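/- **Setting.** Let $\tilde M$ be a simplicial cell complex (each simplex has distinct vertices and each nonempty subset of them spans exactly one of its faces; different simplices may have the same vertices) on which a group $\Gamma$ acts freely, and let $K$ be a $\Gamma$-invariant, finite modulo $\Gamma$, closed triangulation: every simplex lies in a 4-simplex, every 3-simplex lies in exactly two 4-simplices, and the 4-simplices carry a coherent $\Gamma$-invariant orientation. (The case of interest: $\tilde M$ is the universal covering of a triangulated closed oriented PL 4-manifold $M$, $\Gamma=\pi_1(M)$.) Vertices, edges, two-dimensional faces and 4-simplices "of $K$" are counted modulo $\Gamma$. Let $f$ be a homomorphism from $\Gamma$ to the group of proper motions of $\mathbb R^4$, and let $v\mapsto r_v\in\mathbb R^4$ be an $f$-equivariant placement of the vertices for which all 4-simplices considered are nondegenerate. Let $l_a$, $L_a=l_a^2$, $S_i$, $V$ be the resulting lengths of edges, their squares, areas of two-dimensional faces and (positive) volumes of 4-simplices. Regarding the $L_a$ as independent variables, put $\omega_i=-\sum_p\varepsilon_p\,\varphi_i^{(p)} \pmod{2\pi}$, the sum being over the 4-simplices $p$ that contain the face $i$, where $\varphi_i^{(p)}$ is the dihedral angle of $p$ at $i$ and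 $\varepsilon_p=\pm1$ according to whether the placement of $p$ preserves orientation. Let $(\partial\Omega_a/\partial S_i)$ be the transpose of the matrix $(\partial\omega_i/\partial L_a)$, taken at the actual lengths. Consider the sequence $$0\leftarrow\mathfrak a^*\leftarrow(dx\text{ and }dg)^*\leftarrow(d\Omega_a)\xleftarrow{(\partial\Omega_a/\partial S_i)}(dS_i)\leftarrow(d\vec v_a)\leftarrow(d\sigma)\leftarrow(d\sigma)_0\leftarrow0 .$$ Here $(d\Omega_a)$ and $(dS_i)$ are the spaces of real functions on the edges and on the two-dimensional faces of $K$. Vertex deviations $(d\sigma)$ are equivariant families of antisymmetric tensors at the vertices, and $(d\sigma)_0$ is the space of pairs $(\tau,s)$, $\tau$ antisymmetric, for which the family $\tau_{\alpha\beta}+\epsilon_{\alpha\beta\gamma\delta}(r_v)_\gamma s_\delta$ is equivariant, mapped to that family. Edge deviations $(d\vec v_a)$ are equivariant families of vectors orthogonal to the edges, with $(d\vec v_{AB})_\beta=L_{AB}^{-1}\sum_\alpha(\overrightarrow{AB})_\alpha\,(d\sigma_A-d\sigma_B)_{\alpha\beta}$. The map to $(dS_i)$ is $dS_i=\sum_{a\subset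 i}l_a\,\langle n_{a,i},d\vec v_a\rangle$, with $n_{a,i}$ the outer unit normal to the edge $a$ in the plane of $i$; the entries of $(\partial S_i/\partial\vec v_a)$ are taken in any equivariant choice of orthonormal bases of the orthogonal complements of the edges. $\mathfrak a$ is the algebra of infinitesimal motions commuting with $f(\Gamma)$; $(dx\text{ and }dg)$ is the space of displacements of the vertices together with first-order deformations of $f$ taken from any fixed linear space $(dg)$ of such deformations, the placement remaining equivariant to first order; and $(d\Omega_a)\to(dx\text{ and }dg)^*\to\mathfrak a^*$ are the transposes of the natural maps $\mathfrak a\to(dx\text{ and }dg)\to(dL_a)$. The sequence is called acyclic if it is exact in all its terms. For a square submatrix of $(\partial\Omega_a/\partial S_i)$ and one of $(\partial S_i/\partial\vec v_a)$, both denoted by "minor", put $$Q=\frac{\operatorname{minor}(\partial\Omega_a/\partial S_i)}{\operatorname{minor}(\partial S_i/\partial\vec v_a)}\cdot\frac{\prod_{\text{4-simplices}}V\ \prod_{\text{edges}}72\,l^5}{\prod_{\text{2-faces}}S}.$$ **Moves $2\leftrightarrow4$.** Let $K'$ be obtained from $K$ by a move $2\to4$, in which the two 4-simplices $ACDEF$,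 $BCDEF$ with common face $CDEF$ are replaced by the four 4-simplices $ABCDE$, $ABCDF$, $ABCEF$, $ABDEF$ around a new edge $AB$ (with the same induced boundary orientation; the interiors of the clusters are disjoint from their translates by nontrivial elements of $\Gamma$), all 4-simplices of $K$ and $K'$ being nondegenerate. Then the sequence for $K$ is acyclic if and only if the sequence for $K'$ is. Moreover, take any minors of the two matrices for $K$, and form minors for $K'$ by adding the row $AB$ and the column $ABF$ to the minor of $(\partial\Omega_a/\partial S_i)$, and the rows $ABC$, $ABD$, $ABE$ and the three columns of $d\vec v_{AB}$ to the minor of $(\partial S_i/\partial\vec v_a)$. Then each new minor is nonzero if and only if the old one is, and $|Q|$ is the same for $K$ and $K'$. (Read from $K'$ to $K$, this is the statement for moves $4\to2$.) **Moves $3\to3$.** Let $K'$ be obtained from $K$ by a move $3\to3$, in which the three 4-simplices $ABCDE$, $ABCDF$, $ABCEF$ around the face $ABC$ are replaced by the three 4-simplices $ABDEF$, $ACDEF$, $BCDEF$ around the new face $DEF$ (with the same assumptions). Then the sequence for $K$ is acyclic if and only if the sequence for $K'$ is. Moreover, take any minor of $(\partial\Omega_a/\partial S_i)$ for $K$ that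 contains the column $ABC$ once, and form a minor for $K'$ with the same rows and columns, only with the column $ABC$ replaced by $DEF$; and take any minor of $(\partial S_i/\partial\vec v_a)$ that does not contain the row $ABC$, the same one for $K$ and $K'$. Then the new minor of $(\partial\Omega_a/\partial S_i)$ is nonzero if and only if the old one is, and both $\bigl|\operatorname{minor}(\partial\Omega_a/\partial S_i)\prod V/\prod S\bigr|$ and $|Q|$ are the same for $K$ and $K'$. (If the minor of $(\partial S_i/\partial\vec v_a)$ is zero, $Q$ is taken to be $0$.) -/

import Mathlib

open scoped Matrix

noncomputable section

namespace FourManifold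

/-! ### Euclidean four-space and its motions -/

abbrev E4 := EuclideanSpace ℝ (Fin 4)

/-- Motions of Euclidean four-space (a group under composition). -/
abbrev Motion := E4 ≃ᵃⁱ[ℝ] E4

/-- The matrix of the linear part of a motion. -/
def linMatrix (g : Motion) : Matrix (Fin 4) (Fin 4) ℝ :=
  Matrix.of fun i j => g.linearIsometryEquiv (EuclideanSpace.single j 1) i

/-- Antisymmetric tensors `σ_{αβ}`, `α, β = 1, …, 4`. -/
def bivectors : Submodule ℝ (Matrix (Fin 4) (Fin 4) ℝ) where
  carrier := {σ | σᵀ = -σ}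
  add_mem' := by
    intro a b ha hb
    simp only [Set.mem_ofPred_eq, Matrix.transpose_add] at *
    rw [ha, hb, neg_add]
  zero_mem' := by simp
  smul_mem' := by
    intro c a ha
    simp only [Set.mem_ofPred_eq, Matrix.transpose_smul] at *
    rw [ha, smul_neg]

/-- The Lie algebra of infinitesimal motions `x ↦ τ x + s`, `τ` antisymmetric. -/
abbrev MotionAlgebra := bivectors × E4

/-- The velocity at the point `x` of an infinitesimal motion. -/
def velocity (X : MotionAlgebra) (x : E4) : E4 :=
  WithLp.toLp 2 ((X.1 : Matrix (Fin 4) (Fin 4) ℝ) *ᵥ WithLp.ofLp x) + X.2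

lemma velocity_add (X Y : MotionAlgebra) (x : E4) :
    velocity (X + Y) x = velocity X x + velocity Y x := by
  simp only [velocity, Prod.fst_add, Prod.snd_add, Submodule.coe_add, Matrix.add_mulVec,
    WithLp.toLp_add]
  abel

lemma velocity_smul (c : ℝ) (X : MotionAlgebra) (x : E4) :
    velocity (c • X) x = c • velocity X x := by
  simp only [velocity, Prod.smul_fst, Prod.smul_snd, Submodule.coe_smul, Matrix.smul_mulVec,
    WithLp.toLp_smul, smul_add]

@[simp]
lemma velocity_zero (x : E4) : velocity 0 x = 0 := by
  simp [velocity]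

/-- The totally antisymmetric tensor `ε_{αβγδ}`, with `ε_{0123} = 1`. -/
def leviCivita (a b c d : Fin 4) : ℝ :=
  Matrix.det (Matrix.of fun i j : Fin 4 => if ![a, b, c, d] i = j then (1 : ℝ) else 0)

/-- The tensor `τ_{αβ} + ∑ ε_{αβγδ} r_γ s_δ`. -/
def trivialDeviation (X : MotionAlgebra) (r : E4) : Matrix (Fin 4) (Fin 4) ℝ :=
  Matrix.of fun a b => (X.1 : Matrix (Fin 4) (Fin 4) ℝ) a b +
    ∑ c, ∑ d, leviCivita a b c d * r c * X.2 d

/-! ### Simplicial cell complexes with a free group action -/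

/-- Simplices, ordered by "is a face of", glued along faces: the vertices of a simplex are
distinct, and each nonempty set of them spans exactly one of its faces, but two simplices may
have the same vertices.  The group `Γ` acts freely.  (For the universal covering of a
triangulated manifold `M`, `Γ = π₁(M)`; the simplices of `M` are the orbits.) -/
structure SimplicialCells (Γ V C : Type*) [Group Γ] [MulAction Γ V] [MulAction Γ C]
    [PartialOrder C] where
  verts : C → Finset V
  verts_nonempty : ∀ c, (verts c).Nonempty
  verts_mono : ∀ c d, c ≤ d → verts c ⊆ verts d
  face_unique : ∀ (c : C) (s : Finset V), s.Nonempty → s ⊆ verts c →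
    ∃! d : C, d ≤ c ∧ verts d = s
  vertex_unique : ∀ v : V, ∃! c : C, verts c = {v}
  smul_le : ∀ (γ : Γ) (c d : C), c ≤ d → γ • c ≤ γ • d
  verts_smul : ∀ (γ : Γ) (c : C), (verts (γ • c) : Set V) = (fun v => γ • v) '' (verts c : Set V)
  free : ∀ (γ : Γ) (c : C), γ • c = c → γ = 1

section Cells

variable {Γ V C : Type*} [Group Γ] [MulAction Γ V] [MulAction Γ C] [PartialOrder C]

/-- Simplices of the quotient by `Γ`. -/
abbrev Orb (Γ C : Type*) [Group Γ] [MulAction Γ C] := MulAction.orbitRel.Quotient Γ C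

/-- The simplex of the quotient covered by `c`. -/
def orb (Γ : Type*) {C : Type*} [Group Γ] [MulAction Γ C] (c : C) : Orb Γ C :=
  Quotient.mk (MulAction.orbitRel Γ C) c

namespace SimplicialCells

variable (U : SimplicialCells Γ V C)

/-- `x` lists the vertices of `c`, each exactly once. -/
def Enumerates {n : ℕ} (c : C) (x : Fin n → V) : Prop :=
  Function.Injective x ∧ Set.range x = (U.verts c : Set V)

open Classical in
/-- A chosen list of the vertices of an `n`-dimensional simplex. -/
def tuple (n : ℕ) (c : C) : Fin (n + 1) → V :=
  if h : ∃ x : Fin (n + 1) → V, U.Enumerates c x then h.choose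
  else fun _ => (U.verts_nonempty c).choose

open Classical in
/-- A chosen list of the vertices of a 4-simplex `p` that starts with the three vertices of its
two-dimensional face `i`. -/
def flag (p i : C) : Fin 5 → V :=
  if h : ∃ x : Fin 5 → V, U.Enumerates p x ∧ ({x 0, x 1, x 2} : Set V) = (U.verts i : Set V)
  then h.choose
  else fun _ => (U.verts_nonempty p).choose

open Classical in
/-- The face of `c` with vertex set `s`. -/
def face (c : C) (s : Set V) : C :=
  if h : ∃ d, d ≤ c ∧ (U.verts d : Set V) = s then h.choose else c

lemma tuple_spec {n : ℕ} {c : C} (h : (U.verts c).card = n + 1) :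
    U.Enumerates c (U.tuple n c) := by
  have hex : ∃ x : Fin (n + 1) → V, U.Enumerates c x := by
    refine ⟨fun k => ((U.verts c).equivFinOfCardEq h).symm k, ?_, ?_⟩
    · intro a b hab
      exact ((U.verts c).equivFinOfCardEq h).symm.injective (Subtype.ext hab)
    · ext v
      constructor
      · rintro ⟨k, rfl⟩
        exact (((U.verts c).equivFinOfCardEq h).symm k).2
      · intro hv
        exact ⟨(U.verts c).equivFinOfCardEq h ⟨v, hv⟩, by simp⟩
  rw [tuple, dif_pos hex]
  exact hex.choose_spec

lemma tuple_one_pair {a : C} (h : (U.verts a).card = 2) {A B : V}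
    (hs : (U.verts a : Set V) = {A, B}) :
    (U.tuple 1 a 0 = A ∧ U.tuple 1 a 1 = B) ∨ (U.tuple 1 a 0 = B ∧ U.tuple 1 a 1 = A) := by
  obtain ⟨hinj, hr⟩ := U.tuple_spec (n := 1) h
  have h0 : U.tuple 1 a 0 ∈ ({A, B} : Set V) := by
    rw [← hs, ← hr]; exact ⟨0, rfl⟩
  have h1 : U.tuple 1 a 1 ∈ ({A, B} : Set V) := by
    rw [← hs, ← hr]; exact ⟨1, rfl⟩
  have hne : U.tuple 1 a 0 ≠ U.tuple 1 a 1 := fun e => by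
    have := hinj e
    simp at this
  simp only [Set.mem_insert_iff, Set.mem_singleton_iff] at h0 h1
  rcases h0 with h0 | h0 <;> rcases h1 with h1 | h1
  · exact absurd (h0.trans h1.symm) hne
  · exact Or.inl ⟨h0, h1⟩
  · exact Or.inr ⟨h0, h1⟩
  · exact absurd (h0.trans h1.symm) hne

end SimplicialCells

/-- A `Γ`-invariant subcomplex of `U`, finite modulo `Γ`, in which every simplex is a face of a
4-simplex and every three-dimensional simplex is a face of exactly two 4-simplices, with a
`Γ`-invariant coherent orientation of the 4-simplices: `orient p x = ±1` according to whether
the ordering `x` of the vertices of `p` is positive. -/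
structure Triangulation (U : SimplicialCells Γ V C) where
  cells : Set C
  lower : ∀ c d, d ≤ c → c ∈ cells → d ∈ cells
  smul_mem : ∀ (γ : Γ) c, c ∈ cells → γ • c ∈ cells
  finite_orbits : (orb Γ '' cells).Finite
  pure : ∀ c ∈ cells, ∃ p ∈ cells, c ≤ p ∧ (U.verts p).card = 5
  dim_le : ∀ c ∈ cells, (U.verts c).card ≤ 5
  closed : ∀ t ∈ cells, (U.verts t).card = 4 →
    {p | p ∈ cells ∧ (U.verts p).card = 5 ∧ t ≤ p}.ncard = 2
  orient : C → (Fin 5 → V) → ℤˣ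
  orient_perm : ∀ p ∈ cells, ∀ x : Fin 5 → V, U.Enumerates p x → ∀ π : Equiv.Perm (Fin 5),
    orient p (x ∘ π) = Equiv.Perm.sign π * orient p x
  orient_smul : ∀ p ∈ cells, ∀ x : Fin 5 → V, U.Enumerates p x → ∀ γ : Γ,
    orient (γ • p) (fun k => γ • x k) = orient p x
  orient_coherent : ∀ p ∈ cells, ∀ q ∈ cells, p ≠ q → ∀ t : C, t ≤ p → t ≤ q →
    ∀ (w : Fin 4 → V) (a b : V), U.Enumerates t w →
      U.Enumerates p (Fin.cons a w : Fin 5 → V) → U.Enumerates q (Fin.cons b w : Fin 5 → V) →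
      orient p (Fin.cons a w) = -orient q (Fin.cons b w)

namespace Triangulation

variable {U : SimplicialCells Γ V C} (K : Triangulation U)

/-- The `n`-dimensional simplices of the covering. -/
def simplices (n : ℕ) : Set C := {c | c ∈ K.cells ∧ (U.verts c).card = n + 1}

def vertices : Set V := {v | ∃ c ∈ K.cells, v ∈ U.verts c}

/-- The `n`-dimensional simplices of the triangulated manifold itself. -/
def orbits (n : ℕ) : Set (Orb Γ C) := orb Γ '' K.simplices n

instance instFintypeOrbits (n : ℕ) : Fintype (K.orbits n) :=
  (K.finite_orbits.subset (Set.image_mono fun _ h => h.1)).fintype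

end Triangulation

/-! ### Placing the vertices in Euclidean space -/

/-- A representation of `Γ` by proper motions, and an equivariant placement of the vertices. -/
structure Development (Γ V : Type*) [Group Γ] [MulAction Γ V] where
  hol : Γ →* Motion
  proper : ∀ γ, LinearMap.det ((hol γ).linearIsometryEquiv.toLinearEquiv : E4 →ₗ[ℝ] E4) = 1
  pos : V → E4
  pos_smul : ∀ γ v, pos (γ • v) = hol γ (pos v)

namespace Development

variable (P : Development Γ V) (U : SimplicialCells Γ V C)

/-- Every 4-simplex of the triangulation is placed as a nondegenerate 4-simplex. -/
def Nondegenerate {U : SimplicialCells Γ V C} (K : Triangulation U) : Prop :=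
  ∀ p ∈ K.simplices 4, AffineIndependent ℝ fun v : U.verts p => P.pos v

/-- Length of an edge. -/
def length (a : C) : ℝ := dist (P.pos (U.tuple 1 a 0)) (P.pos (U.tuple 1 a 1))

/-- Area of a two-dimensional face. -/
def area (i : C) : ℝ :=
  let u := P.pos (U.tuple 2 i 1) - P.pos (U.tuple 2 i 0)
  let w := P.pos (U.tuple 2 i 2) - P.pos (U.tuple 2 i 0)
  Real.sqrt (‖u‖ ^ 2 * ‖w‖ ^ 2 - (inner ℝ u w) ^ 2) / 2

/-- The determinant of the four edge vectors of a 4-simplex issuing from its first vertex. -/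
def edgeDet (x : Fin 5 → V) : ℝ :=
  Matrix.det (Matrix.of fun i j : Fin 4 => (P.pos (x i.succ) - P.pos (x 0)) j)

/-- Volume of a 4-simplex. -/
def volume (p : C) : ℝ := |P.edgeDet (U.tuple 4 p)| / 24

end Development

/-! ### Deficit angles -/

/-- The interior dihedral angle, at the two-dimensional face `012`, of a Euclidean 4-simplex
`01234` with squared edge lengths `d a b`.  With vertex `0` as the origin, `g` gives the inner
products of the edge vectors; `D a b` is, up to the factor `4 S²` (`S` the area of `012`), the
inner product of the components of the vectors `a` and `b` orthogonal to the plane `012`. -/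
def dihedralAngle (d : Fin 5 → Fin 5 → ℝ) : ℝ :=
  let g : Fin 5 → Fin 5 → ℝ := fun a b => (d 0 a + d 0 b - d a b) / 2
  let D : Fin 5 → Fin 5 → ℝ := fun a b =>
    Matrix.det !![g 1 1, g 1 2, g 1 b; g 2 1, g 2 2, g 2 b; g a 1, g a 2, g a b]
  Real.arccos (D 3 4 / Real.sqrt (D 3 3 * D 4 4))

open Classical in
/-- The squared length of the edge `uw` of `p`, for given squared lengths `L` of all edges. -/
def edgeVar (U : SimplicialCells Γ V C) (L : Orb Γ C → ℝ) (p : C) (u w : V) : ℝ :=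
  if u = w then 0 else L (orb Γ (U.face p {u, w}))

section Deficit

variable {U : SimplicialCells Γ V C} (K : Triangulation U) (P : Development Γ V)

/-- `1` if the placement of the 4-simplex `p` in space respects the orientation, else `-1`. -/
def simplexSign (p : C) : ℝ :=
  ((K.orient p (U.tuple 4 p) : ℤ) : ℝ) * Real.sign (P.edgeDet (U.tuple 4 p))

/-- The deficit angle (a number modulo `2π`; this is a representative) at the two-dimensional
face `i`, as a function of the squared lengths `L` of the edges, which are independent variables:
minus the sum of the dihedral angles at `i`, with signs. -/
def deficit (L : Orb Γ C → ℝ) (i : C) : ℝ :=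
  -∑ᶠ p ∈ {p | p ∈ K.simplices 4 ∧ i ≤ p},
    simplexSign K P p * dihedralAngle fun m n => edgeVar U L p (U.flag p i m) (U.flag p i n)

/-- The actual squared lengths. -/
def sqLength (U : SimplicialCells Γ V C) (P : Development Γ V) (a : Orb Γ C) : ℝ :=
  P.length U a.out ^ 2

open Classical in
/-- The partial derivative `∂ω_i / ∂L_a`, at the actual squared lengths. -/
def deficitDeriv (i a : Orb Γ C) : ℝ :=
  deriv (fun t => deficit K P (Function.update (sqLength U P) a t) i.out) (sqLength U P a)

/-- The matrix `(∂Ω_a / ∂S_i)`, the conjugate (transpose) of `(∂ω_i / ∂L_a)`; rows are edges,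
columns are two-dimensional faces. -/
def omegaMatrix : Matrix (Orb Γ C) (Orb Γ C) ℝ := Matrix.of fun a i => deficitDeriv K P i a

end Deficit

/-! ### Edge and vertex deviations -/

section Deviations

variable (U : SimplicialCells Γ V C) (P : Development Γ V)

/-- The differential of the area of the two-dimensional face `i` due to edge deviations `v`:
the sum, over the three edges of `i`, of the length times the component of the deviation along
the outer normal to the edge in the plane of `i`.  (Equivalently: each vertex of the medial
triangle of `i` is moved by the deviation of its edge, and the area variation of the medial
triangle is multiplied by `4`.) -/
def areaVariation (v : C → E4) (i : C) : ℝ :=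
  ∑ k : Fin 3,
    let x := U.tuple 2 i
    let A := P.pos (x k)
    let B := P.pos (x (k + 1))
    let D := P.pos (x (k + 2))
    let h := (B - A) - (inner ℝ (B - A) (D - B) / ‖D - B‖ ^ 2) • (D - B)
    ‖D - B‖ * inner ℝ (‖h‖⁻¹ • h) (v (U.face i {x (k + 1), x (k + 2)}))

/-- The deviation `(dv)_β = L⁻¹ ∑_α l_α (σ_A - σ_B)_{αβ}` of the edge `AB`,
`l` being the vector `AB` and `L = ∑ l_α²`. -/
def edgeDeviation (σ : V → Matrix (Fin 4) (Fin 4) ℝ) (A B : V) : E4 :=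
  (‖P.pos B - P.pos A‖ ^ 2)⁻¹ •
    WithLp.toLp 2 (WithLp.ofLp (P.pos B - P.pos A) ᵥ* (σ A - σ B))

lemma edgeDeviation_symm (σ : V → Matrix (Fin 4) (Fin 4) ℝ) (A B : V) :
    edgeDeviation P σ A B = edgeDeviation P σ B A := by
  unfold edgeDeviation
  rw [norm_sub_rev (P.pos B) (P.pos A), ← neg_sub (P.pos A) (P.pos B), ← neg_sub (σ B) (σ A),
    WithLp.ofLp_neg, Matrix.neg_vecMul, Matrix.vecMul_neg, neg_neg]

lemma linMatrix_mulVec (g : Motion) (x : E4) :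
    linMatrix g *ᵥ WithLp.ofLp x = WithLp.ofLp (g.linearIsometryEquiv x) := by
  have hx : x = ∑ j, x j • EuclideanSpace.single j (1 : ℝ) := by
    ext i
    simp [Finset.sum_apply, Pi.single_apply]
  ext i
  conv_rhs => rw [hx]
  simp [linMatrix, Matrix.mulVec, dotProduct, mul_comm]

lemma linMatrix_orthogonal (g : Motion) : (linMatrix g)ᵀ * linMatrix g = 1 := by
  ext i j
  have h := g.linearIsometryEquiv.inner_map_map (EuclideanSpace.single i (1 : ℝ))
    (EuclideanSpace.single j (1 : ℝ))
  simp only [PiLp.inner_apply, RCLike.inner_apply, conj_trivial] at h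
  simp only [Matrix.mul_apply, Matrix.transpose_apply, linMatrix, Matrix.of_apply]
  rw [Finset.sum_congr rfl fun x _ => mul_comm _ _, h]
  simp [Matrix.one_apply, eq_comm]

lemma pos_sub_smul (γ : Γ) (A B : V) :
    P.pos (γ • B) - P.pos (γ • A) = (P.hol γ).linearIsometryEquiv (P.pos B - P.pos A) := by
  rw [P.pos_smul, P.pos_smul]
  exact ((P.hol γ).map_vsub _ _).symm

lemma edgeDeviation_smul (σ : V → Matrix (Fin 4) (Fin 4) ℝ) (γ : Γ) (A B : V)
    (hA : σ (γ • A) = linMatrix (P.hol γ) * σ A * (linMatrix (P.hol γ))ᵀ)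
    (hB : σ (γ • B) = linMatrix (P.hol γ) * σ B * (linMatrix (P.hol γ))ᵀ) :
    edgeDeviation P σ (γ • A) (γ • B) =
      (P.hol γ).linearIsometryEquiv (edgeDeviation P σ A B) := by
  have hR := linMatrix_orthogonal (P.hol γ)
  unfold edgeDeviation
  rw [pos_sub_smul, LinearIsometryEquiv.norm_map, map_smul, hA, hB]
  congr 1
  apply WithLp.ofLp_injective 2
  rw [← linMatrix_mulVec (P.hol γ) (WithLp.toLp 2 _), ← linMatrix_mulVec]
  simp only
  rw [← Matrix.sub_mul, ← Matrix.mul_sub, ← Matrix.vecMul_transpose, ← Matrix.vecMul_transpose,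
    Matrix.vecMul_vecMul, Matrix.vecMul_vecMul]
  congr 1
  rw [← Matrix.mul_assoc, ← Matrix.mul_assoc, hR, Matrix.one_mul]

lemma inner_edgeDeviation (σ : V → Matrix (Fin 4) (Fin 4) ℝ) (A B : V)
    (hA : σ A ∈ bivectors) (hB : σ B ∈ bivectors) :
    inner ℝ (edgeDeviation P σ A B) (P.pos B - P.pos A) = 0 := by
  have hM : (σ A - σ B)ᵀ = -(σ A - σ B) := bivectors.sub_mem hA hB
  unfold edgeDeviation
  rw [inner_smul_left]
  have key : inner ℝ (WithLp.toLp 2 (WithLp.ofLp (P.pos B - P.pos A) ᵥ* (σ A - σ B)) : E4)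
      (P.pos B - P.pos A) = 0 := by
    set M := σ A - σ B
    set l := WithLp.ofLp (P.pos B - P.pos A)
    have e : (inner ℝ (WithLp.toLp 2 (l ᵥ* M) : E4) (P.pos B - P.pos A) : ℝ) = l ⬝ᵥ (l ᵥ* M) := by
      simp [PiLp.inner_apply, dotProduct, l]
    have e1 : l ⬝ᵥ (l ᵥ* M) = -(l ⬝ᵥ (l ᵥ* M)) := by
      conv_lhs => rw [← Matrix.mulVec_transpose, hM, Matrix.neg_mulVec, dotProduct_neg,
        Matrix.dotProduct_mulVec, dotProduct_comm]
    rw [e]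
    linarith
  rw [key, mul_zero]

end Deviations

/-! ### The spaces and maps of the complex -/

section Complex

variable {U : SimplicialCells Γ V C} (K : Triangulation U) (P : Development Γ V)

/-- The space `(dσ)` of vertex deviations: equivariant families of bivectors at the vertices. -/
def vertexDeviations : Submodule ℝ (V → Matrix (Fin 4) (Fin 4) ℝ) where
  carrier := {σ | (∀ v, v ∉ K.vertices → σ v = 0) ∧ (∀ v, σ v ∈ bivectors) ∧
    ∀ γ v, σ (γ • v) = linMatrix (P.hol γ) * σ v * (linMatrix (P.hol γ))ᵀ}
  add_mem' := by
    rintro a b ⟨ha, ha', ha''⟩ ⟨hb, hb', hb''⟩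
    refine ⟨fun v hv => by simp [ha v hv, hb v hv],
      fun v => bivectors.add_mem (ha' v) (hb' v), fun γ v => ?_⟩
    simp [ha'', hb'', Matrix.mul_add, Matrix.add_mul]
  zero_mem' := ⟨fun _ _ => rfl, fun _ => bivectors.zero_mem, fun _ _ => by simp⟩
  smul_mem' := by
    rintro c a ⟨ha, ha', ha''⟩
    refine ⟨fun v hv => by simp [ha v hv],
      fun v => bivectors.smul_mem c (ha' v), fun γ v => ?_⟩
    simp [ha'']

/-- The space `(dv)` of edge deviations: equivariant families of vectors at the edges, each
orthogonal to its edge. -/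
def edgeDeviations : Submodule ℝ (C → E4) where
  carrier := {v | (∀ a, a ∉ K.simplices 1 → v a = 0) ∧
    (∀ a ∈ K.simplices 1, inner ℝ (v a) (P.pos (U.tuple 1 a 1) - P.pos (U.tuple 1 a 0)) = 0) ∧
    ∀ γ a, v (γ • a) = (P.hol γ).linearIsometryEquiv (v a)}
  add_mem' := by
    rintro a b ⟨ha, ha', ha''⟩ ⟨hb, hb', hb''⟩
    refine ⟨fun v hv => by simp [ha v hv, hb v hv],
      fun v hv => by simp [inner_add_left, ha' v hv, hb' v hv], fun γ v => by simp [ha'', hb'']⟩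
  zero_mem' := ⟨fun _ _ => rfl, fun _ _ => by simp, fun _ _ => by simp⟩
  smul_mem' := by
    rintro c a ⟨ha, ha', ha''⟩
    refine ⟨fun v hv => by simp [ha v hv],
      fun v hv => by simp [inner_smul_left, ha' v hv], fun γ v => by simp [ha'']⟩

open Classical in
/-- The family of tensors `τ + ε r_v s` at the vertices `v`. -/
def trivialFamily : MotionAlgebra →ₗ[ℝ] (V → Matrix (Fin 4) (Fin 4) ℝ) where
  toFun X := fun v => if v ∈ K.vertices then trivialDeviation X (P.pos v) else 0
  map_add' X Y := by
    funext v
    by_cases hv : v ∈ K.vertices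
    · ext a b
      simp only [hv, if_true, Pi.add_apply, trivialDeviation, Matrix.of_apply, Matrix.add_apply,
        Prod.fst_add, Prod.snd_add, Submodule.coe_add, PiLp.add_apply, mul_add,
        Finset.sum_add_distrib]
      ring
    · simp [hv]
  map_smul' c X := by
    funext v
    by_cases hv : v ∈ K.vertices
    · ext a b
      simp only [hv, if_true, Pi.smul_apply, trivialDeviation, Matrix.of_apply, Matrix.smul_apply,
        Prod.smul_fst, Prod.smul_snd, Submodule.coe_smul, PiLp.smul_apply, smul_eq_mul,
        RingHom.id_apply, mul_add, Finset.mul_sum]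
      congr 1
      refine Finset.sum_congr rfl fun _ _ => Finset.sum_congr rfl fun _ _ => ?_
      ring
    · simp [hv]

/-- The space `(dσ)₀`: those `(τ, s)` for which `τ + ε r_v s` is an equivariant family, that is,
correctly defines a deviation of every vertex of the manifold. -/
def trivialDeviations : Submodule ℝ MotionAlgebra :=
  (vertexDeviations K P).comap (trivialFamily K P)

/-- `(dσ)₀ → (dσ)`. -/
def mapTrivial : trivialDeviations K P →ₗ[ℝ] vertexDeviations K P :=
  (trivialFamily K P).restrict fun _ h => h

open Classical in
lemma edgeDeviation_mem (σ : vertexDeviations K P) :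
    (fun a => if a ∈ K.simplices 1 then
      edgeDeviation P σ.1 (U.tuple 1 a 0) (U.tuple 1 a 1) else 0) ∈ edgeDeviations K P := by
  obtain ⟨σ, _, hb, he⟩ := σ
  refine ⟨fun a ha => by simp [ha], fun a ha => ?_, fun γ a => ?_⟩
  · simp only [ha, if_true]
    exact inner_edgeDeviation P σ _ _ (hb _) (hb _)
  · have hcard : (U.verts (γ • a)).card = (U.verts a).card := by
      rw [← Set.ncard_coe_finset, ← Set.ncard_coe_finset, U.verts_smul]
      exact Set.ncard_image_of_injective _ (MulAction.injective γ)
    have hmem : γ • a ∈ K.simplices 1 ↔ a ∈ K.simplices 1 := by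
      constructor
      · rintro ⟨h1, h2⟩
        exact ⟨by simpa using K.smul_mem γ⁻¹ _ h1, hcard ▸ h2⟩
      · rintro ⟨h1, h2⟩
        exact ⟨K.smul_mem γ _ h1, hcard.trans h2⟩
    by_cases ha : a ∈ K.simplices 1
    · simp only [hmem.2 ha, ha, if_true]
      have hs : (U.verts (γ • a) : Set V) = {γ • U.tuple 1 a 0, γ • U.tuple 1 a 1} := by
        rw [U.verts_smul, ← (U.tuple_spec (n := 1) ha.2).2]
        ext v
        simp [eq_comm]
      have main := edgeDeviation_smul P σ γ (U.tuple 1 a 0) (U.tuple 1 a 1) (he γ _) (he γ _)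
      rcases U.tuple_one_pair (hmem.2 ha).2 hs with ⟨h0, h1⟩ | ⟨h0, h1⟩
      · rw [h0, h1, main]
      · rw [h0, h1, edgeDeviation_symm, main]
    · simp [hmem, ha]

open Classical in
/-- `(dσ) → (dv)`. -/
def mapVertexEdge : vertexDeviations K P →ₗ[ℝ] edgeDeviations K P where
  toFun σ := ⟨_, edgeDeviation_mem K P σ⟩
  map_add' σ τ := by
    ext1
    funext a
    by_cases ha : a ∈ K.simplices 1
    · simp only [ha, if_true, Submodule.coe_add, Pi.add_apply, edgeDeviation]
      rw [add_sub_add_comm, Matrix.vecMul_add, WithLp.toLp_add, smul_add]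
    · simp [ha]
  map_smul' c σ := by
    ext1
    funext a
    by_cases ha : a ∈ K.simplices 1
    · simp only [ha, if_true, Submodule.coe_smul, Pi.smul_apply, edgeDeviation, RingHom.id_apply]
      rw [← smul_sub, Matrix.vecMul_smul, WithLp.toLp_smul, smul_comm]
    · simp [ha]

/-- `(dv) → (dS)`. -/
def mapEdgeArea : edgeDeviations K P →ₗ[ℝ] (K.orbits 2 → ℝ) where
  toFun v := fun i => areaVariation U P v.1 i.1.out
  map_add' v w := by
    funext i
    simp only [areaVariation, Submodule.coe_add, Pi.add_apply, inner_add_right, mul_add,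
      Finset.sum_add_distrib]
  map_smul' c v := by
    funext i
    simp only [areaVariation, Submodule.coe_smul, Pi.smul_apply, inner_smul_right, smul_eq_mul,
      RingHom.id_apply, Finset.mul_sum]
    refine Finset.sum_congr rfl fun _ _ => ?_
    ring

/-- `(dS) → (dΩ)`. -/
def mapAreaOmega : (K.orbits 2 → ℝ) →ₗ[ℝ] (K.orbits 1 → ℝ) :=
  Matrix.mulVecLin ((omegaMatrix K P).submatrix Subtype.val Subtype.val)

/-- The algebra `𝔞` of infinitesimal motions that commute with all motions of the
representation, i.e. are invariant under them as vector fields. -/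
def commutingMotions : Submodule ℝ MotionAlgebra where
  carrier := {X | ∀ (γ : Γ) (x : E4),
    velocity X (P.hol γ x) = (P.hol γ).linearIsometryEquiv (velocity X x)}
  add_mem' := by
    intro a b ha hb γ x
    simp only [velocity_add, map_add, ha γ x, hb γ x]
  zero_mem' := by
    intro γ x
    simp
  smul_mem' := by
    intro c a ha γ x
    simp only [velocity_smul, map_smul, ha γ x]

/-- First-order deformations of the representation: `z` is the derivative, at `ε = 0`, of a
deformation `γ ↦ (1 + ε z(γ)) ∘ hol γ` that is a homomorphism to first order in `ε`. -/
def cocycles : Submodule ℝ (Γ → MotionAlgebra) where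
  carrier := {z | ∀ (γ δ : Γ) (x : E4), velocity (z (γ * δ)) (P.hol γ x) =
    velocity (z γ) (P.hol γ x) + (P.hol γ).linearIsometryEquiv (velocity (z δ) x)}
  add_mem' := by
    intro a b ha hb γ δ x
    simp only [Pi.add_apply, velocity_add, map_add, ha γ δ x, hb γ δ x]
    abel
  zero_mem' := by
    intro γ δ x
    simp
  smul_mem' := by
    intro c a ha γ δ x
    simp only [Pi.smul_apply, velocity_smul, map_smul, ha γ δ x, smul_add]

variable (dg : Submodule ℝ (Γ → MotionAlgebra))

/-- The space `(dx and dg)`: first-order deformations `z`, in the given space `dg`, of the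
representation, together with displacements `dx` of the vertices that keep the placement
equivariant (to first order) with respect to the deformed representation. -/
def displacements : Submodule ℝ ((V → E4) × (Γ → MotionAlgebra)) where
  carrier := {y | (∀ v, v ∉ K.vertices → y.1 v = 0) ∧ y.2 ∈ dg ∧
    ∀ v ∈ K.vertices, ∀ γ : Γ, y.1 (γ • v) =
      velocity (y.2 γ) (P.pos (γ • v)) + (P.hol γ).linearIsometryEquiv (y.1 v)}
  add_mem' := by
    rintro a b ⟨ha, ha', ha''⟩ ⟨hb, hb', hb''⟩
    refine ⟨fun v hv => by simp [ha v hv, hb v hv], dg.add_mem ha' hb', fun v hv γ => ?_⟩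
    simp only [Prod.fst_add, Prod.snd_add, Pi.add_apply, velocity_add, map_add, ha'' v hv γ,
      hb'' v hv γ]
    abel
  zero_mem' := ⟨fun _ _ => rfl, dg.zero_mem, fun _ _ _ => by simp⟩
  smul_mem' := by
    rintro c a ⟨ha, ha', ha''⟩
    refine ⟨fun v hv => by simp [ha v hv], dg.smul_mem c ha', fun v hv γ => ?_⟩
    simp only [Prod.smul_fst, Prod.smul_snd, Pi.smul_apply, velocity_smul, map_smul, ha'' v hv γ,
      smul_add]

open Classical in
lemma motion_mem (X : commutingMotions P) :
    ((fun v => if v ∈ K.vertices then velocity X.1 (P.pos v) else 0, 0) :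
      (V → E4) × (Γ → MotionAlgebra)) ∈ displacements K P dg := by
  refine ⟨fun v hv => by simp [hv], dg.zero_mem, fun v hv γ => ?_⟩
  have hγ : γ • v ∈ K.vertices := by
    obtain ⟨c, hc, hvc⟩ := hv
    refine ⟨γ • c, K.smul_mem γ c hc, ?_⟩
    have : γ • v ∈ (U.verts (γ • c) : Set V) := by
      rw [U.verts_smul]
      exact ⟨v, hvc, rfl⟩
    exact this
  simp only [hv, hγ, if_true, Pi.zero_apply, velocity_zero, zero_add, P.pos_smul]
  exact X.2 γ (P.pos v)

open Classical in
/-- `𝔞 → (dx and dg)`. -/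
def mapMotion : commutingMotions P →ₗ[ℝ] displacements K P dg where
  toFun X := ⟨_, motion_mem K P dg X⟩
  map_add' X Y := by
    ext1
    refine Prod.ext ?_ (by simp)
    funext v
    by_cases hv : v ∈ K.vertices <;> simp [hv, velocity_add]
  map_smul' c X := by
    ext1
    refine Prod.ext ?_ (by simp)
    funext v
    by_cases hv : v ∈ K.vertices <;> simp [hv, velocity_smul]

/-- `(dx and dg) → (dL)`, the differential of the squared edge lengths. -/
def mapLength : displacements K P dg →ₗ[ℝ] (K.orbits 1 → ℝ) where
  toFun y := fun a =>
    let x := U.tuple 1 a.1.out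
    2 * inner ℝ (P.pos (x 1) - P.pos (x 0)) (y.1.1 (x 1) - y.1.1 (x 0))
  map_add' y z := by
    funext a
    simp only [Submodule.coe_add, Prod.fst_add, Pi.add_apply]
    rw [add_sub_add_comm, inner_add_right, mul_add]
  map_smul' c y := by
    funext a
    simp only [Submodule.coe_smul, Prod.smul_fst, Pi.smul_apply, RingHom.id_apply, smul_eq_mul]
    rw [← smul_sub, inner_smul_right]
    ring

/-- `(dΩ) → (dx and dg)*`, the transpose of `(dx and dg) → (dL)`. -/
def mapOmegaDual : (K.orbits 1 → ℝ) →ₗ[ℝ] Module.Dual ℝ (displacements K P dg) :=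
  ∑ a : K.orbits 1, (LinearMap.proj a : (K.orbits 1 → ℝ) →ₗ[ℝ] ℝ).smulRight
    ((LinearMap.proj a : (K.orbits 1 → ℝ) →ₗ[ℝ] ℝ) ∘ₗ mapLength K P dg)

/-- Exactness of the sequence
`0 ← 𝔞* ← (dx and dg)* ← (dΩ) ← (dS) ← (dv) ← (dσ) ← (dσ)₀ ← 0`, in all its terms. -/
structure Acyclic : Prop where
  injective : Function.Injective (mapTrivial K P)
  exact_vertex : Function.Exact (mapTrivial K P) (mapVertexEdge K P)
  exact_edge : Function.Exact (mapVertexEdge K P) (mapEdgeArea K P)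
  exact_area : Function.Exact (mapEdgeArea K P) (mapAreaOmega K P)
  exact_omega : Function.Exact (mapAreaOmega K P) (mapOmegaDual K P dg)
  exact_displacement : Function.Exact (mapOmegaDual K P dg) (mapMotion K P dg).dualMap
  surjective : Function.Surjective (mapMotion K P dg).dualMap

end Complex

/-! ### Minors and the conserved quantity -/

section Minors

variable (U : SimplicialCells Γ V C) (P : Development Γ V)

/-- Orthonormal bases of the orthogonal complements of the edges, chosen equivariantly; they
are the bases in which the components of edge deviations are taken. -/
def IsFrame (u : C → Fin 3 → E4) : Prop :=
  (∀ a, (U.verts a).card = 2 → Orthonormal ℝ (u a) ∧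
    ∀ k, inner ℝ (u a k) (P.pos (U.tuple 1 a 1) - P.pos (U.tuple 1 a 0)) = 0) ∧
  ∀ (γ : Γ) a k, u (γ • a) k = (P.hol γ).linearIsometryEquiv (u a k)

open Classical in
/-- The matrix `(∂S_i / ∂v_a)` in the bases `u`: rows are two-dimensional faces, columns are
pairs of an edge and one of the three components of its deviation. -/
def areaMatrix (u : C → Fin 3 → E4) : Matrix (Orb Γ C) (Orb Γ C × Fin 3) ℝ :=
  Matrix.of fun i b =>
    areaVariation U P (fun a => if orb Γ a = b.1 then u a b.2 else 0) i.out

/-- The product of the volumes of all 4-simplices. -/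
def prodVolume {U : SimplicialCells Γ V C} (K : Triangulation U) : ℝ :=
  ∏ p : K.orbits 4, P.volume U p.1.out

/-- The product of the areas of all two-dimensional faces. -/
def prodArea {U : SimplicialCells Γ V C} (K : Triangulation U) : ℝ :=
  ∏ i : K.orbits 2, P.area U i.1.out

/-- The product of `72 l⁵` over all edges. -/
def prodEdge {U : SimplicialCells Γ V C} (K : Triangulation U) : ℝ :=
  ∏ a : K.orbits 1, 72 * P.length U a.1.out ^ 5

/-- The minor of `(∂Ω_a / ∂S_i)` with rows (edges) `a` and columns (faces) `i`. -/
def minorOmega {U : SimplicialCells Γ V C} (K : Triangulation U) {ι : Type*} [Fintype ι]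
    [DecidableEq ι] (a i : ι → Orb Γ C) : ℝ :=
  ((omegaMatrix K P).submatrix a i).det

/-- The minor of `(∂S_i / ∂v_a)` with rows (faces) `i` and columns (edge components) `b`. -/
def minorArea (u : C → Fin 3 → E4) {κ : Type*} [Fintype κ] [DecidableEq κ]
    (i : κ → Orb Γ C) (b : κ → Orb Γ C × Fin 3) : ℝ :=
  ((areaMatrix U P u).submatrix i b).det

/-- `minor(∂Ω/∂S) / minor(∂S/∂v) · ∏ V · ∏ 72 l⁵ / ∏ S`, for given values `m`, `n` of the
minors. -/
def quantity {U : SimplicialCells Γ V C} (K : Triangulation U) (m n : ℝ) : ℝ :=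
  m / n * (prodVolume P K * prodEdge P K / prodArea P K)

end Minors

/-! ### Pachner moves -/

/-- `K'` is obtained from `K` by a move.  `D` is a 5-simplex with vertices `x 0, …, x 5`; the
boundary of `D` is the union of two clusters of 4-simplices: those opposite to the `x j` with
`j ∈ J`, which belong to `K`, and those opposite to the `x j` with `j ∉ J`, which belong to `K'`.
Apart from (the translates of) the clusters, `K` and `K'` are the same; the interiors of the
clusters do not meet their own translates; and the new 4-simplices are oriented so as to induce
the same orientation of the common boundary of the clusters as the old ones. -/
structure IsMove {U : SimplicialCells Γ V C} (K K' : Triangulation U) (D : C) (x : Fin 6 → V)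
    (J : Finset (Fin 6)) : Prop where
  enumerates : U.Enumerates D x
  mem_old : ∀ c, c < D → (c ∈ K.cells ↔ ∃ j ∈ J, x j ∉ U.verts c)
  mem_new : ∀ c, c < D → (c ∈ K'.cells ↔ ∃ j ∉ J, x j ∉ U.verts c)
  outside : ∀ c, (∀ γ : Γ, ¬ c ≤ γ • D) → (c ∈ K.cells ↔ c ∈ K'.cells)
  embedded : ∀ c, c ≤ D → ((∀ j ∈ J, x j ∈ U.verts c) ∨ (∀ j ∉ J, x j ∈ U.verts c)) →
    ∀ γ : Γ, γ • c ≤ D → γ = 1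
  orient_outside : ∀ p ∈ K.simplices 4, p ∈ K'.simplices 4 → ∀ y : Fin 5 → V,
    U.Enumerates p y → K.orient p y = K'.orient p y
  orient_boundary : ∀ p ∈ K.simplices 4, ∀ p' ∈ K'.simplices 4, p < D → p' < D →
    ∀ t : C, t ≤ p → t ≤ p' → ∀ (w : Fin 4 → V) (a b : V), U.Enumerates t w →
      U.Enumerates p (Fin.cons a w : Fin 5 → V) → U.Enumerates p' (Fin.cons b w : Fin 5 → V) →
      K.orient p (Fin.cons a w) = K'.orient p' (Fin.cons b w)

end Cells

end FourManifold

namespace FourManifold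

/-! The boundary of the 5-simplex `D` is the union of the old and the new cluster. Its six vertices
are placed in four-space at points r_k, so they satisfy one affine relation ∑ δ_k = 0, ∑ δ_k r_k =
0. The coefficients δ_k (`dependency`) are, up to sign, 24 times the volumes of the facets of `D`,
and nondegeneracy makes all of them nonzero. Everything below is driven by this relation.

Coherence of the orientations implies that the move changes the deficit angle at a triangle by one
common sign times the sum, over all facets j of `D` at that triangle, of sign(δ_j) times the
dihedral angle (`deficit_sub_deficit`). When the squared lengths are varied independently near the
flat configuration, the derivative of this sum factorises, because the Gram determinants involved
have δ as null vector: for the triangle s and the edge kl it is (S_s / ∏_{m ∉ s} δ_m) · δ_k δ_l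
(`hasDerivAt_sum_dihedralAngle`). Hence the matrices (∂Ω/∂S) of `K` and `K'` differ by a rank-one
matrix c w uᵀ (`omegaMatrix_move`), where w is `edgeWeight` and u is `faceWeight`; contributions of
edges or faces of `D` identified by `Γ` are added.

The same affine relation gives two orthogonality statements: ∑ w_a dL_a = 0 for all displacements
(`sum_edgeWeight`), and ∑ u_i dS_i = 0 for all edge deviations (`IsEdgeField.sum_faceWeight`). On
functions S of the faces with ∑ u_i S_i = 0 the operators of `K` and `K'` agree.

For moves 3 → 3 vertices and edges stay the same, and u is nonzero at the lost and at the gained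
triangle. A function on the faces of one triangulation is therefore adjusted at the triangle absent
from it so that ∑ u_i S_i = 0, which transfers exactness (`IsMove.elementwiseAcyclic_of_replace`).
For moves 2 → 4 the new row of (∂Ω/∂S) is c w_{AB} u, so it imposes ∑ u_i S_i = 0. The three
components of the new edge deviation determine three of the four new area variations through an
invertible 3×3 matrix, and the relation determines the fourth; on the side of the edges, the new
length variation is expressed by the others through w (`IsMove.elementwiseAcyclic_iff`).

For the minors, column operations remove the rank-one term and leave explicit factors
(`det_border_rank_one`, `det_replace_column`). The minor of (∂S/∂v) acquires the determinant of the
3×3 block (`IsMove.abs_det_newEdgeMatrix`). These factors are compensated by the changes of the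
products of volumes, areas and 72 l⁵, the numerical constants cancelling because 8 · 72 = 24². -/

/-! ### Volumes of Euclidean simplices and the affine dependency of six points -/

/-- The determinant of the edge vectors issuing from the first of five points. -/
def simplexDet (y : Fin 5 → E4) : ℝ :=
  Matrix.det (Matrix.of fun i j : Fin 4 => (y i.succ - y 0) j)

/-- Subtracting the first row from the others clears the column of ones. The homogeneous form treats
the five points alike, which is what the permutation rule and the Laplace expansion below need. -/
lemma simplexDet_eq_det (y : Fin 5 → E4) :
    simplexDet y = Matrix.det (Matrix.of fun i : Fin 5 => (Fin.cons 1 (y i) : Fin 5 → ℝ)) := by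
  have h : Matrix.det (Matrix.of fun i : Fin 5 => (Fin.cons 1 (y i) : Fin 5 → ℝ)) =
      Matrix.det (Matrix.of (Fin.cons (Fin.cons 1 (y 0) : Fin 5 → ℝ)
        fun i : Fin 4 => (Fin.cons 0 (y i.succ - y 0).ofLp : Fin 5 → ℝ)) :
        Matrix (Fin 5) (Fin 5) ℝ) := by
    refine Matrix.det_eq_of_forall_row_eq_smul_add_const (Fin.cons 0 fun _ => 1) 0 rfl ?_
    intro i j
    refine Fin.cases ?_ (fun i => ?_) i <;> refine Fin.cases ?_ (fun j => ?_) j <;> simp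
  rw [h, Matrix.det_succ_column_zero, Fin.sum_univ_succ]
  simp only [Matrix.of_apply, Fin.cons_zero, Fin.cons_succ, mul_zero, zero_mul, mul_one,
    Finset.sum_const_zero, add_zero, Fin.val_zero, pow_zero, one_mul]
  rfl

lemma simplexDet_comp_perm (y : Fin 5 → E4) (π : Equiv.Perm (Fin 5)) :
    simplexDet (y ∘ π) = Equiv.Perm.sign π * simplexDet y := by
  rw [simplexDet_eq_det, simplexDet_eq_det, ← Matrix.det_permute]
  rfl

/-- The coefficients of the affine dependency of six points of four-space: up to sign, the
determinants of the 4-simplices opposite to the points. -/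
def dependency (y : Fin 6 → E4) (k : Fin 6) : ℝ :=
  Matrix.det (Matrix.of fun i : Fin 6 =>
    (Fin.cons (if i = k then 1 else 0) (Fin.cons 1 (y i)) : Fin 6 → ℝ))

/-- Laplace expansion along the first column. If `f` repeats another column the determinant
vanishes; taking for `f` the constant 1 or a coordinate yields the affine relation of the six
points. -/
lemma det_cons_eq_sum (y : Fin 6 → E4) (f : Fin 6 → ℝ) :
    Matrix.det (Matrix.of fun i : Fin 6 =>
      (Fin.cons (f i) (Fin.cons 1 (y i)) : Fin 6 → ℝ)) =
      ∑ k, f k * ((-1) ^ (k : ℕ) * simplexDet (y ∘ k.succAbove)) := by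
  rw [Matrix.det_succ_column_zero]
  refine Finset.sum_congr rfl fun k _ => ?_
  rw [simplexDet_eq_det]
  simp only [Matrix.of_apply, Fin.cons_zero]
  rw [mul_comm _ (f k), mul_assoc]
  rfl

lemma dependency_eq (y : Fin 6 → E4) (k : Fin 6) :
    dependency y k = (-1) ^ (k : ℕ) * simplexDet (y ∘ k.succAbove) := by
  rw [dependency, det_cons_eq_sum y fun i => if i = k then 1 else 0]
  simp

lemma sum_dependency (y : Fin 6 → E4) : ∑ k, dependency y k = 0 := by
  have h := det_cons_eq_sum y fun _ => 1
  rw [Matrix.det_zero_of_column_eq (i := 0) (j := 1) (by decide) (by intro k; rfl)] at h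
  simp only [dependency_eq]
  simpa using h.symm

lemma sum_dependency_smul (y : Fin 6 → E4) : ∑ k, dependency y k • y k = 0 := by
  ext j
  have h := det_cons_eq_sum y fun i => y i j
  rw [Matrix.det_zero_of_column_eq (i := 0) (j := j.succ.succ)
    (Fin.succ_ne_zero _).symm (by intro k; rfl)] at h
  simp only [dependency_eq]
  simpa [mul_comm] using h.symm

lemma dependency_comp_perm (y : Fin 6 → E4) (π : Equiv.Perm (Fin 6)) (k : Fin 6) :
    dependency (y ∘ π) k = Equiv.Perm.sign π * dependency y (π k) := by
  rw [dependency, dependency, ← Matrix.det_permute]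
  congr 1
  ext i j
  simp [Matrix.submatrix]

lemma sum_dependency_smul_sub (y : Fin 6 → E4) (z : E4) :
    ∑ k, dependency y k • (y k - z) = 0 := by
  simp only [smul_sub, Finset.sum_sub_distrib, sum_dependency_smul, ← Finset.sum_smul,
    sum_dependency, zero_smul, sub_zero]

lemma linearIndependent_of_simplexDet_ne_zero {y : Fin 5 → E4} (h : simplexDet y ≠ 0)
    (v : E4) (hv : ∀ i : Fin 4, inner ℝ (y i.succ - y 0) v = (0 : ℝ)) : v = 0 := by
  have := Matrix.eq_zero_of_mulVec_eq_zero h (v := v.ofLp) (by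
    ext i
    have := hv i
    simpa [Matrix.mulVec, dotProduct, PiLp.inner_apply, mul_comm] using this)
  ext i
  exact congrFun this i

/-! ### Areas of triangles -/

/-- The area of a triangle. -/
def triangleArea (a b c : E4) : ℝ :=
  Real.sqrt (‖b - a‖ ^ 2 * ‖c - a‖ ^ 2 - (inner ℝ (b - a) (c - a)) ^ 2) / 2

lemma gram_nonneg (u w : E4) : 0 ≤ ‖u‖ ^ 2 * ‖w‖ ^ 2 - (inner ℝ u w) ^ 2 := by
  have := real_inner_mul_inner_self_le u w
  rw [real_inner_self_eq_norm_sq, real_inner_self_eq_norm_sq] at this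
  nlinarith

lemma triangleArea_sq (a b c : E4) :
    (2 * triangleArea a b c) ^ 2 = ‖b - a‖ ^ 2 * ‖c - a‖ ^ 2 - (inner ℝ (b - a) (c - a)) ^ 2 := by
  rw [triangleArea, mul_div_cancel₀ _ two_ne_zero, Real.sq_sqrt (gram_nonneg _ _)]

lemma triangleArea_swap (a b c : E4) : triangleArea a c b = triangleArea a b c := by
  rw [triangleArea, triangleArea, real_inner_comm, mul_comm]

lemma triangleArea_rotate (a b c : E4) : triangleArea b c a = triangleArea a b c := by
  rw [triangleArea, triangleArea]
  have h1 : c - b = (c - a) - (b - a) := by abel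
  have h2 : a - b = -(b - a) := by abel
  rw [h1, h2, norm_neg, inner_neg_right, inner_sub_left, real_inner_self_eq_norm_sq,
    norm_sub_sq_real, real_inner_comm]
  congr 2
  ring

lemma gram_pos_of_simplexDet_ne_zero {y : Fin 5 → E4} (h : simplexDet y ≠ 0) :
    0 < ‖y 1 - y 0‖ ^ 2 * ‖y 2 - y 0‖ ^ 2 - (inner ℝ (y 1 - y 0) (y 2 - y 0)) ^ 2 := by
  have key : ∀ c : Fin 4 → ℝ, c ≠ 0 → ∑ i : Fin 4, c i • (y i.succ - y 0) ≠ 0 := by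
    intro c hc h0
    refine hc (Matrix.eq_zero_of_vecMul_eq_zero h ?_)
    ext j
    have := congrArg (fun z : E4 => z j) h0
    simpa [Matrix.vecMul, dotProduct] using this
  refine lt_of_le_of_ne (gram_nonneg _ _) fun h0 => ?_
  have h2 : y 2 - y 0 ≠ 0 := by
    have := key (Pi.single 1 1) (by simp)
    simpa [Fin.sum_univ_four] using this
  -- With p, q the two edge vectors, ‖q‖² p − ⟨p, q⟩ q has squared norm ‖q‖² times the Gram
  -- determinant, so it would vanish together with it.
  have h1 := key ![‖y 2 - y 0‖ ^ 2, -inner ℝ (y 1 - y 0) (y 2 - y 0), 0, 0] (by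
    intro hz
    have := congrFun hz 0
    simp at this
    exact h2 this)
  simp only [Fin.sum_univ_four, Matrix.cons_val_zero, Matrix.cons_val_one, Fin.succ_zero_eq_one,
    Fin.succ_one_eq_two, Matrix.cons_val, zero_smul, add_zero] at h1
  apply h1
  rw [← norm_eq_zero, ← sq_eq_zero_iff, neg_smul, ← sub_eq_add_neg, norm_sub_sq_real, norm_smul,
    norm_smul, inner_smul_left, inner_smul_right]
  simp only [Real.norm_eq_abs, mul_pow, sq_abs, conj_trivial]
  linear_combination -‖y 2 - y 0‖ ^ 2 * h0

lemma triangleArea_pos {y : Fin 5 → E4} (h : simplexDet y ≠ 0) :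
    0 < triangleArea (y 0) (y 1) (y 2) := by
  rw [triangleArea]
  have := Real.sqrt_pos.2 (gram_pos_of_simplexDet_ne_zero h)
  linarith

/-! ### The derivative of a dihedral angle -/

section FaceMinor

variable {ι : Type*}

/-- The Gram matrix, with respect to the base point `o`, of points with squared distances `e`. -/
def gramEntry (e : ι → ι → ℝ) (o a b : ι) : ℝ := (e o a + e o b - e a b) / 2

/-- The determinant of scalar products through which the dihedral angle at the face `opq` is
defined. -/
def faceMinor (e : ι → ι → ℝ) (o p q b c : ι) : ℝ :=
  Matrix.det !![gramEntry e o p p, gramEntry e o p q, gramEntry e o p c;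
    gramEntry e o q p, gramEntry e o q q, gramEntry e o q c;
    gramEntry e o b p, gramEntry e o b q, gramEntry e o b c]

lemma dihedralAngle_eq (d : Fin 5 → Fin 5 → ℝ) :
    dihedralAngle d = Real.arccos (faceMinor d 0 1 2 3 4 /
      Real.sqrt (faceMinor d 0 1 2 3 3 * faceMinor d 0 1 2 4 4)) := rfl

lemma faceMinor_comp {κ : Type*} (e : ι → ι → ℝ) (y : κ → ι) (o p q b c : κ) :
    faceMinor (fun m n => e (y m) (y n)) o p q b c = faceMinor e (y o) (y p) (y q) (y b) (y c) :=
  rfl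

/-- The linear part of `faceMinor` at `e`. -/
def faceMinorDeriv (e e' : ι → ι → ℝ) (o p q b c : ι) : ℝ :=
  gramEntry e' o p p * (gramEntry e o q q * gramEntry e o b c -
      gramEntry e o q c * gramEntry e o b q) +
    gramEntry e o p p * (gramEntry e' o q q * gramEntry e o b c +
      gramEntry e o q q * gramEntry e' o b c - gramEntry e' o q c * gramEntry e o b q -
      gramEntry e o q c * gramEntry e' o b q) -
    gramEntry e' o p q * (gramEntry e o q p * gramEntry e o b c -
      gramEntry e o q c * gramEntry e o b p) -
    gramEntry e o p q * (gramEntry e' o q p * gramEntry e o b c +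
      gramEntry e o q p * gramEntry e' o b c - gramEntry e' o q c * gramEntry e o b p -
      gramEntry e o q c * gramEntry e' o b p) +
    gramEntry e' o p c * (gramEntry e o q p * gramEntry e o b q -
      gramEntry e o q q * gramEntry e o b p) +
    gramEntry e o p c * (gramEntry e' o q p * gramEntry e o b q +
      gramEntry e o q p * gramEntry e' o b q - gramEntry e' o q q * gramEntry e o b p -
      gramEntry e o q q * gramEntry e' o b p)

variable {e : ℝ → ι → ι → ℝ} {e' : ι → ι → ℝ} {t : ℝ}

lemma hasDerivAt_gramEntry (he : ∀ k l, HasDerivAt (fun s => e s k l) (e' k l) t) (o a b : ι) :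
    HasDerivAt (fun s => gramEntry (e s) o a b) (gramEntry e' o a b) t :=
  (((he o a).add (he o b)).sub (he a b)).div_const 2

lemma hasDerivAt_faceMinor (he : ∀ k l, HasDerivAt (fun s => e s k l) (e' k l) t)
    (o p q b c : ι) :
    HasDerivAt (fun s => faceMinor (e s) o p q b c) (faceMinorDeriv (e t) e' o p q b c) t := by
  have h := hasDerivAt_gramEntry he o
  simp only [faceMinor, Matrix.det_fin_three, Matrix.of_apply, Matrix.cons_val', Matrix.cons_val,
    Matrix.cons_val_zero, Matrix.cons_val_one]
  have := ((((((h p p).mul (h q q)).mul (h b c)).sub (((h p p).mul (h q c)).mul (h b q))).sub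
    (((h p q).mul (h q p)).mul (h b c))).add (((h p q).mul (h q c)).mul (h b p))).add
    (((h p c).mul (h q p)).mul (h b q)) |>.sub (((h p c).mul (h q q)).mul (h b p))
  refine this.congr_deriv ?_
  simp only [faceMinorDeriv, Pi.mul_apply]
  ring

end FaceMinor

/-- The logarithmic derivatives of `g` and `h` are kept apart because they cancel when three angles
around a face are added. Positivity of g h − f² keeps the argument of the arccosine away from ±1. -/
lemma hasDerivAt_arccos_div_sqrt {f g h : ℝ → ℝ} {f' g' h' t : ℝ} (hf : HasDerivAt f f' t)
    (hg : HasDerivAt g g' t) (hh : HasDerivAt h h' t) (hpos : 0 < g t * h t - f t ^ 2) :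
    HasDerivAt (fun s => Real.arccos (f s / Real.sqrt (g s * h s)))
      (-(f' - f t * (g' / g t + h' / h t) / 2) / Real.sqrt (g t * h t - f t ^ 2)) t := by
  have hgh : 0 < g t * h t := by nlinarith [sq_nonneg (f t)]
  have hg0 : g t ≠ 0 := left_ne_zero_of_mul hgh.ne'
  have hh0 : h t ≠ 0 := right_ne_zero_of_mul hgh.ne'
  set R := Real.sqrt (g t * h t) with hR
  have hRpos : 0 < R := Real.sqrt_pos.2 hgh
  have hR2 : R ^ 2 = g t * h t := Real.sq_sqrt hgh.le
  have hx : 1 - (f t / R) ^ 2 = (g t * h t - f t ^ 2) / R ^ 2 := by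
    rw [div_pow, hR2]; field_simp
  have hxpos : 0 < 1 - (f t / R) ^ 2 := by rw [hx]; positivity
  have h1 : f t / R ≠ -1 := fun h => by rw [h] at hxpos; norm_num at hxpos
  have h2 : f t / R ≠ 1 := fun h => by rw [h] at hxpos; norm_num at hxpos
  have hs := ((hg.mul hh).sqrt hgh.ne')
  have hq := hf.div hs hRpos.ne'
  have := (Real.hasDerivAt_arccos h1 h2).comp t hq
  refine this.congr_deriv ?_
  simp only [Pi.mul_apply]
  rw [← hR, hx, Real.sqrt_div hpos.le, Real.sqrt_sq hRpos.le]
  have hT := Real.sqrt_pos.2 hpos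
  set T := Real.sqrt (g t * h t - f t ^ 2)
  have : g' * h t + g t * h' = R ^ 2 * (g' / g t + h' / h t) := by
    rw [hR2]; field_simp
  rw [this]
  field_simp

/-! ### Gram determinants of Euclidean simplices and the derivative of one dihedral angle -/

section Flat

variable {ι : Type*}

lemma gramEntry_of_dist {e : ι → ι → ℝ} {y : ι → E4} (he : ∀ k l, e k l = ‖y k - y l‖ ^ 2)
    (o a b : ι) : gramEntry e o a b = inner ℝ (y a - y o) (y b - y o) := by
  have h : y a - y b = (y a - y o) - (y b - y o) := by abel
  rw [gramEntry, he, he, he, h, norm_sub_rev (y o) (y a), norm_sub_rev (y o) (y b),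
    norm_sub_sq_real (y a - y o)]
  ring

/-- The Desnanot–Jacobi identity for a symmetric matrix. The corner block is to be the Gram matrix
of the face, so the minors defining the angle are tied to the Gram determinant of the whole simplex.
-/
lemma desnanot_jacobi_gram (a b c d f g h i j k : ℝ) :
    (a * b - c ^ 2) * Matrix.det !![a, c, d, f; c, b, g, h; d, g, i, j; f, h, j, k] =
      Matrix.det !![a, c, d; c, b, g; d, g, i] * Matrix.det !![a, c, f; c, b, h; f, h, k] -
      Matrix.det !![a, c, f; c, b, h; d, g, j] ^ 2 := by
  simp [Matrix.det_succ_row_zero, Fin.sum_univ_succ, Fin.succAbove]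
  ring

lemma simplexDet_sq (y : Fin 5 → E4) :
    simplexDet y ^ 2 = Matrix.det (Matrix.of fun i j : Fin 4 =>
      (inner ℝ (y i.succ - y 0) (y j.succ - y 0) : ℝ)) := by
  rw [sq, simplexDet]
  conv_lhs => rw [← Matrix.det_transpose]
  rw [Matrix.det_transpose]
  nth_rewrite 2 [← Matrix.det_transpose]
  rw [← Matrix.det_mul]
  congr 1
  ext i j
  simp [Matrix.mul_apply, PiLp.inner_apply, mul_comm]

/-- This is the numerator of sin² of the dihedral angle. Its being the square of 2S times 24 times
the volume puts area and volume in the denominator of the derivative of the angle. -/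
lemma faceMinor_mul_sub_sq {e : Fin 5 → Fin 5 → ℝ} {y : Fin 5 → E4}
    (he : ∀ k l, e k l = ‖y k - y l‖ ^ 2) :
    faceMinor e 0 1 2 3 3 * faceMinor e 0 1 2 4 4 - faceMinor e 0 1 2 3 4 ^ 2 =
      (2 * triangleArea (y 0) (y 1) (y 2) * simplexDet y) ^ 2 := by
  rw [mul_pow, triangleArea_sq, simplexDet_sq, ← real_inner_self_eq_norm_sq,
    ← real_inner_self_eq_norm_sq]
  simp only [faceMinor, gramEntry_of_dist he]
  have h := desnanot_jacobi_gram (inner ℝ (y 1 - y 0) (y 1 - y 0))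
    (inner ℝ (y 2 - y 0) (y 2 - y 0)) (inner ℝ (y 1 - y 0) (y 2 - y 0))
    (inner ℝ (y 1 - y 0) (y 3 - y 0)) (inner ℝ (y 1 - y 0) (y 4 - y 0))
    (inner ℝ (y 2 - y 0) (y 3 - y 0)) (inner ℝ (y 2 - y 0) (y 4 - y 0))
    (inner ℝ (y 3 - y 0) (y 3 - y 0)) (inner ℝ (y 3 - y 0) (y 4 - y 0))
    (inner ℝ (y 4 - y 0) (y 4 - y 0))
  rw [real_inner_comm (y 1 - y 0) (y 2 - y 0), real_inner_comm (y 1 - y 0) (y 3 - y 0),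
    real_inner_comm (y 1 - y 0) (y 4 - y 0), real_inner_comm (y 2 - y 0) (y 3 - y 0),
    real_inner_comm (y 2 - y 0) (y 4 - y 0), ← h]
  congr 2
  ext i j
  fin_cases i <;> fin_cases j <;> first
    | rfl
    | (simp; done)
    | (simp; exact real_inner_comm _ _)

variable {e : ℝ → Fin 5 → Fin 5 → ℝ} {e' : Fin 5 → Fin 5 → ℝ} {t : ℝ} {y : Fin 5 → E4}

/-- Only at `t` need the distances come from actual points; nearby they are independent variables.
The points `y` serve to evaluate the square root in the denominator. -/
lemma hasDerivAt_dihedralAngle (he : ∀ k l, HasDerivAt (fun s => e s k l) (e' k l) t)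
    (ht : ∀ k l, e t k l = ‖y k - y l‖ ^ 2) (hy : simplexDet y ≠ 0) :
    HasDerivAt (fun s => dihedralAngle (e s))
      (-(faceMinorDeriv (e t) e' 0 1 2 3 4 - faceMinor (e t) 0 1 2 3 4 *
        (faceMinorDeriv (e t) e' 0 1 2 3 3 / faceMinor (e t) 0 1 2 3 3 +
          faceMinorDeriv (e t) e' 0 1 2 4 4 / faceMinor (e t) 0 1 2 4 4) / 2) /
        (2 * triangleArea (y 0) (y 1) (y 2) * |simplexDet y|)) t := by
  have hS := triangleArea_pos hy
  have hm := faceMinor_mul_sub_sq ht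
  have := hasDerivAt_arccos_div_sqrt (hasDerivAt_faceMinor he 0 1 2 3 4)
    (hasDerivAt_faceMinor he 0 1 2 3 3) (hasDerivAt_faceMinor he 0 1 2 4 4)
    (by rw [hm]; positivity)
  rw [hm, Real.sqrt_sq_eq_abs, abs_mul, abs_of_pos (by positivity)] at this
  exact this

/-- The 3×3 matrix with rows (g11, g12, p1), (g21, g22, p2), (q1, q2, r) has the vector (l1, l2, 1)
as left and right null vector. Its adjugate is therefore g11 g22 − g12 g21 times the dyadic square
of this vector, and Jacobi's formula for the derivative of a determinant gives the quadratic form on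
the right. -/
lemma bordered_deriv {g11 g12 g21 g22 p1 p2 q1 q2 r l1 l2 : ℝ} (h11 h12 h21 h22 h1 h2 k1 k2 s : ℝ)
    (hp1 : l1 * g11 + l2 * g12 + p1 = 0) (hp2 : l1 * g21 + l2 * g22 + p2 = 0)
    (hq1 : l1 * g11 + l2 * g21 + q1 = 0) (hq2 : l1 * g12 + l2 * g22 + q2 = 0)
    (hr : l1 * p1 + l2 * p2 + r = 0) :
    h11 * (g22 * r - p2 * q2) +
    g11 * (h22 * r + g22 * s - h2 * q2 - p2 * k2) -
    h12 * (g21 * r - p2 * q1) -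
    g12 * (h21 * r + g21 * s - h2 * q1 - p2 * k1) +
    h1 * (g21 * q2 - g22 * q1) +
    p1 * (h21 * q2 + g21 * k2 - h22 * q1 - g22 * k1) =
    (g11 * g22 - g12 * g21) * (s + l1 * h1 + l2 * h2 + l1 * k1 + l2 * k2 + l1 ^ 2 * h11 +
      l1 * l2 * h12 + l1 * l2 * h21 + l2 ^ 2 * h22) := by
  obtain rfl : p1 = -(l1 * g11 + l2 * g12) := by linarith
  obtain rfl : p2 = -(l1 * g21 + l2 * g22) := by linarith
  obtain rfl : q1 = -(l1 * g11 + l2 * g21) := by linarith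
  obtain rfl : q2 = -(l1 * g12 + l2 * g22) := by linarith
  obtain rfl : r = -(l1 * -(l1 * g11 + l2 * g12) + l2 * -(l1 * g21 + l2 * g22)) := by linarith
  ring

end Flat

/-- Sum over three pairs of indices of the signed derivatives of the dihedral angles. -/
lemma sum_angle_deriv {D D' : Fin 3 → Fin 3 → ℝ} {n : Fin 3 → ℝ} {S : ℝ} (hS : S ≠ 0)
    (hn : ∀ k, n k ≠ 0) (hD : ∀ k, D k k ≠ 0)
    (h0 : ∀ c, ∑ b, n b * D b c = 0) (hDs : ∀ b c, D b c = D c b)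
    (hDs' : ∀ b c, D' b c = D' c b) :
    -(D' 1 2 - D 1 2 * (D' 1 1 / D 1 1 + D' 2 2 / D 2 2) / 2) / (2 * S * n 0) +
    -(D' 0 2 - D 0 2 * (D' 0 0 / D 0 0 + D' 2 2 / D 2 2) / 2) / (2 * S * n 1) +
    -(D' 0 1 - D 0 1 * (D' 0 0 / D 0 0 + D' 1 1 / D 1 1) / 2) / (2 * S * n 2) =
      -(∑ b, ∑ c, n b * n c * D' b c) / (4 * S * (n 0 * n 1 * n 2)) := by
  have e0 := h0 0
  have e1 := h0 1
  have e2 := h0 2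
  simp only [Fin.sum_univ_three] at e0 e1 e2 ⊢
  rw [hDs 1 0, hDs 2 0] at e0
  rw [hDs 2 1] at e1
  rw [hDs' 1 0, hDs' 2 0, hDs' 2 1]
  have n0 := hn 0
  have n1 := hn 1
  have n2 := hn 2
  -- Naming the logarithmic derivatives x_k = D'_kk / D_kk keeps `D k k` out of the denominators.
  obtain ⟨x0, hx0⟩ : ∃ x, x = D' 0 0 / D 0 0 := ⟨_, rfl⟩
  obtain ⟨x1, hx1⟩ : ∃ x, x = D' 1 1 / D 1 1 := ⟨_, rfl⟩
  obtain ⟨x2, hx2⟩ : ∃ x, x = D' 2 2 / D 2 2 := ⟨_, rfl⟩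
  rw [← hx0, ← hx1, ← hx2]
  rw [eq_div_iff (hD _)] at hx0 hx1 hx2
  rw [← hx0, ← hx1, ← hx2]
  field_simp
  -- All terms with x_k, including n_k² D'_kk from the right-hand side, add up to a multiple of n_k
  -- x_k ∑ n_b D_bk, which is zero.
  linear_combination 4 * (n 0 * x0 * e0 + n 1 * x1 * e1 + n 2 * x2 * e2)

/-! ### The sum of three dihedral angles around a face for six points of four-space -/

section SixPoints

variable {e : ℝ → Fin 6 → Fin 6 → ℝ} {e' : Fin 6 → Fin 6 → ℝ} {t : ℝ} {y : Fin 6 → E4}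

lemma sum_dependency_gram {d : Fin 6 → Fin 6 → ℝ} (hd : ∀ k l, d k l = ‖y k - y l‖ ^ 2)
    (c : Fin 6) :
    dependency y 1 * gramEntry d 0 1 c + dependency y 2 * gramEntry d 0 2 c +
      dependency y 3 * gramEntry d 0 3 c + dependency y 4 * gramEntry d 0 4 c +
      dependency y 5 * gramEntry d 0 5 c = 0 := by
  have := congrArg (fun z => (inner ℝ z (y c - y 0) : ℝ)) (sum_dependency_smul_sub y (y 0))
  rw [sum_inner] at this
  simp only [inner_smul_left, Fin.sum_univ_six, sub_self, inner_zero_left, mul_zero,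
    zero_add, conj_trivial] at this
  simp only [gramEntry_of_dist hd]
  exact this

/-- Since ∑ l_k = 0, eliminating l_0 makes the terms with the base point 0 agree on both sides. The
result is a form in the squared distances that singles out no base point. -/
lemma sum_gram_deriv {l : Fin 6 → ℝ} (hl : ∑ k, l k = 0) (hs : ∀ k m, e' k m = e' m k)
    (h0 : ∀ k, e' k k = 0) :
    ∑ k : Fin 5, ∑ m : Fin 5, l k.succ * l m.succ * gramEntry e' 0 k.succ m.succ =
      -(1 / 2 * ∑ k, ∑ m, l k * l m * e' k m) := by
  rw [Fin.sum_univ_succ] at hl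
  have hl0 : l 0 = -∑ k : Fin 5, l k.succ := by linarith
  have h1 : ∑ k, ∑ m, l k * l m * e' k m = 2 * (l 0 * ∑ k : Fin 5, l k.succ * e' 0 k.succ) +
      ∑ k : Fin 5, ∑ m : Fin 5, l k.succ * l m.succ * e' k.succ m.succ := by
    simp only [Fin.sum_univ_succ (n := 5), Finset.sum_add_distrib, h0, hs _ 0]
    rw [Finset.mul_sum]
    have h2 : ∀ k : Fin 5, l k.succ * l 0 * e' 0 k.succ = l 0 * (l k.succ * e' 0 k.succ) :=
      fun k => by ring
    simp only [h2, mul_assoc]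
    ring
  rw [h1, hl0]
  have h3 : ∀ k m : Fin 5, l k.succ * l m.succ * gramEntry e' 0 k.succ m.succ =
      1 / 2 * ((l k.succ * e' 0 k.succ) * l m.succ + l k.succ * (l m.succ * e' 0 m.succ) -
        l k.succ * l m.succ * e' k.succ m.succ) := fun k m => by rw [gramEntry]; ring
  simp only [h3, ← Finset.mul_sum, Finset.sum_add_distrib, Finset.sum_sub_distrib,
    ← Finset.sum_mul]
  ring

lemma faceMinor_symm {ι : Type*} {d : ι → ι → ℝ} (hd : ∀ k l, d k l = d l k) (o p q b c : ι) :
    faceMinor d o p q b c = faceMinor d o p q c b := by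
  have hg : ∀ a b, gramEntry d o a b = gramEntry d o b a := fun a b => by
    rw [gramEntry, gramEntry, hd a b]; ring
  simp only [faceMinor, Matrix.det_fin_three, Matrix.of_apply, Matrix.cons_val', Matrix.cons_val,
    Matrix.cons_val_zero, Matrix.cons_val_one]
  rw [hg b p, hg b q, hg b c, hg p c, hg q c, hg q p]
  ring

lemma faceMinorDeriv_symm {ι : Type*} {d d' : ι → ι → ℝ} (hd : ∀ k l, d k l = d l k)
    (hd' : ∀ k l, d' k l = d' l k) (o p q b c : ι) :
    faceMinorDeriv d d' o p q b c = faceMinorDeriv d d' o p q c b := by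
  have hg : ∀ a b, gramEntry d o a b = gramEntry d o b a := fun a b => by
    rw [gramEntry, gramEntry, hd a b]; ring
  have hg' : ∀ a b, gramEntry d' o a b = gramEntry d' o b a := fun a b => by
    rw [gramEntry, gramEntry, hd' a b]; ring
  simp only [faceMinorDeriv]
  rw [hg b p, hg b q, hg b c, hg p c, hg q c, hg q p, hg' b p, hg' b q, hg' b c, hg' p c,
    hg' q c, hg' q p]
  ring

/-- The face minor is linear in its last row, that of the point b. Summed over all six points with
weights δ_b these rows cancel, and the points 0, 1, 2 contribute nothing, their rows being zero or
repeated. -/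
lemma sum_dependency_faceMinor {d : Fin 6 → Fin 6 → ℝ} (hd : ∀ k l, d k l = ‖y k - y l‖ ^ 2)
    (c : Fin 6) :
    ∑ b : Fin 3, dependency y (![3, 4, 5] b) * faceMinor d 0 1 2 (![3, 4, 5] b) c = 0 := by
  have H1 := sum_dependency_gram hd 1
  have H2 := sum_dependency_gram hd 2
  have Hc := sum_dependency_gram hd c
  simp only [Fin.sum_univ_three, Matrix.cons_val_zero, Matrix.cons_val_one, Matrix.cons_val]
  simp only [faceMinor, Matrix.det_fin_three, Matrix.of_apply, Matrix.cons_val', Matrix.cons_val,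
    Matrix.cons_val_zero, Matrix.cons_val_one]
  linear_combination (gramEntry d 0 1 2 * gramEntry d 0 2 c -
    gramEntry d 0 1 c * gramEntry d 0 2 2) * H1 -
    (gramEntry d 0 1 1 * gramEntry d 0 2 c - gramEntry d 0 1 c * gramEntry d 0 2 1) * H2 +
    (gramEntry d 0 1 1 * gramEntry d 0 2 2 - gramEntry d 0 1 2 * gramEntry d 0 2 1) * Hc

lemma gramEntry_comm {ι : Type*} {d : ι → ι → ℝ} (hd : ∀ k l, d k l = d l k) (o a b : ι) :
    gramEntry d o a b = gramEntry d o b a := by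
  rw [gramEntry, gramEntry, hd a b]
  ring

/-- Linearity in both points folds 3, 4, 5 into the single vector ∑ δ_b (y_b − y_0), which by the
affine relation equals −δ_1 (y_1 − y_0) − δ_2 (y_2 − y_0). Thus `bordered_deriv` applies with null
vector (δ_1, δ_2, 1). -/
lemma sum_faceMinorDeriv {d : Fin 6 → Fin 6 → ℝ} (hd : ∀ k l, d k l = ‖y k - y l‖ ^ 2) :
    ∑ b : Fin 3, ∑ c : Fin 3, dependency y (![3, 4, 5] b) * dependency y (![3, 4, 5] c) *
      faceMinorDeriv d e' 0 1 2 (![3, 4, 5] b) (![3, 4, 5] c) =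
      (2 * triangleArea (y 0) (y 1) (y 2)) ^ 2 * ∑ k : Fin 5, ∑ m : Fin 5,
        dependency y k.succ * dependency y m.succ * gramEntry e' 0 k.succ m.succ := by
  have hes : ∀ k l, d k l = d l k := fun k l => by rw [hd, hd, norm_sub_rev]
  have hG : (2 * triangleArea (y 0) (y 1) (y 2)) ^ 2 = gramEntry d 0 1 1 *
      gramEntry d 0 2 2 - gramEntry d 0 1 2 * gramEntry d 0 2 1 := by
    rw [triangleArea_sq, gramEntry_comm hes 0 2 1]
    simp only [gramEntry_of_dist hd, real_inner_self_eq_norm_sq]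
    ring
  rw [hG]
  have key := bordered_deriv (g11 := gramEntry d 0 1 1) (g12 := gramEntry d 0 1 2)
    (g21 := gramEntry d 0 2 1) (g22 := gramEntry d 0 2 2)
    (p1 := ∑ c, dependency y ((![3, 4, 5] : Fin 3 → Fin 6) c) * gramEntry d 0 1 ((![3, 4, 5] : Fin 3 → Fin 6) c))
    (p2 := ∑ c, dependency y ((![3, 4, 5] : Fin 3 → Fin 6) c) * gramEntry d 0 2 ((![3, 4, 5] : Fin 3 → Fin 6) c))
    (q1 := ∑ c, dependency y ((![3, 4, 5] : Fin 3 → Fin 6) c) * gramEntry d 0 ((![3, 4, 5] : Fin 3 → Fin 6) c) 1)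
    (q2 := ∑ c, dependency y ((![3, 4, 5] : Fin 3 → Fin 6) c) * gramEntry d 0 ((![3, 4, 5] : Fin 3 → Fin 6) c) 2)
    (r := ∑ b, ∑ c, dependency y ((![3, 4, 5] : Fin 3 → Fin 6) b) * dependency y ((![3, 4, 5] : Fin 3 → Fin 6) c) *
      gramEntry d 0 ((![3, 4, 5] : Fin 3 → Fin 6) b) ((![3, 4, 5] : Fin 3 → Fin 6) c))
    (l1 := dependency y 1) (l2 := dependency y 2)
    (gramEntry e' 0 1 1) (gramEntry e' 0 1 2) (gramEntry e' 0 2 1) (gramEntry e' 0 2 2)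
    (∑ c, dependency y ((![3, 4, 5] : Fin 3 → Fin 6) c) * gramEntry e' 0 1 ((![3, 4, 5] : Fin 3 → Fin 6) c))
    (∑ c, dependency y ((![3, 4, 5] : Fin 3 → Fin 6) c) * gramEntry e' 0 2 ((![3, 4, 5] : Fin 3 → Fin 6) c))
    (∑ c, dependency y ((![3, 4, 5] : Fin 3 → Fin 6) c) * gramEntry e' 0 ((![3, 4, 5] : Fin 3 → Fin 6) c) 1)
    (∑ c, dependency y ((![3, 4, 5] : Fin 3 → Fin 6) c) * gramEntry e' 0 ((![3, 4, 5] : Fin 3 → Fin 6) c) 2)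
    (∑ b, ∑ c, dependency y ((![3, 4, 5] : Fin 3 → Fin 6) b) * dependency y ((![3, 4, 5] : Fin 3 → Fin 6) c) * gramEntry e' 0 ((![3, 4, 5] : Fin 3 → Fin 6) b) ((![3, 4, 5] : Fin 3 → Fin 6) c))
    (by
      simp only [Fin.sum_univ_three, Matrix.cons_val_zero, Matrix.cons_val_one,
        Matrix.cons_val]
      rw [gramEntry_comm hes 0 1 3, gramEntry_comm hes 0 1 4, gramEntry_comm hes 0 1 5, gramEntry_comm hes 0 1 2]
      linear_combination sum_dependency_gram hd 1)
    (by
      simp only [Fin.sum_univ_three, Matrix.cons_val_zero, Matrix.cons_val_one,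
        Matrix.cons_val]
      rw [gramEntry_comm hes 0 2 3, gramEntry_comm hes 0 2 4, gramEntry_comm hes 0 2 5, gramEntry_comm hes 0 2 1]
      linear_combination sum_dependency_gram hd 2)
    (by
      simp only [Fin.sum_univ_three, Matrix.cons_val_zero, Matrix.cons_val_one,
        Matrix.cons_val]
      linear_combination sum_dependency_gram hd 1)
    (by
      simp only [Fin.sum_univ_three, Matrix.cons_val_zero, Matrix.cons_val_one,
        Matrix.cons_val]
      linear_combination sum_dependency_gram hd 2)
    (by
      simp only [Fin.sum_univ_three, Matrix.cons_val_zero, Matrix.cons_val_one,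
        Matrix.cons_val]
      linear_combination dependency y 3 * sum_dependency_gram hd 3 + dependency y 4 * sum_dependency_gram hd 4 +
        dependency y 5 * sum_dependency_gram hd 5)
  refine Eq.trans ?_ (key.trans ?_)
  · simp only [Fin.sum_univ_three, Matrix.cons_val_zero, Matrix.cons_val_one,
      Matrix.cons_val, faceMinorDeriv]
    ring
  · congr 1
    simp only [Fin.sum_univ_three, Fin.sum_univ_five, Matrix.cons_val_zero,
      Matrix.cons_val_one, Matrix.cons_val]
    change _ = dependency y 1 * dependency y 1 * gramEntry e' 0 1 1 +
      dependency y 1 * dependency y 2 * gramEntry e' 0 1 2 +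
      dependency y 1 * dependency y 3 * gramEntry e' 0 1 3 +
      dependency y 1 * dependency y 4 * gramEntry e' 0 1 4 +
      dependency y 1 * dependency y 5 * gramEntry e' 0 1 5 +
      (dependency y 2 * dependency y 1 * gramEntry e' 0 2 1 +
      dependency y 2 * dependency y 2 * gramEntry e' 0 2 2 +
      dependency y 2 * dependency y 3 * gramEntry e' 0 2 3 +
      dependency y 2 * dependency y 4 * gramEntry e' 0 2 4 +
      dependency y 2 * dependency y 5 * gramEntry e' 0 2 5) +
      (dependency y 3 * dependency y 1 * gramEntry e' 0 3 1 +
      dependency y 3 * dependency y 2 * gramEntry e' 0 3 2 +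
      dependency y 3 * dependency y 3 * gramEntry e' 0 3 3 +
      dependency y 3 * dependency y 4 * gramEntry e' 0 3 4 +
      dependency y 3 * dependency y 5 * gramEntry e' 0 3 5) +
      (dependency y 4 * dependency y 1 * gramEntry e' 0 4 1 +
      dependency y 4 * dependency y 2 * gramEntry e' 0 4 2 +
      dependency y 4 * dependency y 3 * gramEntry e' 0 4 3 +
      dependency y 4 * dependency y 4 * gramEntry e' 0 4 4 +
      dependency y 4 * dependency y 5 * gramEntry e' 0 4 5) +
      (dependency y 5 * dependency y 1 * gramEntry e' 0 5 1 +
      dependency y 5 * dependency y 2 * gramEntry e' 0 5 2 +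
      dependency y 5 * dependency y 3 * gramEntry e' 0 5 3 +
      dependency y 5 * dependency y 4 * gramEntry e' 0 5 4 +
      dependency y 5 * dependency y 5 * gramEntry e' 0 5 5)
    ring

/-- Because sign l / |l| = 1 / l, attaching the sign replaces the absolute volume in the denominator
by the signed coefficient `l`, and only signed quantities enter the linear relations. -/
lemma hasDerivAt_sign_mul_dihedralAngle {ι : Type*} {e : ℝ → ι → ι → ℝ} {e' : ι → ι → ℝ}
    {y : ι → E4} {z : Fin 5 → ι} {l : ℝ}
    (he : ∀ k l, HasDerivAt (fun s => e s k l) (e' k l) t)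
    (ht : ∀ k l, e t k l = ‖y k - y l‖ ^ 2) (hz : |simplexDet (y ∘ z)| = |l|) (hl : l ≠ 0) :
    HasDerivAt (fun s => Real.sign l * dihedralAngle (fun m n => e s (z m) (z n)))
      (-(faceMinorDeriv (e t) e' (z 0) (z 1) (z 2) (z 3) (z 4) -
        faceMinor (e t) (z 0) (z 1) (z 2) (z 3) (z 4) *
        (faceMinorDeriv (e t) e' (z 0) (z 1) (z 2) (z 3) (z 3) /
          faceMinor (e t) (z 0) (z 1) (z 2) (z 3) (z 3) +
        faceMinorDeriv (e t) e' (z 0) (z 1) (z 2) (z 4) (z 4) /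
          faceMinor (e t) (z 0) (z 1) (z 2) (z 4) (z 4)) / 2) /
        (2 * triangleArea (y (z 0)) (y (z 1)) (y (z 2)) * l)) t := by
  have hne : simplexDet (y ∘ z) ≠ 0 := fun h => by
    rw [h, abs_zero, eq_comm, abs_eq_zero] at hz
    exact hl hz
  have h := (hasDerivAt_dihedralAngle (e := fun s m n => e s (z m) (z n)) (y := y ∘ z)
    (fun m n => he (z m) (z n)) (fun m n => ht _ _) hne).const_mul (Real.sign l)
  refine h.congr_deriv ?_
  rw [hz]
  have hsign : ∀ X S : ℝ, Real.sign l * (X / (2 * S * |l|)) = X / (2 * S * l) := fun X S => by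
    rcases lt_or_gt_of_ne hl with hk | hk
    · rw [Real.sign_of_neg hk, abs_of_neg hk, mul_neg, div_neg]; ring
    · rw [Real.sign_of_pos hk, abs_of_pos hk]; ring
  exact hsign _ _

lemma faceMinor_self_ne_zero {ι : Type*} {d : ι → ι → ℝ} {y : ι → E4}
    (hd : ∀ k l, d k l = ‖y k - y l‖ ^ 2) {z : Fin 5 → ι} (hz : simplexDet (y ∘ z) ≠ 0) :
    faceMinor d (z 0) (z 1) (z 2) (z 3) (z 3) ≠ 0 ∧
      faceMinor d (z 0) (z 1) (z 2) (z 4) (z 4) ≠ 0 := by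
  have h := faceMinor_mul_sub_sq (e := fun m n => d (z m) (z n)) (y := y ∘ z) fun m n => hd _ _
  have hS := triangleArea_pos hz
  have hp : 0 < (2 * triangleArea ((y ∘ z) 0) ((y ∘ z) 1) ((y ∘ z) 2) *
    simplexDet (y ∘ z)) ^ 2 := by positivity
  simp only [faceMinor_comp] at h
  have : 0 < faceMinor d (z 0) (z 1) (z 2) (z 3) (z 3) *
      faceMinor d (z 0) (z 1) (z 2) (z 4) (z 4) := by
    nlinarith [sq_nonneg (faceMinor d (z 0) (z 1) (z 2) (z 3) (z 4))]
  exact ⟨left_ne_zero_of_mul this.ne', right_ne_zero_of_mul this.ne'⟩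

lemma abs_simplexDet_succAbove (y : Fin 6 → E4) (k : Fin 6) :
    |simplexDet (y ∘ k.succAbove)| = |dependency y k| := by
  rw [dependency_eq, abs_mul, abs_pow, abs_neg, abs_one, one_pow, one_mul]

/-- The variation of the algebraic sum of the dihedral angles, at a common two-dimensional face,
of three 4-simplices with vertices among six points of four-space, when the squared distances
are varied independently. -/
theorem hasDerivAt_sum_dihedralAngle
    (he : ∀ k l, HasDerivAt (fun s => e s k l) (e' k l) t)
    (hs : ∀ k l, e' k l = e' l k) (h0 : ∀ k, e' k k = 0)
    (ht : ∀ k l, e t k l = ‖y k - y l‖ ^ 2) (hy : ∀ k, dependency y k ≠ 0) :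
    HasDerivAt (fun s =>
      Real.sign (dependency y 3) *
        dihedralAngle (fun m n => e s ((3 : Fin 6).succAbove m) ((3 : Fin 6).succAbove n)) +
      Real.sign (dependency y 4) *
        dihedralAngle (fun m n => e s ((4 : Fin 6).succAbove m) ((4 : Fin 6).succAbove n)) +
      Real.sign (dependency y 5) *
        dihedralAngle (fun m n => e s ((5 : Fin 6).succAbove m) ((5 : Fin 6).succAbove n)))
      (triangleArea (y 0) (y 1) (y 2) /
        (dependency y 3 * dependency y 4 * dependency y 5) *
        (1 / 2 * ∑ k, ∑ l, dependency y k * dependency y l * e' k l)) t := by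
  have hne : ∀ k : Fin 6, simplexDet (y ∘ k.succAbove) ≠ 0 := fun k h => by
    have := abs_simplexDet_succAbove y k
    rw [h, abs_zero, eq_comm, abs_eq_zero] at this
    exact hy k this
  have v0 : ∀ k : Fin 6, 3 ≤ k → k.succAbove 0 = 0 ∧ k.succAbove 1 = 1 ∧ k.succAbove 2 = 2 := by
    decide
  have hS : 0 < triangleArea (y 0) (y 1) (y 2) := by
    have h := triangleArea_pos (hne 5)
    simp only [Function.comp_apply] at h
    rwa [(v0 5 (by decide)).1, (v0 5 (by decide)).2.1, (v0 5 (by decide)).2.2] at h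
  have h := fun k : Fin 6 => hasDerivAt_sign_mul_dihedralAngle (z := k.succAbove)
    he ht (abs_simplexDet_succAbove y k) (hy k)
  have h3 := h 3
  have h4 := h 4
  have h5 := h 5
  clear h
  have v3 : (3 : Fin 6).succAbove 3 = 4 ∧ (3 : Fin 6).succAbove 4 = 5 := by decide
  have v4 : (4 : Fin 6).succAbove 3 = 3 ∧ (4 : Fin 6).succAbove 4 = 5 := by decide
  have v5 : (5 : Fin 6).succAbove 3 = 3 ∧ (5 : Fin 6).succAbove 4 = 4 := by decide
  rw [(v0 3 (by decide)).1, (v0 3 (by decide)).2.1, (v0 3 (by decide)).2.2, v3.1, v3.2] at h3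
  rw [(v0 4 (by decide)).1, (v0 4 (by decide)).2.1, (v0 4 (by decide)).2.2, v4.1, v4.2] at h4
  rw [(v0 5 (by decide)).1, (v0 5 (by decide)).2.1, (v0 5 (by decide)).2.2, v5.1, v5.2] at h5
  refine ((h3.add h4).add h5).congr_deriv ?_
  have hes : ∀ k l, e t k l = e t l k := fun k l => by rw [ht, ht, norm_sub_rev]
  have hDpos : ∀ k : Fin 3, faceMinor (e t) 0 1 2 (![3, 4, 5] k) (![3, 4, 5] k) ≠ 0 := by
    have p5 := faceMinor_self_ne_zero ht (hne 5)
    have p4 := faceMinor_self_ne_zero ht (hne 4)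
    rw [(v0 4 (by decide)).1, (v0 4 (by decide)).2.1, (v0 4 (by decide)).2.2, v4.1, v4.2] at p4
    rw [(v0 5 (by decide)).1, (v0 5 (by decide)).2.1, (v0 5 (by decide)).2.2, v5.1, v5.2] at p5
    intro k
    fin_cases k
    · exact p5.1
    · exact p5.2
    · exact p4.2
  have hsum := sum_angle_deriv (D := fun b c => faceMinor (e t) 0 1 2 (![3, 4, 5] b) (![3, 4, 5] c))
    (D' := fun b c => faceMinorDeriv (e t) e' 0 1 2 (![3, 4, 5] b) (![3, 4, 5] c))
    (n := fun b => dependency y (![3, 4, 5] b)) hS.ne' (fun k => hy _) hDpos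
    (fun c => sum_dependency_faceMinor ht _)
    (fun b c => faceMinor_symm hes _ _ _ _ _) (fun b c => faceMinorDeriv_symm hes hs _ _ _ _ _)
  rw [sum_faceMinorDeriv (e' := e') ht, sum_gram_deriv (sum_dependency y) hs h0] at hsum
  simp only [Matrix.cons_val_zero, Matrix.cons_val_one, Matrix.cons_val] at hsum
  rw [hsum]
  have d3 := hy 3
  have d4 := hy 4
  have d5 := hy 5
  field_simp
  ring

end SixPoints

/-! ### Orbits, faces and orderings of the vertices of cells -/

section CellLemmas

variable {Γ V C : Type*} [Group Γ] [MulAction Γ V] [MulAction Γ C] [PartialOrder C]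

omit [PartialOrder C] in
lemma orb_eq_orb {c d : C} : orb Γ c = orb Γ d ↔ ∃ γ : Γ, γ • d = c :=
  Quotient.eq.trans MulAction.orbitRel_apply

omit [PartialOrder C] in
@[simp]
lemma orb_smul (γ : Γ) (c : C) : orb Γ (γ • c) = orb Γ c := orb_eq_orb.2 ⟨γ, rfl⟩

omit [PartialOrder C] in
@[simp]
lemma orb_out (q : Orb Γ C) : orb Γ q.out = q := Quotient.out_eq q

omit [PartialOrder C] in
lemma exists_smul_out (c : C) : ∃ γ : Γ, γ • c = (orb Γ c).out :=
  orb_eq_orb.1 (orb_out _)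

namespace SimplicialCells

variable (U : SimplicialCells Γ V C)

lemma face_spec {c : C} {s : Set V} (hne : s.Nonempty) (hs : s ⊆ U.verts c) :
    U.face c s ≤ c ∧ (U.verts (U.face c s) : Set V) = s := by
  classical
  have hfin : s.Finite := (U.verts c).finite_toSet.subset hs
  have hex : ∃ d, d ≤ c ∧ (U.verts d : Set V) = s := by
    obtain ⟨d, ⟨hd, hv⟩, -⟩ := U.face_unique c hfin.toFinset (by simpa using hne)
      (by intro v hv; exact hs (by simpa using hv))
    exact ⟨d, hd, by rw [hv]; simp⟩
  rw [face, dif_pos hex]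
  exact hex.choose_spec

lemma eq_of_le_of_verts_eq {c d d' : C} (hd : d ≤ c) (hd' : d' ≤ c)
    (h : U.verts d = U.verts d') : d = d' := by
  obtain ⟨e, -, he⟩ := U.face_unique c (U.verts d) (U.verts_nonempty d) (U.verts_mono d c hd)
  rw [he d ⟨hd, rfl⟩, he d' ⟨hd', h.symm⟩]

lemma face_eq {c d : C} {s : Set V} (hd : d ≤ c) (hs : (U.verts d : Set V) = s) :
    U.face c s = d := by
  have h := U.face_spec (c := c) (s := s) (hs ▸ U.verts_nonempty d)
    (hs ▸ U.verts_mono d c hd)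
  exact U.eq_of_le_of_verts_eq h.1 hd (Finset.coe_injective (h.2.trans hs.symm))

lemma face_of_le {c d : C} (hd : d ≤ c) {s : Set V} (hne : s.Nonempty) (hs : s ⊆ U.verts d) :
    U.face c s = U.face d s :=
  U.face_eq ((U.face_spec hne hs).1.trans hd) (U.face_spec hne hs).2

lemma smul_le_smul_iff (U : SimplicialCells Γ V C) (γ : Γ) (c d : C) : γ • c ≤ γ • d ↔ c ≤ d := by
  refine ⟨fun h => ?_, U.smul_le γ c d⟩
  have := U.smul_le γ⁻¹ _ _ h
  simpa using this

lemma smul_le_iff (U : SimplicialCells Γ V C) (γ : Γ) (c d : C) : γ • c ≤ d ↔ c ≤ γ⁻¹ • d := by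
  rw [← U.smul_le_smul_iff γ c, smul_inv_smul]

lemma card_verts_smul (γ : Γ) (c : C) : (U.verts (γ • c)).card = (U.verts c).card := by
  rw [← Set.ncard_coe_finset, ← Set.ncard_coe_finset, U.verts_smul]
  exact Set.ncard_image_of_injective _ (MulAction.injective γ)

lemma card_verts_out (c : C) : (U.verts (orb Γ c).out).card = (U.verts c).card := by
  obtain ⟨γ, hγ⟩ := exists_smul_out (Γ := Γ) c
  rw [← hγ, U.card_verts_smul]

lemma face_smul (γ : Γ) {c : C} {s : Set V} (hne : s.Nonempty) (hs : s ⊆ U.verts c) :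
    U.face (γ • c) ((fun v => γ • v) '' s) = γ • U.face c s := by
  have h := U.face_spec hne hs
  exact U.face_eq (U.smul_le γ _ _ h.1) (by rw [U.verts_smul, h.2])

lemma smul_left_injective (U : SimplicialCells Γ V C) (c : C) {γ δ : Γ} (h : γ • c = δ • c) : γ = δ := by
  have := U.free (δ⁻¹ * γ) c (by rw [mul_smul, h, inv_smul_smul])
  rwa [inv_mul_eq_one, eq_comm] at this

lemma Enumerates.smul {U : SimplicialCells Γ V C} {n : ℕ} {c : C} {y : Fin n → V}
    (h : U.Enumerates c y) (γ : Γ) : U.Enumerates (γ • c) fun k => γ • y k := by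
  refine ⟨(MulAction.injective γ).comp h.1, ?_⟩
  rw [U.verts_smul, ← h.2, ← Set.range_comp]
  rfl

lemma Enumerates.mem {U : SimplicialCells Γ V C} {n : ℕ} {c : C} {y : Fin n → V}
    (h : U.Enumerates c y) (k : Fin n) : y k ∈ U.verts c := by
  have : y k ∈ (U.verts c : Set V) := h.2 ▸ ⟨k, rfl⟩
  exact this

lemma Enumerates.exists_perm {U : SimplicialCells Γ V C} {n : ℕ} {c : C} {y z : Fin n → V}
    (hy : U.Enumerates c y) (hz : U.Enumerates c z) : ∃ π : Equiv.Perm (Fin n), z = y ∘ π := by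
  have h : ∀ k, ∃ m, y m = z k := fun k => by
    have : z k ∈ Set.range y := by rw [hy.2, ← hz.2]; exact ⟨k, rfl⟩
    exact this
  choose f hf using h
  have hinj : Function.Injective f := fun a b hab => hz.1 (by rw [← hf, ← hf, hab])
  exact ⟨Equiv.ofBijective f (Finite.injective_iff_bijective.1 hinj), by ext k; simp [hf]⟩

/-- A list of the vertices of a 4-simplex starts with those of a given triangular face. -/
lemma flag_spec {p i : C} (hp : (U.verts p).card = 5) (hi : (U.verts i).card = 3) (hip : i ≤ p) :
    U.Enumerates p (U.flag p i) ∧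
      ({U.flag p i 0, U.flag p i 1, U.flag p i 2} : Set V) = (U.verts i : Set V) := by
  classical
  have hex : ∃ x : Fin 5 → V, U.Enumerates p x ∧
      ({x 0, x 1, x 2} : Set V) = (U.verts i : Set V) := by
    obtain ⟨a, b, c, hab, hac, hbc, hs⟩ := Finset.card_eq_three.1 hi
    have hsub := U.verts_mono i p hip
    obtain ⟨d, e, hde, hs'⟩ := Finset.card_eq_two.1
      (show (U.verts p \ U.verts i).card = 2 by rw [Finset.card_sdiff_of_subset hsub, hp, hi])
    have hd : d ∈ U.verts p \ U.verts i := by rw [hs']; simp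
    have he : e ∈ U.verts p \ U.verts i := by rw [hs']; simp
    rw [Finset.mem_sdiff, hs] at hd he
    simp only [Finset.mem_insert, Finset.mem_singleton, not_or] at hd he
    refine ⟨![a, b, c, d, e], ⟨?_, ?_⟩, ?_⟩
    · intro k l hkl
      fin_cases k <;> fin_cases l <;> simp_all
    · have hU : U.verts p = U.verts i ∪ (U.verts p \ U.verts i) := by
        rw [Finset.union_sdiff_of_subset hsub]
      rw [hU, hs', hs]
      ext v
      simp only [Set.mem_range, Fin.exists_fin_succ]
      simp
      tauto
    · rw [hs]
      simp
  rw [flag, dif_pos hex]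
  exact hex.choose_spec

end SimplicialCells

/-! ### Symmetry of the dihedral angle -/

section Symmetry

variable {d : V → V → ℝ}

lemma faceMinor_swap {ι : Type*} (d : ι → ι → ℝ) (o p q b c : ι) :
    faceMinor d o q p b c = faceMinor d o p q b c := by
  simp only [faceMinor, Matrix.det_fin_three, Matrix.of_apply, Matrix.cons_val', Matrix.cons_val,
    Matrix.cons_val_zero, Matrix.cons_val_one]
  ring

/-- Moving the origin from `o` to `p` acts on rows and on columns by changes of edge vectors of
determinant −1 each, so the determinant is unchanged. -/
lemma faceMinor_base {ι : Type*} {d : ι → ι → ℝ} (hs : ∀ k l, d k l = d l k) (h0 : ∀ k, d k k = 0)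
    (o p q b c : ι) : faceMinor d p o q b c = faceMinor d o p q b c := by
  simp only [faceMinor, Matrix.det_fin_three, Matrix.of_apply, Matrix.cons_val', Matrix.cons_val,
    Matrix.cons_val_zero, Matrix.cons_val_one, gramEntry, h0]
  rw [hs p o, hs q o, hs b o, hs q p, hs b p, hs b q]
  ring

/-- The face minors do not depend on the order of the three vertices of the face, and the formula is
symmetric in the two remaining vertices. Hence the choice made in `flag` is immaterial. -/
lemma dihedralAngle_comp_eq {ι : Type*} {d : ι → ι → ℝ} (hs : ∀ k l, d k l = d l k)
    (h0 : ∀ k, d k k = 0) {y z : Fin 5 → ι} (hz : Function.Injective z)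
    (hr : Set.range z = Set.range y) (hy : Function.Injective y)
    (h : ({z 0, z 1, z 2} : Set ι) = {y 0, y 1, y 2}) :
    dihedralAngle (fun m n => d (z m) (z n)) = dihedralAngle (fun m n => d (y m) (y n)) := by
  have hne : ∀ {m n : Fin 5}, m ≠ n → z m ≠ z n := fun h => hz.ne h
  have hne' : ∀ {m n : Fin 5}, m ≠ n → y m ≠ y n := fun h => hy.ne h
  have m0 : z 0 ∈ ({y 0, y 1, y 2} : Set ι) := by rw [← h]; simp
  have m1 : z 1 ∈ ({y 0, y 1, y 2} : Set ι) := by rw [← h]; simp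
  have m2 : z 2 ∈ ({y 0, y 1, y 2} : Set ι) := by rw [← h]; simp
  have hback : ∀ k : Fin 5, 2 < k → z k = y 3 ∨ z k = y 4 := by
    intro k hk
    have hn : z k ∉ ({y 0, y 1, y 2} : Set ι) := by
      rw [← h]
      simp only [Set.mem_insert_iff, Set.mem_singleton_iff, not_or]
      refine ⟨hne ?_, hne ?_, hne ?_⟩ <;> rintro rfl <;> simp at hk
    have hm : z k ∈ Set.range y := hr ▸ ⟨k, rfl⟩
    obtain ⟨l, hl⟩ := hm
    simp only [Set.mem_insert_iff, Set.mem_singleton_iff, not_or] at hn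
    fin_cases l
    · exact absurd hl.symm hn.1
    · exact absurd hl.symm hn.2.1
    · exact absurd hl.symm hn.2.2
    · exact Or.inl hl.symm
    · exact Or.inr hl.symm
  have hF : ∀ b c, faceMinor d (z 0) (z 1) (z 2) b c = faceMinor d (y 0) (y 1) (y 2) b c := by
    intro b c
    have s := faceMinor_swap d
    have t := faceMinor_base hs h0
    simp only [Set.mem_insert_iff, Set.mem_singleton_iff] at m0 m1 m2
    have e01 := hne (show (0 : Fin 5) ≠ 1 by decide)
    have e02 := hne (show (0 : Fin 5) ≠ 2 by decide)
    have e12 := hne (show (1 : Fin 5) ≠ 2 by decide)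
    rcases m0 with m0 | m0 | m0 <;> rcases m1 with m1 | m1 | m1 <;>
      first
      | exact absurd (m0.trans m1.symm) e01
      | (rcases m2 with m2 | m2 | m2 <;>
          first
          | exact absurd (m0.trans m2.symm) e02
          | exact absurd (m1.trans m2.symm) e12
          | (rw [m0, m1, m2]; done)
          | (rw [m0, m1, m2, s]; done)
          | (rw [m0, m1, m2, t]; done)
          | (rw [m0, m1, m2, s, t]; done)
          | (rw [m0, m1, m2, t, s]; done)
          | rw [m0, m1, m2, s, t, s])
  simp only [dihedralAngle_eq, faceMinor_comp, hF]
  have e34 := hne (show (3 : Fin 5) ≠ 4 by decide)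
  rcases hback 3 (by decide) with h3 | h3 <;> rcases hback 4 (by decide) with h4 | h4
  · exact absurd (h3.trans h4.symm) e34
  · rw [h3, h4]
  · rw [h3, h4, faceMinor_symm hs, mul_comm]
  · exact absurd (h3.trans h4.symm) e34

end Symmetry

section EdgeVar

variable (U : SimplicialCells Γ V C) (L : Orb Γ C → ℝ)

lemma edgeVar_self (p : C) (u : V) : edgeVar U L p u u = 0 := if_pos rfl

lemma edgeVar_comm (p : C) (u w : V) : edgeVar U L p u w = edgeVar U L p w u := by
  by_cases h : u = w
  · rw [h]
  · rw [edgeVar, edgeVar, if_neg h, if_neg (Ne.symm h), Set.pair_comm]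

lemma edgeVar_smul (γ : Γ) {p : C} {u w : V} (hu : u ∈ U.verts p) (hw : w ∈ U.verts p) :
    edgeVar U L (γ • p) (γ • u) (γ • w) = edgeVar U L p u w := by
  have h : ({γ • u, γ • w} : Set V) = (fun v => γ • v) '' {u, w} := by rw [Set.image_pair]
  by_cases huw : u = w
  · rw [huw, edgeVar_self, edgeVar_self]
  · rw [edgeVar, edgeVar, if_neg huw, if_neg ((MulAction.injective γ).ne huw), h,
      U.face_smul γ ⟨u, by simp⟩ (Set.pair_subset hu hw), orb_smul]

lemma edgeVar_of_le {p c : C} (hpc : p ≤ c) {u w : V} (hu : u ∈ U.verts p)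
    (hw : w ∈ U.verts p) : edgeVar U L p u w = edgeVar U L c u w := by
  simp only [edgeVar]
  rw [U.face_of_le hpc ⟨u, by simp⟩ (Set.pair_subset hu hw)]

/-- The dihedral angle of the 4-simplex `p` at its face `i`. -/
def angleAt (p i : C) : ℝ :=
  dihedralAngle fun m n => edgeVar U L p (U.flag p i m) (U.flag p i n)

lemma angleAt_eq {p i : C} (hp : (U.verts p).card = 5) (hi : (U.verts i).card = 3) (hip : i ≤ p)
    {y : Fin 5 → V} (hy : U.Enumerates p y) (hyi : ({y 0, y 1, y 2} : Set V) = U.verts i) :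
    angleAt U L p i = dihedralAngle fun m n => edgeVar U L p (y m) (y n) := by
  have h := U.flag_spec hp hi hip
  exact dihedralAngle_comp_eq (edgeVar_comm U L p) (edgeVar_self U L p) h.1.1
    (h.1.2.trans hy.2.symm) hy.1 (h.2.trans hyi.symm)

lemma angleAt_smul (γ : Γ) {p i : C} (hp : (U.verts p).card = 5) (hi : (U.verts i).card = 3)
    (hip : i ≤ p) : angleAt U L (γ • p) (γ • i) = angleAt U L p i := by
  have h := U.flag_spec hp hi hip
  rw [angleAt_eq U L (by rw [U.card_verts_smul, hp]) (by rw [U.card_verts_smul, hi])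
    (U.smul_le γ _ _ hip) (h.1.smul γ) (by rw [U.verts_smul, ← h.2]; simp [Set.image_insert_eq])]
  simp only [edgeVar_smul U L γ (h.1.mem _) (h.1.mem _)]
  rfl

end EdgeVar

/-! ### The placement of the simplices -/

namespace Development

variable (P : Development Γ V)

lemma edgeDet_eq (y : Fin 5 → V) : P.edgeDet y = simplexDet (P.pos ∘ y) := rfl

lemma edgeDet_comp_perm (y : Fin 5 → V) (π : Equiv.Perm (Fin 5)) :
    P.edgeDet (y ∘ π) = Equiv.Perm.sign π * P.edgeDet y := by
  rw [edgeDet_eq, edgeDet_eq]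
  exact simplexDet_comp_perm (P.pos ∘ y) π

lemma det_linMatrix (γ : Γ) : (linMatrix (P.hol γ)).det = 1 := by
  rw [← P.proper γ, ← LinearMap.det_toMatrix (EuclideanSpace.basisFun (Fin 4) ℝ).toBasis]
  congr 1

/-- Here properness of the motions is essential: the linear part has determinant 1, so even the sign
of the volume is constant along an orbit. -/
lemma edgeDet_smul (γ : Γ) (y : Fin 5 → V) : P.edgeDet (fun k => γ • y k) = P.edgeDet y := by
  have h : Matrix.of (fun i j : Fin 4 => (P.pos (γ • y i.succ) - P.pos (γ • y 0)) j) =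
      Matrix.of (fun i j : Fin 4 => (P.pos (y i.succ) - P.pos (y 0)) j) *
        (linMatrix (P.hol γ))ᵀ := by
    ext i j
    have := congrFun (linMatrix_mulVec (P.hol γ) (P.pos (y i.succ) - P.pos (y 0))) j
    rw [Matrix.of_apply, pos_sub_smul]
    refine this.symm.trans ?_
    simp [Matrix.mul_apply, Matrix.mulVec, dotProduct, mul_comm]
  rw [edgeDet, h, Matrix.det_mul, Matrix.det_transpose, P.det_linMatrix, mul_one]
  rfl

lemma edgeDet_ne_zero {U : SimplicialCells Γ V C} {K : Triangulation U} (hK : P.Nondegenerate K)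
    {p : C} (hp : p ∈ K.simplices 4) {y : Fin 5 → V} (hy : U.Enumerates p y) :
    P.edgeDet y ≠ 0 := by
  have h := hK p hp
  have h1 : AffineIndependent ℝ fun k : Fin 5 => P.pos (y k) :=
    h.comp_embedding ⟨fun k => (⟨y k, hy.mem k⟩ : U.verts p), fun a b hab =>
      hy.1 (congrArg Subtype.val hab)⟩
  rw [affineIndependent_iff_linearIndependent_vsub ℝ _ 0] at h1
  have h2 := h1.comp (fun i : Fin 4 => (⟨i.succ, Fin.succ_ne_zero i⟩ : {k : Fin 5 // k ≠ 0}))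
    (fun a b hab => Fin.succ_injective _ (congrArg Subtype.val hab))
  have h3 := h2.map' (WithLp.linearEquiv 2 ℝ (Fin 4 → ℝ)).toLinearMap
    (LinearEquiv.ker _)
  have h4 : LinearIndependent ℝ (Matrix.of fun i j : Fin 4 =>
      (P.pos (y i.succ) - P.pos (y 0)) j).row := h3
  have := Matrix.linearIndependent_rows_iff_isUnit.1 h4
  exact ((Matrix.isUnit_iff_isUnit_det _).1 this).ne_zero

lemma abs_edgeDet_eq {U : SimplicialCells Γ V C} {p : C} {y z : Fin 5 → V}
    (hy : U.Enumerates p y) (hz : U.Enumerates p z) : |P.edgeDet z| = |P.edgeDet y| := by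
  obtain ⟨π, rfl⟩ := hy.exists_perm hz
  rw [edgeDet_comp_perm, abs_mul]
  rcases Int.units_eq_one_or (Equiv.Perm.sign π) with h | h <;> simp [h]

lemma volume_eq (U : SimplicialCells Γ V C) {p : C} (hp : (U.verts p).card = 5) {y : Fin 5 → V}
    (hy : U.Enumerates p y) : P.volume U p = |P.edgeDet y| / 24 := by
  rw [volume, P.abs_edgeDet_eq hy (U.tuple_spec (n := 4) hp)]

lemma volume_smul (U : SimplicialCells Γ V C) (γ : Γ) {p : C} (hp : (U.verts p).card = 5) :
    P.volume U (γ • p) = P.volume U p := by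
  have h := U.tuple_spec (n := 4) hp
  rw [P.volume_eq U (by rw [U.card_verts_smul, hp]) (h.smul γ), edgeDet_smul, P.volume_eq U hp h]

lemma dist_smul (γ : Γ) (A B : V) : dist (P.pos (γ • A)) (P.pos (γ • B)) =
    dist (P.pos A) (P.pos B) := by
  rw [P.pos_smul, P.pos_smul, (P.hol γ).dist_map]

lemma length_eq (U : SimplicialCells Γ V C) {a : C} {A B : V} (hAB : A ≠ B)
    (h : (U.verts a : Set V) = {A, B}) : P.length U a = dist (P.pos A) (P.pos B) := by
  have hc : (U.verts a).card = 2 := by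
    rw [← Set.ncard_coe_finset, h, Set.ncard_pair hAB]
  rcases U.tuple_one_pair hc h with ⟨h0, h1⟩ | ⟨h0, h1⟩
  · rw [length, h0, h1]
  · rw [length, h0, h1, dist_comm]

lemma length_smul (U : SimplicialCells Γ V C) (γ : Γ) {a : C} (ha : (U.verts a).card = 2) :
    P.length U (γ • a) = P.length U a := by
  have h := U.tuple_spec (n := 1) ha
  have hne : U.tuple 1 a 0 ≠ U.tuple 1 a 1 := h.1.ne (by decide)
  rw [P.length_eq U (A := γ • U.tuple 1 a 0) (B := γ • U.tuple 1 a 1)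
    ((MulAction.injective γ).ne hne) ?_, P.dist_smul]
  · rfl
  · rw [U.verts_smul, ← h.2, ← Set.range_comp]
    ext v
    simp [eq_comm]

lemma area_eq_triangleArea (U : SimplicialCells Γ V C) (i : C) : P.area U i =
    triangleArea (P.pos (U.tuple 2 i 0)) (P.pos (U.tuple 2 i 1)) (P.pos (U.tuple 2 i 2)) := rfl

lemma area_eq (U : SimplicialCells Γ V C) {i : C} {y : Fin 3 → V} (hy : U.Enumerates i y) :
    P.area U i = triangleArea (P.pos (y 0)) (P.pos (y 1)) (P.pos (y 2)) := by
  have hc : (U.verts i).card = 3 := by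
    rw [← Set.ncard_coe_finset, ← hy.2, ← Set.image_univ, Set.ncard_image_of_injective _ hy.1]
    simp
  have ht := U.tuple_spec (n := 2) hc
  obtain ⟨π, hπ⟩ := hy.exists_perm ht
  have e01 : π 0 ≠ π 1 := π.injective.ne (by decide)
  have e02 : π 0 ≠ π 2 := π.injective.ne (by decide)
  have e12 : π 1 ≠ π 2 := π.injective.ne (by decide)
  rw [P.area_eq_triangleArea, hπ]
  simp only [Function.comp_apply]
  generalize π 0 = a at *
  generalize π 1 = b at *
  generalize π 2 = c at *
  set A := P.pos (y 0)
  set B := P.pos (y 1)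
  set D := P.pos (y 2)
  fin_cases a <;> fin_cases b <;> fin_cases c <;> first
    | exact absurd rfl e01
    | exact absurd rfl e02
    | exact absurd rfl e12
    | rfl
    | exact triangleArea_swap _ _ _
    | exact triangleArea_rotate _ _ _
    | exact (triangleArea_rotate _ _ _).symm
    | exact (triangleArea_swap _ _ _).trans (triangleArea_rotate _ _ _)
    | exact (triangleArea_swap _ _ _).trans (triangleArea_rotate _ _ _).symm

lemma area_smul (U : SimplicialCells Γ V C) (γ : Γ) {i : C} (hi : (U.verts i).card = 3) :
    P.area U (γ • i) = P.area U i := by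
  have h := U.tuple_spec (n := 2) hi
  rw [P.area_eq U (h.smul γ), P.area_eq U h, triangleArea, triangleArea]
  simp only [pos_sub_smul, LinearIsometryEquiv.norm_map, LinearIsometryEquiv.inner_map_map]

lemma sqLength_eq (U : SimplicialCells Γ V C) {c : C} {A B : V} (hA : A ∈ U.verts c)
    (hB : B ∈ U.verts c) : edgeVar U (sqLength U P) c A B = ‖P.pos A - P.pos B‖ ^ 2 := by
  rw [edgeVar]
  split_ifs with h
  · simp [h]
  · have hs := U.face_spec (c := c) (s := {A, B}) ⟨A, by simp⟩ (Set.pair_subset hA hB)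
    have hc : (U.verts (U.face c {A, B})).card = 2 := by
      rw [← Set.ncard_coe_finset, hs.2, Set.ncard_pair h]
    obtain ⟨γ, hγ⟩ := exists_smul_out (Γ := Γ) (U.face c {A, B})
    rw [sqLength, ← hγ, P.length_smul U γ hc, P.length_eq U h hs.2, dist_eq_norm]

end Development

/-! ### Signs -/

section Signs

variable {U : SimplicialCells Γ V C} (K : Triangulation U) (P : Development Γ V)

lemma Triangulation.smul_mem_simplices (K : Triangulation U) {n : ℕ} (γ : Γ) {c : C} :
    γ • c ∈ K.simplices n ↔ c ∈ K.simplices n := by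
  constructor
  · rintro ⟨h1, h2⟩
    exact ⟨by simpa using K.smul_mem γ⁻¹ _ h1, U.card_verts_smul γ c ▸ h2⟩
  · rintro ⟨h1, h2⟩
    exact ⟨K.smul_mem γ _ h1, (U.card_verts_smul γ c).trans h2⟩

lemma Triangulation.orb_mem_orbits (K : Triangulation U) {n : ℕ} {c : C} :
    orb Γ c ∈ K.orbits n ↔ c ∈ K.simplices n := by
  constructor
  · rintro ⟨d, hd, hdc⟩
    obtain ⟨γ, rfl⟩ := orb_eq_orb.1 hdc
    exact (K.smul_mem_simplices γ).1 hd
  · exact fun h => ⟨c, h, rfl⟩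

lemma Triangulation.out_mem_simplices (K : Triangulation U) {n : ℕ} {q : Orb Γ C} :
    q.out ∈ K.simplices n ↔ q ∈ K.orbits n := by
  rw [← K.orb_mem_orbits, orb_out]

/-- Reordering the vertices multiplies the orientation and the sign of the determinant by the same
sign of the permutation. -/
lemma simplexSign_eq {p : C} (hp : p ∈ K.simplices 4) {y : Fin 5 → V} (hy : U.Enumerates p y) :
    simplexSign K P p = ((K.orient p y : ℤ) : ℝ) * Real.sign (P.edgeDet y) := by
  obtain ⟨π, hπ⟩ := hy.exists_perm (U.tuple_spec (n := 4) hp.2)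
  rw [simplexSign, hπ, K.orient_perm p hp.1 y hy, P.edgeDet_comp_perm]
  rcases Int.units_eq_one_or (Equiv.Perm.sign π) with h | h <;> simp [h, Real.sign_neg]

lemma simplexSign_smul (γ : Γ) {p : C} (hp : p ∈ K.simplices 4) :
    simplexSign K P (γ • p) = simplexSign K P p := by
  have h := U.tuple_spec (n := 4) hp.2
  rw [simplexSign_eq K P ((K.smul_mem_simplices γ).2 hp) (h.smul γ), K.orient_smul p hp.1 _ h,
    P.edgeDet_smul]
  rfl

end Signs

end CellLemmas

section Clusters

variable {Γ V C : Type*} [Group Γ] [MulAction Γ V] [MulAction Γ C] [PartialOrder C]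

/-! ### The deficit angle as a sum over the 4-simplices of the quotient -/

open Classical in
/-- The sum of the dihedral angles of `p` at its triangular faces covering `i`. -/
def angleSum (U : SimplicialCells Γ V C) (L : Orb Γ C → ℝ) (p : C) (i : Orb Γ C) : ℝ :=
  ∑ s ∈ ((U.verts p).powersetCard 3).filter (fun s : Finset V => orb Γ (U.face p (s : Set V)) = i),
    angleAt U L p (U.face p (s : Set V))

section

variable {U : SimplicialCells Γ V C}

lemma face_spec_of_mem_powersetCard {p : C} {s : Finset V} {n : ℕ}
    (hs : s ∈ (U.verts p).powersetCard (n + 1)) :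
    (s : Set V).Nonempty ∧ (s : Set V) ⊆ U.verts p ∧ U.face p (s : Set V) ≤ p ∧
      U.verts (U.face p (s : Set V)) = s := by
  rw [Finset.mem_powersetCard] at hs
  have hne : (s : Set V).Nonempty := by
    rw [Finset.coe_nonempty, ← Finset.card_pos, hs.2]
    exact n.succ_pos
  have hsub : (s : Set V) ⊆ U.verts p := hs.1
  have h := U.face_spec hne hsub
  exact ⟨hne, hsub, h.1, Finset.coe_injective h.2⟩

lemma angleSum_smul (L : Orb Γ C → ℝ) (γ : Γ) {p : C} (hp : (U.verts p).card = 5)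
    (i : Orb Γ C) : angleSum U L (γ • p) i = angleSum U L p i := by
  classical
  let e : V ↪ V := ⟨fun v => γ • v, MulAction.injective γ⟩
  have hv : U.verts (γ • p) = (U.verts p).map e :=
    Finset.coe_injective (by rw [U.verts_smul, Finset.coe_map]; rfl)
  have hface : ∀ s ∈ (U.verts p).powersetCard 3,
      U.face (γ • p) ((s.map e : Finset V) : Set V) = γ • U.face p (s : Set V) := fun s hs => by
    have h := face_spec_of_mem_powersetCard hs
    rw [Finset.coe_map]
    exact U.face_smul γ h.1 h.2.1
  symm
  refine Finset.sum_bij (fun s _ => s.map e) ?_ ?_ ?_ ?_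
  · intro s hs
    rw [Finset.mem_filter] at hs ⊢
    rw [hface s hs.1, orb_smul, hv, Finset.powersetCard_map]
    exact ⟨Finset.mem_map_of_mem _ hs.1, hs.2⟩
  · intro s _ t _ hst
    exact Finset.map_injective e hst
  · intro t ht
    rw [Finset.mem_filter, hv, Finset.powersetCard_map, Finset.mem_map] at ht
    obtain ⟨⟨s, hs, rfl⟩, ht⟩ := ht
    refine ⟨s, Finset.mem_filter.2 ⟨hs, ?_⟩, rfl⟩
    have ht : orb Γ (U.face (γ • p) ((s.map e : Finset V) : Set V)) = i := ht
    rwa [hface s hs, orb_smul] at ht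
  · intro s hs
    rw [Finset.mem_filter] at hs
    have h := face_spec_of_mem_powersetCard hs.1
    rw [hface s hs.1, angleAt_smul U L γ hp
      (by rw [h.2.2.2]; exact (Finset.mem_powersetCard.1 hs.1).2) h.2.2.1]

/-- The definition sums over the 4-simplices of the covering at one fixed triangle; the right-hand
side sums over orbits of 4-simplices, each counted once for every one of its triangles in the orbit
of `i`. Freeness of the action matches the two index sets. In this form the deficits of two
triangulations can be compared orbit by orbit. -/
lemma deficit_eq_sum (K : Triangulation U) (P : Development Γ V) (L : Orb Γ C → ℝ) {i : C}
    (hi : (U.verts i).card = 3) :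
    deficit K P L i =
      -∑ q ∈ (K.orbits 4).toFinset, simplexSign K P q.out * angleSum U L q.out (orb Γ i) := by
  classical
  simp only [angleSum, Finset.mul_sum]
  rw [Finset.sum_sigma', deficit, neg_inj]
  set A := (K.orbits 4).toFinset.sigma fun q => ((U.verts q.out).powersetCard 3).filter
    (fun s : Finset V => orb Γ (U.face q.out (s : Set V)) = orb Γ i) with hAdef
  have hA : ∀ x ∈ A, x.1 ∈ K.orbits 4 ∧ x.2 ∈ (U.verts x.1.out).powersetCard 3 ∧
      orb Γ (U.face x.1.out (x.2 : Set V)) = orb Γ i := by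
    intro x hx
    rw [hAdef, Finset.mem_sigma, Finset.mem_filter, Set.mem_toFinset] at hx
    exact hx
  -- For each triangle in the orbit of `i`, a group element carrying it to `i`. Stating the
  -- existence for all `x` makes the chosen `g` a total function; its values off `A` play no role.
  have hγ : ∀ x : Σ _ : Orb Γ C, Finset V, ∃ γ : Γ, x ∈ A →
      γ • U.face x.1.out (x.2 : Set V) = i := by
    intro x
    by_cases hx : x ∈ A
    · obtain ⟨γ, hγ⟩ := orb_eq_orb.1 (hA x hx).2.2.symm
      exact ⟨γ, fun _ => hγ⟩
    · exact ⟨1, fun h => absurd h hx⟩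
  choose g hg using hγ
  rw [← finsum_mem_coe_finset]
  symm
  refine finsum_mem_eq_of_bijOn (fun x => g x • x.1.out) ⟨?_, ?_, ?_⟩ ?_
  · intro x hx
    have h := hA x hx
    have hf := face_spec_of_mem_powersetCard h.2.1
    refine ⟨(K.smul_mem_simplices _).2 (K.out_mem_simplices.2 h.1), ?_⟩
    conv_lhs => rw [← hg x hx]
    exact U.smul_le _ _ _ hf.2.2.1
  · rintro ⟨q, s⟩ hx ⟨q', s'⟩ hx' heq
    have heq : g ⟨q, s⟩ • q.out = g ⟨q', s'⟩ • q'.out := heq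
    have hq : q = q' := by
      rw [← orb_out q, ← orb_out q', ← orb_smul (g ⟨q, s⟩), heq, orb_smul]
    subst hq
    have hgg := U.smul_left_injective _ heq
    have h1 := hg _ hx
    have h2 := hg _ hx'
    simp only [hgg] at h1
    have h3 := MulAction.injective _ (h1.trans h2.symm)
    have h4 := (face_spec_of_mem_powersetCard (hA _ hx).2.1).2.2.2
    have h5 := (face_spec_of_mem_powersetCard (hA _ hx').2.1).2.2.2
    simp only at h3 h4 h5
    rw [h3, h5] at h4
    rw [h4]
  · rintro p ⟨hp, hip⟩
    obtain ⟨γ, hγ⟩ := exists_smul_out (Γ := Γ) p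
    have hle : γ • i ≤ (orb Γ p).out := hγ ▸ U.smul_le γ _ _ hip
    have hface : U.face (orb Γ p).out (U.verts (γ • i) : Set V) = γ • i := U.face_eq hle rfl
    have hx : (⟨orb Γ p, U.verts (γ • i)⟩ : Σ _ : Orb Γ C, Finset V) ∈ A := by
      rw [hAdef, Finset.mem_sigma, Finset.mem_filter, Set.mem_toFinset, Finset.mem_powersetCard]
      refine ⟨K.orb_mem_orbits.2 hp, ⟨U.verts_mono _ _ hle, ?_⟩, ?_⟩
      · rw [U.card_verts_smul, hi]
      · rw [hface, orb_smul]
    -- The chosen element carries γ • i to i, as does γ⁻¹; freeness makes them equal.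
    refine ⟨_, hx, ?_⟩
    have h := hg _ hx
    simp only [hface, smul_smul] at h ⊢
    rw [← hγ, smul_smul, U.free _ _ h, one_smul]
  · intro x hx
    have h := hA x hx
    have hf := face_spec_of_mem_powersetCard h.2.1
    have hp := K.out_mem_simplices.2 h.1
    rw [simplexSign_smul K P _ hp]
    have ha : angleAt U L (g x • x.1.out) i = angleAt U L x.1.out (U.face x.1.out (x.2 : Set V)) := by
      rw [← angleAt_smul U L (g x) hp.2
        (by rw [hf.2.2.2]; exact (Finset.mem_powersetCard.1 h.2.1).2) hf.2.2.1, hg x hx]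
    exact congrArg _ ha.symm

end

/-! ### The faces of a 5-simplex -/

/-- The face of `D` with vertices `x k`, `k ∈ s`. -/
def subface (U : SimplicialCells Γ V C) (D : C) (x : Fin 6 → V) (s : Finset (Fin 6)) : C :=
  U.face D (x '' (s : Set (Fin 6)))

namespace SimplicialCells.Enumerates

variable {U : SimplicialCells Γ V C} {D : C} {x : Fin 6 → V} (hx : U.Enumerates D x)
  {s t : Finset (Fin 6)}

include hx

lemma subface_spec (hs : s.Nonempty) :
    subface U D x s ≤ D ∧ (U.verts (subface U D x s) : Set V) = x '' (s : Set (Fin 6)) :=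
  U.face_spec (by simpa using hs) (by rw [← hx.2]; exact Set.image_subset_range _ _)

lemma card_subface (hs : s.Nonempty) : (U.verts (subface U D x s)).card = s.card := by
  rw [← Set.ncard_coe_finset, (hx.subface_spec hs).2, Set.ncard_image_of_injective _ hx.1,
    Set.ncard_coe_finset]

lemma mem_verts_subface (hs : s.Nonempty) {k : Fin 6} :
    x k ∈ U.verts (subface U D x s) ↔ k ∈ s := by
  have : x k ∈ (U.verts (subface U D x s) : Set V) ↔ k ∈ s := by
    rw [(hx.subface_spec hs).2, hx.1.mem_set_image, Finset.mem_coe]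
  exact this

lemma eq_subface {c : C} (hc : c ≤ D) : ∃ s : Finset (Fin 6), s.Nonempty ∧ subface U D x s = c := by
  classical
  have himg : x '' ((Finset.univ.filter fun k => x k ∈ U.verts c : Finset (Fin 6)) :
      Set (Fin 6)) = U.verts c := by
    ext v
    simp only [Finset.coe_filter, Finset.mem_univ, true_and, Set.mem_image, Set.mem_ofPred_eq,
      Finset.mem_coe]
    constructor
    · rintro ⟨k, hk, rfl⟩
      exact hk
    · intro hv
      have : v ∈ Set.range x := by rw [hx.2]; exact U.verts_mono c D hc hv
      obtain ⟨k, rfl⟩ := this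
      exact ⟨k, hv, rfl⟩
  refine ⟨Finset.univ.filter fun k => x k ∈ U.verts c, ?_, U.face_eq hc himg.symm⟩
  have : (x '' ((Finset.univ.filter fun k => x k ∈ U.verts c : Finset (Fin 6)) :
      Set (Fin 6))).Nonempty := by
    rw [himg]
    exact U.verts_nonempty c
  obtain ⟨_, k, hk, _⟩ := this
  exact ⟨k, hk⟩

lemma subface_mono (hs : s.Nonempty) (hst : s ⊆ t) : subface U D x s ≤ subface U D x t := by
  have ht := hx.subface_spec (hs.mono hst)
  have hsub : x '' (s : Set (Fin 6)) ⊆ U.verts (subface U D x t) := by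
    rw [ht.2]
    exact Set.image_mono hst
  rw [subface, U.face_of_le ht.1 (by simpa using hs) hsub]
  exact (U.face_spec (by simpa using hs) hsub).1

lemma subface_lt (hs : s.Nonempty) (hu : s ≠ Finset.univ) : subface U D x s < D := by
  refine lt_of_le_of_ne (hx.subface_spec hs).1 fun h => hu ?_
  ext k
  rw [← hx.mem_verts_subface hs, h]
  simpa using hx.mem k

lemma subface_injective (hs : s.Nonempty) (ht : t.Nonempty)
    (h : subface U D x s = subface U D x t) : s = t := by
  ext k
  rw [← hx.mem_verts_subface hs, h, hx.mem_verts_subface ht]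

lemma enumerates_subface {n : ℕ} {y : Fin n → Fin 6} (hy : Function.Injective y)
    (hs : s.Nonempty) (h : Set.range y = s) : U.Enumerates (subface U D x s) (x ∘ y) :=
  ⟨hx.1.comp hy, by rw [(hx.subface_spec hs).2, Set.range_comp, h]⟩

lemma enumerates_facet (j : Fin 6) : U.Enumerates (subface U D x {j}ᶜ) (x ∘ j.succAbove) :=
  hx.enumerates_subface Fin.succAbove_right_injective ⟨j + 1, by simp⟩
    (by rw [Fin.range_succAbove]; simp)

end SimplicialCells.Enumerates

lemma compl_singleton_nonempty (j : Fin 6) : ({j}ᶜ : Finset (Fin 6)).Nonempty :=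
  ⟨j + 1, by simp⟩

/-! ### Combinatorics of a move -/

namespace IsMove

variable {U : SimplicialCells Γ V C} {K K' : Triangulation U} {D : C} {x : Fin 6 → V}
  {J : Finset (Fin 6)}

/-- A move and its inverse are the same datum with `J` replaced by its complement, so each statement
about `K` below yields one about `K'`. -/
lemma symm (h : IsMove K K' D x J) : IsMove K' K D x Jᶜ where
  enumerates := h.enumerates
  mem_old := fun c hc => by simpa using h.mem_new c hc
  mem_new := fun c hc => by simpa using h.mem_old c hc
  outside := fun c hc => (h.outside c hc).symm
  embedded := fun c hc hJ γ hγ => h.embedded c hc (by simpa using hJ.symm) γ hγ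
  orient_outside := fun p hp hp' y hy => (h.orient_outside p hp' hp y hy).symm
  orient_boundary := fun p hp p' hp' hpD hpD' t ht ht' w a b hw ha hb =>
    (h.orient_boundary p' hp' p hp hpD' hpD t ht' ht w b a hw hb ha).symm

variable (h : IsMove K K' D x J) {s t : Finset (Fin 6)}

include h

lemma subface_mem (hs : s.Nonempty) (hu : s ≠ Finset.univ) :
    subface U D x s ∈ K.cells ↔ ¬ J ⊆ s := by
  rw [h.mem_old _ (h.enumerates.subface_lt hs hu), Finset.not_subset]
  simp only [h.enumerates.mem_verts_subface hs]

lemma subface_mem_new (hs : s.Nonempty) (hu : s ≠ Finset.univ) :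
    subface U D x s ∈ K'.cells ↔ ¬ Jᶜ ⊆ s :=
  h.symm.subface_mem hs hu

/-- A face containing all of `J` or all of its complement is interior to one of the clusters. The
embedding condition forbids a nontrivial translate of it inside `D`, so it is identified with no
other face of `D`. -/
lemma orb_subface_injective (hs : s.Nonempty) (ht : t.Nonempty) (hJ : J ⊆ s ∨ Jᶜ ⊆ s)
    (ho : orb Γ (subface U D x t) = orb Γ (subface U D x s)) : t = s := by
  obtain ⟨γ, hγ⟩ := orb_eq_orb.1 ho
  have hle := (h.enumerates.subface_spec ht).1
  rw [← hγ] at hle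
  have := h.embedded _ (h.enumerates.subface_spec hs).1 (by
    rcases hJ with hJ | hJ
    · exact Or.inl fun j hj => (h.enumerates.mem_verts_subface hs).2 (hJ hj)
    · exact Or.inr fun j hj => (h.enumerates.mem_verts_subface hs).2
        (hJ (Finset.mem_compl.2 hj))) γ hle
  rw [this, one_smul] at hγ
  exact h.enumerates.subface_injective ht hs hγ.symm

/-- Outside the translates of `D` the triangulations agree, and a proper face of `D` fails to lie in
`K'` exactly when it contains `Jᶜ`. The second alternative thus describes the interior faces of the
old cluster. -/
lemma mem_orbits_or {n : ℕ} {q : Orb Γ C} (hq : q ∈ K.orbits n) :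
    q ∈ K'.orbits n ∨ ∃ s : Finset (Fin 6), s.card = n + 1 ∧ Jᶜ ⊆ s ∧
      orb Γ (subface U D x s) = q := by
  obtain ⟨c, hc, rfl⟩ := hq
  by_cases hout : ∀ γ : Γ, ¬ c ≤ γ • D
  · exact Or.inl ⟨c, ⟨(h.outside c hout).1 hc.1, hc.2⟩, rfl⟩
  · push Not at hout
    obtain ⟨γ, hγ⟩ := hout
    have hle : γ⁻¹ • c ≤ D := by rwa [U.smul_le_iff, inv_inv]
    obtain ⟨s, hs, hsc⟩ := h.enumerates.eq_subface hle
    have ho : orb Γ (subface U D x s) = orb Γ c := by rw [hsc, orb_smul]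
    have hcard : s.card = n + 1 := by
      rw [← h.enumerates.card_subface hs, hsc, U.card_verts_smul, hc.2]
    have hu : s ≠ Finset.univ := by
      rintro rfl
      have := K.dim_le c hc.1
      rw [hc.2, ← hcard] at this
      simp at this
    by_cases hJ : Jᶜ ⊆ s
    · exact Or.inr ⟨s, hcard, hJ, ho⟩
    · refine Or.inl ⟨subface U D x s, ⟨(h.subface_mem_new hs hu).2 hJ, ?_⟩, ho⟩
      rw [h.enumerates.card_subface hs, hcard]

lemma orb_subface_mem {n : ℕ} (hn : s.card = n + 1) (hn5 : n < 5) :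
    orb Γ (subface U D x s) ∈ K.orbits n ↔ ¬ J ⊆ s := by
  have hs : s.Nonempty := by rw [← Finset.card_pos, hn]; exact n.succ_pos
  have hu : s ≠ Finset.univ := by
    rintro rfl
    simp at hn
    omega
  rw [K.orb_mem_orbits]
  constructor
  · exact fun hm => (h.subface_mem hs hu).1 hm.1
  · exact fun hJ => ⟨(h.subface_mem hs hu).2 hJ, by rw [h.enumerates.card_subface hs, hn]⟩

lemma orb_subface_mem_new {n : ℕ} (hn : s.card = n + 1) (hn5 : n < 5) :
    orb Γ (subface U D x s) ∈ K'.orbits n ↔ ¬ Jᶜ ⊆ s :=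
  h.symm.orb_subface_mem hn hn5

open Classical in
lemma orbits_sdiff {n : ℕ} (hn5 : n < 5) :
    (K.orbits n).toFinset \ (K'.orbits n).toFinset =
      ((Finset.univ.powersetCard (n + 1)).filter fun s => Jᶜ ⊆ s).image
        fun s => orb Γ (subface U D x s) := by
  ext q
  simp only [Finset.mem_sdiff, Set.mem_toFinset, Finset.mem_image, Finset.mem_filter,
    Finset.mem_powersetCard, Finset.subset_univ, true_and]
  constructor
  · rintro ⟨h1, h2⟩
    rcases h.mem_orbits_or h1 with h3 | ⟨s, h3, h4, h5⟩
    · exact absurd h3 h2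
    · exact ⟨s, ⟨h3, h4⟩, h5⟩
  · rintro ⟨s, ⟨h1, h2⟩, rfl⟩
    rw [h.orb_subface_mem h1 hn5, h.orb_subface_mem_new h1 hn5]
    refine ⟨fun hJ => ?_, fun hJ => hJ h2⟩
    have : s = Finset.univ := by
      rw [← Finset.univ_subset_iff, ← Finset.union_compl J]
      exact Finset.union_subset hJ h2
    rw [this] at h1
    simp at h1
    omega

lemma orb_subface_injOn {n : ℕ} :
    Set.InjOn (fun s => orb Γ (subface U D x s))
      ((Finset.univ.powersetCard (n + 1)).filter fun s => Jᶜ ⊆ s : Finset (Finset (Fin 6))) := by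
  intro s hs t ht hst
  simp only [Finset.coe_filter, Set.mem_ofPred_eq, Finset.mem_powersetCard] at hs ht
  have hs0 : s.Nonempty := by rw [← Finset.card_pos, hs.1.2]; exact n.succ_pos
  have ht0 : t.Nonempty := by rw [← Finset.card_pos, ht.1.2]; exact n.succ_pos
  exact h.orb_subface_injective ht0 hs0 (Or.inr ht.2) hst

open Classical in
lemma prod_orbits {n : ℕ} (hn5 : n < 5) (f : Orb Γ C → ℝ) :
    ∏ q ∈ (K.orbits n).toFinset, f q =
      (∏ q ∈ (K.orbits n).toFinset ∩ (K'.orbits n).toFinset, f q) *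
      ∏ s ∈ (Finset.univ.powersetCard (n + 1)).filter (fun s => Jᶜ ⊆ s),
        f (orb Γ (subface U D x s)) := by
  rw [← Finset.prod_inter_mul_prod_sdiff _ (K'.orbits n).toFinset, h.orbits_sdiff hn5,
    Finset.prod_image h.orb_subface_injOn]

open Classical in
lemma sum_orbits {n : ℕ} (hn5 : n < 5) (f : Orb Γ C → ℝ) :
    ∑ q ∈ (K.orbits n).toFinset, f q =
      (∑ q ∈ (K.orbits n).toFinset ∩ (K'.orbits n).toFinset, f q) +
      ∑ s ∈ (Finset.univ.powersetCard (n + 1)).filter (fun s => Jᶜ ⊆ s),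
        f (orb Γ (subface U D x s)) := by
  rw [← Finset.sum_inter_add_sum_sdiff _ (K'.orbits n).toFinset, h.orbits_sdiff hn5,
    Finset.sum_image h.orb_subface_injOn]

end IsMove

end Clusters

section Variation

variable {Γ V C : Type*} [Group Γ] [MulAction Γ V] [MulAction Γ C] [PartialOrder C]
  {U : SimplicialCells Γ V C} {K K' : Triangulation U} {D : C} {x : Fin 6 → V}
  {J : Finset (Fin 6)}

/-! ### Orientations of the facets of the 5-simplex -/

/-- Bringing the m-th vertex to the front is a cycle, whose sign is (−1)^m. -/
lemma cons_succAbove_eq {α : Type*} (x : Fin 6 → α) (j : Fin 6) (m : Fin 5) :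
    (Fin.cons (x (j.succAbove m)) (x ∘ j.succAbove ∘ m.succAbove) : Fin 5 → α) =
      (x ∘ j.succAbove) ∘ m.cycleRange.symm := by
  ext k
  refine Fin.cases ?_ (fun k => ?_) k
  · simp
  · simp

/-- The facets opposite to `j` and `k` share the ridge opposite to both; `m` and `m'` are the
positions in each facet of the vertex outside the ridge. The odd parity is the classical sign rule
for the boundary of a boundary. -/
lemma exists_succAbove_pair : ∀ j k : Fin 6, j ≠ k → ∃ m m' : Fin 5, j.succAbove m = k ∧
    k.succAbove m' = j ∧
    (∀ l : Fin 4, j.succAbove (m.succAbove l) = k.succAbove (m'.succAbove l)) ∧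
    (m : ℕ) + j + m' + k ≡ 1 [MOD 2] := by
  unfold Nat.ModEq
  decide

lemma units_sign_eq {a b : ℤˣ} {m j m' k : ℕ} (h : m + j + m' + k ≡ 1 [MOD 2])
    (hab : (-1) ^ m * a = (-1) ^ m' * b) : (-1) ^ j * a = -((-1) ^ k * b) := by
  have ha : a = (-1) ^ m * ((-1) ^ m' * b) := by
    rw [← hab, ← mul_assoc, ← pow_add, ← two_mul, pow_mul]
    simp
  have hp : (-1 : ℤˣ) ^ (m + j + m' + k) = -1 :=
    Odd.neg_one_pow (Nat.odd_iff.2 h)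
  have hk : (-1 : ℤˣ) ^ k * (-1) ^ k = 1 := by rw [← mul_pow]; simp
  have h1 : (-1 : ℤˣ) ^ j * ((-1) ^ m * ((-1) ^ m' * b)) = (-1) ^ m * (-1) ^ j * (-1) ^ m' * b := by
    ac_rfl
  have h2 : (-1 : ℤˣ) ^ m * (-1) ^ j * (-1) ^ m' * (-1) ^ k * ((-1) ^ k * b) =
      (-1) ^ m * (-1) ^ j * (-1) ^ m' * b * ((-1) ^ k * (-1) ^ k) := by ac_rfl
  rw [pow_add, pow_add, pow_add] at hp
  rw [ha, h1, ← neg_one_mul ((-1) ^ k * b)]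
  exact ((congrArg (· * ((-1) ^ k * b)) hp.symm).trans (h2.trans (by rw [hk, mul_one]))).symm

/-- The orientation which the ordering `x` and the 4-simplex opposite to `x j` induce. -/
def facetOrient (K : Triangulation U) (D : C) (x : Fin 6 → V) (j : Fin 6) : ℤˣ :=
  (-1) ^ (j : ℕ) * K.orient (subface U D x {j}ᶜ) (x ∘ j.succAbove)

lemma orient_cons (hx : U.Enumerates D x) (K : Triangulation U) {j : Fin 6}
    (hj : subface U D x {j}ᶜ ∈ K.cells) (m : Fin 5) :
    K.orient (subface U D x {j}ᶜ)
      (Fin.cons (x (j.succAbove m)) (x ∘ j.succAbove ∘ m.succAbove) : Fin 5 → V) =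
      (-1) ^ (m : ℕ) * K.orient (subface U D x {j}ᶜ) (x ∘ j.succAbove) := by
  rw [cons_succAbove_eq, K.orient_perm _ hj _ (hx.enumerates_facet j), Equiv.Perm.sign_symm,
    Fin.sign_cycleRange]

lemma enumerates_cons (hx : U.Enumerates D x) (j : Fin 6) (m : Fin 5) :
    U.Enumerates (subface U D x {j}ᶜ)
      (Fin.cons (x (j.succAbove m)) (x ∘ j.succAbove ∘ m.succAbove) : Fin 5 → V) := by
  rw [cons_succAbove_eq]
  exact ⟨(hx.enumerates_facet j).1.comp (Equiv.injective _),
    by rw [← (hx.enumerates_facet j).2, EquivLike.range_comp]⟩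

lemma facet_ridge (hx : U.Enumerates D x) {j k : Fin 6} (hjk : j ≠ k) :
    ∃ (m m' : Fin 5) (w : Fin 4 → V), (m : ℕ) + j + m' + k ≡ 1 [MOD 2] ∧
      j.succAbove m = k ∧ k.succAbove m' = j ∧
      w = x ∘ j.succAbove ∘ m.succAbove ∧ w = x ∘ k.succAbove ∘ m'.succAbove ∧
      U.Enumerates (subface U D x {j, k}ᶜ) w ∧
      subface U D x {j, k}ᶜ ≤ subface U D x {j}ᶜ ∧
      subface U D x {j, k}ᶜ ≤ subface U D x {k}ᶜ := by
  obtain ⟨m, m', h1, h2, h3, h4⟩ := exists_succAbove_pair j k hjk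
  have hne : ({j, k}ᶜ : Finset (Fin 6)).Nonempty := by
    rw [← Finset.card_pos, Finset.card_compl, Finset.card_pair hjk]
    simp
  refine ⟨m, m', _, h4, h1, h2, rfl, ?_, ?_, hx.subface_mono hne ?_, hx.subface_mono hne ?_⟩
  · ext l
    exact congrArg x (h3 l)
  · refine hx.enumerates_subface (Fin.succAbove_right_injective.comp
      Fin.succAbove_right_injective) hne ?_
    rw [Set.range_comp, Fin.range_succAbove]
    ext l
    simp only [Set.mem_image, Set.mem_compl_iff, Set.mem_singleton_iff, Finset.coe_compl,
      Finset.coe_insert, Finset.coe_singleton, Set.mem_insert_iff]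
    constructor
    · rintro ⟨i, hi, rfl⟩
      rw [not_or]
      exact ⟨Fin.succAbove_ne j i, fun e => hi (Fin.succAbove_right_injective (e.trans h1.symm))⟩
    · rintro hl
      rw [not_or] at hl
      obtain ⟨i, hi⟩ := Fin.exists_succAbove_eq hl.1
      exact ⟨i, fun e => hl.2 (by rw [← hi, e, h1]), hi⟩
  · rw [Finset.compl_subset_compl]
    simp
  · rw [Finset.compl_subset_compl]
    simp

/-- Coherence across the common ridge contributes −1, which the odd parity of the positions cancels.
So all facets in `K` are oriented as parts of one oriented boundary of `D`. -/
lemma facetOrient_eq (hx : U.Enumerates D x) (K : Triangulation U) {j k : Fin 6}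
    (hj : subface U D x {j}ᶜ ∈ K.cells) (hk : subface U D x {k}ᶜ ∈ K.cells) :
    facetOrient K D x j = facetOrient K D x k := by
  by_cases hjk : j = k
  · rw [hjk]
  obtain ⟨m, m', w, hp, h1, h2, hw, hw', ht, hle, hle'⟩ := facet_ridge hx hjk
  have hne : subface U D x {j}ᶜ ≠ subface U D x {k}ᶜ := fun e => hjk (by
    have := hx.subface_injective (compl_singleton_nonempty j) (compl_singleton_nonempty k) e
    simpa using this)
  have e1 := enumerates_cons hx j m
  have e2 := enumerates_cons hx k m'
  rw [← hw] at e1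
  rw [← hw'] at e2
  have h := K.orient_coherent _ hj _ hk hne _ hle hle' w _ _ ht e1 e2
  have o1 := orient_cons hx K hj m
  have o2 := orient_cons hx K hk m'
  rw [← hw] at o1
  rw [← hw'] at o2
  rw [o1, o2, ← mul_neg] at h
  have := units_sign_eq hp h
  rw [mul_neg, neg_neg] at this
  exact this

lemma IsMove.facet_mem (h : IsMove K K' D x J) (j : Fin 6) :
    subface U D x {j}ᶜ ∈ K.simplices 4 ↔ j ∈ J := by
  have hc : ({j}ᶜ : Finset (Fin 6)).card = 4 + 1 := by rw [Finset.card_compl]; simp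
  rw [← K.orb_mem_orbits, h.orb_subface_mem hc (by norm_num), Finset.not_subset]
  simp

lemma IsMove.facet_mem_new (h : IsMove K K' D x J) (j : Fin 6) :
    subface U D x {j}ᶜ ∈ K'.simplices 4 ↔ j ∉ J := by
  rw [h.symm.facet_mem, Finset.mem_compl]

/-- Across a ridge between the clusters an old and a new facet induce the same, not opposite,
orientations, and the parity now leaves a sign −1. -/
lemma IsMove.facetOrient_neg (h : IsMove K K' D x J) {j k : Fin 6} (hj : j ∈ J) (hk : k ∉ J) :
    facetOrient K D x j = -facetOrient K' D x k := by
  have hx := h.enumerates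
  have hjk : j ≠ k := fun e => hk (e ▸ hj)
  obtain ⟨m, m', w, hp, h1, h2, hw, hw', ht, hle, hle'⟩ := facet_ridge hx hjk
  have hjm := (h.facet_mem j).2 hj
  have hkm := (h.facet_mem_new k).2 hk
  have e1 := enumerates_cons hx j m
  have e2 := enumerates_cons hx k m'
  rw [← hw] at e1
  rw [← hw'] at e2
  have hb := h.orient_boundary _ hjm _ hkm
    (hx.subface_lt (compl_singleton_nonempty j) (by simp [Finset.ext_iff]))
    (hx.subface_lt (compl_singleton_nonempty k) (by simp [Finset.ext_iff])) _ hle hle' w _ _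
    ht e1 e2
  have o1 := orient_cons hx K hjm.1 m
  have o2 := orient_cons hx K' hkm.1 m'
  rw [← hw] at o1
  rw [← hw'] at o2
  rw [o1, o2] at hb
  exact units_sign_eq hp hb

lemma exists_orientation (h : IsMove K K' D x J) (hJ : ∃ k, k ∉ J) :
    ∃ o : ℤˣ, (∀ j ∈ J, facetOrient K D x j = -o) ∧ ∀ j ∉ J, facetOrient K' D x j = o := by
  obtain ⟨k, hk⟩ := hJ
  exact ⟨facetOrient K' D x k, fun j hj => h.facetOrient_neg hj hk, fun j hj =>
    facetOrient_eq h.enumerates K' ((h.facet_mem_new j).2 hj).1 ((h.facet_mem_new k).2 hk).1⟩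

/-! ### The variation of the deficit angles -/

variable (P : Development Γ V)

/-- The factors (−1)^j in `facetOrient` and in `dependency` cancel each other. -/
lemma simplexSign_facet (hx : U.Enumerates D x) (K : Triangulation U) {j : Fin 6}
    (hj : subface U D x {j}ᶜ ∈ K.simplices 4) :
    simplexSign K P (subface U D x {j}ᶜ) =
      ((facetOrient K D x j : ℤ) : ℝ) * Real.sign (dependency (P.pos ∘ x) j) := by
  rw [simplexSign_eq K P hj (hx.enumerates_facet j), dependency_eq, facetOrient, P.edgeDet_eq]
  rcases neg_one_pow_eq_or ℝ (j : ℕ) with hs | hs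
  · have : (-1 : ℤˣ) ^ (j : ℕ) = 1 := by
      rcases neg_one_pow_eq_or ℤˣ (j : ℕ) with h' | h'
      · exact h'
      · have h'' := congrArg (fun z : ℤˣ => ((z : ℤ) : ℝ)) h'
        push_cast at h''
        rw [hs] at h''
        norm_num at h''
    rw [this, hs, one_mul, one_mul]
    rfl
  · have : (-1 : ℤˣ) ^ (j : ℕ) = -1 := by
      rcases neg_one_pow_eq_or ℤˣ (j : ℕ) with h' | h'
      · have h'' := congrArg (fun z : ℤˣ => ((z : ℤ) : ℝ)) h'
        push_cast at h''
        rw [hs] at h''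
        norm_num at h''
      · exact h'
    rw [this, hs, neg_one_mul, neg_one_mul, Real.sign_neg]
    push_cast
    rw [neg_mul_neg]
    rfl

lemma facets_filter (J : Finset (Fin 6)) :
    (Finset.univ.powersetCard (4 + 1)).filter (fun s : Finset (Fin 6) => Jᶜ ⊆ s) =
      J.image fun j => ({j}ᶜ : Finset (Fin 6)) := by
  ext s
  simp only [Finset.mem_filter, Finset.mem_powersetCard, Finset.subset_univ, true_and,
    Finset.mem_image]
  constructor
  · rintro ⟨h1, h2⟩
    have : sᶜ.card = 1 := by rw [Finset.card_compl, h1]; simp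
    obtain ⟨j, hj⟩ := Finset.card_eq_one.1 this
    refine ⟨j, ?_, by rw [← hj, compl_compl]⟩
    have hs : sᶜ ⊆ J := by rwa [← Finset.compl_subset_compl, compl_compl]
    exact hs (by rw [hj]; simp)
  · rintro ⟨j, hj, rfl⟩
    refine ⟨by rw [Finset.card_compl]; simp, ?_⟩
    rw [Finset.compl_subset_compl]
    simpa using hj

open Classical in
lemma IsMove.sum_simplices (h : IsMove K K' D x J) (f : Orb Γ C → ℝ) :
    ∑ q ∈ (K.orbits 4).toFinset, f q =
      (∑ q ∈ (K.orbits 4).toFinset ∩ (K'.orbits 4).toFinset, f q) +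
      ∑ j ∈ J, f (orb Γ (subface U D x {j}ᶜ)) := by
  rw [h.sum_orbits (by norm_num), facets_filter, Finset.sum_image]
  intro j _ k _ hjk
  simpa using hjk

lemma sign_mul_angleSum_out (K : Triangulation U) (L : Orb Γ C → ℝ) (i : Orb Γ C) {p : C}
    (hp : p ∈ K.simplices 4) :
    simplexSign K P (orb Γ p).out * angleSum U L (orb Γ p).out i =
      simplexSign K P p * angleSum U L p i := by
  obtain ⟨γ, hγ⟩ := exists_smul_out (Γ := Γ) p
  rw [← hγ, simplexSign_smul K P γ hp, angleSum_smul L γ hp.2]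

open Classical in
-- The common 4-simplices cancel. The old cluster enters with sign −o and is removed, the new one
-- enters with o and is added, so all six facets of `D` appear with the same overall sign whatever
-- `J` is.
lemma deficit_sub_deficit (h : IsMove K K' D x J) {o : ℤˣ}
    (ho : (∀ j ∈ J, facetOrient K D x j = -o) ∧ ∀ j ∉ J, facetOrient K' D x j = o)
    (L : Orb Γ C → ℝ) {i : C} (hi : (U.verts i).card = 3) :
    deficit K' P L i = deficit K P L i - ((o : ℤ) : ℝ) * ∑ j,
      Real.sign (dependency (P.pos ∘ x) j) * angleSum U L (subface U D x {j}ᶜ) (orb Γ i) := by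
  rw [deficit_eq_sum K P L hi, deficit_eq_sum K' P L hi, h.sum_simplices, h.symm.sum_simplices]
  have hc : ∑ q ∈ (K'.orbits 4).toFinset ∩ (K.orbits 4).toFinset,
      simplexSign K' P q.out * angleSum U L q.out (orb Γ i) =
      ∑ q ∈ (K.orbits 4).toFinset ∩ (K'.orbits 4).toFinset,
      simplexSign K P q.out * angleSum U L q.out (orb Γ i) := by
    rw [Finset.inter_comm]
    refine Finset.sum_congr rfl fun q hq => ?_
    rw [Finset.mem_inter, Set.mem_toFinset, Set.mem_toFinset] at hq
    have h1 := K.out_mem_simplices.2 hq.1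
    have h2 := K'.out_mem_simplices.2 hq.2
    rw [simplexSign, simplexSign, h.orient_outside _ h1 h2 _ (U.tuple_spec (n := 4) h1.2)]
  have hJ : ∀ j ∈ J, simplexSign K P (orb Γ (subface U D x {j}ᶜ)).out *
      angleSum U L (orb Γ (subface U D x {j}ᶜ)).out (orb Γ i) = -(((o : ℤ) : ℝ) *
      (Real.sign (dependency (P.pos ∘ x) j) *
        angleSum U L (subface U D x {j}ᶜ) (orb Γ i))) := fun j hj => by
    have hm := (h.facet_mem j).2 hj
    rw [sign_mul_angleSum_out P K L _ hm, simplexSign_facet P h.enumerates K hm, ho.1 j hj]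
    push_cast
    ring
  have hJ' : ∀ j ∈ Jᶜ, simplexSign K' P (orb Γ (subface U D x {j}ᶜ)).out *
      angleSum U L (orb Γ (subface U D x {j}ᶜ)).out (orb Γ i) = ((o : ℤ) : ℝ) *
      (Real.sign (dependency (P.pos ∘ x) j) *
        angleSum U L (subface U D x {j}ᶜ) (orb Γ i)) := fun j hj => by
    have hj := Finset.mem_compl.1 hj
    have hm := (h.facet_mem_new j).2 hj
    rw [sign_mul_angleSum_out P K' L _ hm, simplexSign_facet P h.enumerates K' hm, ho.2 j hj,
      mul_assoc]
  rw [Finset.sum_congr rfl hJ, Finset.sum_congr rfl hJ', hc, ← Finset.sum_add_sum_compl J,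
    Finset.sum_neg_distrib, ← Finset.mul_sum, ← Finset.mul_sum]
  ring

open Classical in
-- The triangles of a facet are indexed as triangles of `D` avoiding `x j`; this common index set
-- allows the sums over facets and over triangles to be exchanged.
lemma angleSum_facet (hx : U.Enumerates D x) (L : Orb Γ C → ℝ) (j : Fin 6) (i : Orb Γ C) :
    angleSum U L (subface U D x {j}ᶜ) i =
      ∑ s ∈ (Finset.univ.powersetCard 3 : Finset (Finset (Fin 6))),
        if orb Γ (subface U D x s) = i ∧ j ∉ s then
          angleAt U L (subface U D x {j}ᶜ) (subface U D x s) else 0 := by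
  have hF := hx.subface_spec (compl_singleton_nonempty j)
  have hv : U.verts (subface U D x {j}ᶜ) = ({j}ᶜ : Finset (Fin 6)).map ⟨x, hx.1⟩ :=
    Finset.coe_injective (by rw [hF.2, Finset.coe_map]; rfl)
  have hface : ∀ s ∈ ({j}ᶜ : Finset (Fin 6)).powersetCard 3,
      U.face (subface U D x {j}ᶜ) ((s.map ⟨x, hx.1⟩ : Finset V) : Set V) = subface U D x s := by
    intro s hs
    rw [Finset.mem_powersetCard] at hs
    have hne : s.Nonempty := by rw [← Finset.card_pos, hs.2]; norm_num
    refine U.face_eq (hx.subface_mono hne hs.1) ?_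
    rw [(hx.subface_spec hne).2, Finset.coe_map]
    rfl
  rw [angleSum, hv, Finset.powersetCard_map, Finset.sum_filter, Finset.sum_map]
  have hsub : ({j}ᶜ : Finset (Fin 6)).powersetCard 3 ⊆ Finset.univ.powersetCard 3 :=
    Finset.powersetCard_mono (Finset.subset_univ _)
  rw [← Finset.sum_subset hsub]
  · refine Finset.sum_congr rfl fun s hs => ?_
    have hf : U.face (subface U D x {j}ᶜ)
        (((Finset.mapEmbedding ⟨x, hx.1⟩).toEmbedding s : Finset V) : Set V) =
        subface U D x s := hface s hs
    have hj : j ∉ s := fun hj => by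
      have := (Finset.mem_powersetCard.1 hs).1 hj
      simp at this
    rw [hf]
    simp only [hj, not_false_eq_true, and_true]
  · intro s hs hs'
    rw [if_neg]
    rintro ⟨-, hj⟩
    refine hs' (Finset.mem_powersetCard.2 ⟨?_, (Finset.mem_powersetCard.1 hs).2⟩)
    intro k hk
    simp only [Finset.mem_compl, Finset.mem_singleton]
    rintro rfl
    exact hj hk

section Derivative

open Classical in
-- Several edges of one simplex may lie in the same orbit and then vary together, which is why
-- `edgeWeight` is a sum over pairs of vertices.
lemma hasDerivAt_edgeVar (L : Orb Γ C → ℝ) (a : Orb Γ C) (p : C) (u w : V) (t : ℝ) :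
    HasDerivAt (fun s => edgeVar U (Function.update L a s) p u w)
      (if u ≠ w ∧ orb Γ (U.face p {u, w}) = a then 1 else 0) t := by
  by_cases huw : u = w
  · simp only [edgeVar, huw, if_true, ne_eq, not_true_eq_false, false_and, if_false]
    exact hasDerivAt_const _ _
  · by_cases ha : orb Γ (U.face p {u, w}) = a
    · simp only [edgeVar, huw, if_false, ne_eq, not_false_eq_true, true_and, ha, if_true,
        Function.update_self]
      exact hasDerivAt_id _
    · simp only [edgeVar, huw, if_false, ne_eq, not_false_eq_true, true_and, ha,
        Function.update_of_ne ha]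
      exact hasDerivAt_const _ _

open Classical in
lemma differentiableAt_angleAt {K : Triangulation U} (hK : P.Nondegenerate K) (a : Orb Γ C)
    {p i : C} (hp : p ∈ K.simplices 4) (hi : (U.verts i).card = 3) (hip : i ≤ p) :
    DifferentiableAt ℝ (fun s => angleAt U (Function.update (sqLength U P) a s) p i)
      (sqLength U P a) := by
  have hf := (U.flag_spec hp.2 hi hip).1
  have := (hasDerivAt_dihedralAngle (y := P.pos ∘ U.flag p i)
    (e := fun s m n => edgeVar U (Function.update (sqLength U P) a s) p (U.flag p i m)
      (U.flag p i n))
    (fun m n => hasDerivAt_edgeVar (sqLength U P) a p (U.flag p i m) (U.flag p i n)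
      (sqLength U P a))
    (fun m n => by
      rw [Function.update_eq_self]
      exact P.sqLength_eq U (hf.mem m) (hf.mem n))
    (P.edgeDet_ne_zero hK hp hf)).differentiableAt
  exact this

open Classical in
lemma differentiableAt_deficit {K : Triangulation U} (hK : P.Nondegenerate K) (a : Orb Γ C)
    {i : C} (hi : (U.verts i).card = 3) :
    DifferentiableAt ℝ (fun s => deficit K P (Function.update (sqLength U P) a s) i)
      (sqLength U P a) := by
  simp only [deficit_eq_sum K P _ hi, angleSum]
  refine DifferentiableAt.neg (DifferentiableAt.fun_sum fun q hq => ?_)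
  refine DifferentiableAt.const_mul (DifferentiableAt.fun_sum fun s hs => ?_) _
  have hs := (Finset.mem_filter.1 hs).1
  have hf := face_spec_of_mem_powersetCard hs
  have := differentiableAt_angleAt P hK a (K.out_mem_simplices.2 (Set.mem_toFinset.1 hq))
    (by rw [hf.2.2.2]; exact (Finset.mem_powersetCard.1 hs).2) hf.2.2.1
  exact this

end Derivative

end Variation

/-! ### The rank-one change of the matrix (∂Ω/∂S) -/

section RankOne

variable {Γ V C : Type*} [Group Γ] [MulAction Γ V] [MulAction Γ C] [PartialOrder C]
  {U : SimplicialCells Γ V C} {K K' : Triangulation U} {D : C} {x : Fin 6 → V}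
  {J : Finset (Fin 6)} (P : Development Γ V)

open Classical in
/-- The gradient, up to a factor, of the Cayley-Menger determinant of the 5-simplex `D`, as a
function on the edges of the quotient. -/
def edgeWeight (U : SimplicialCells Γ V C) (P : Development Γ V) (D : C) (x : Fin 6 → V)
    (a : Orb Γ C) : ℝ :=
  1 / 2 * ∑ k, ∑ l, dependency (P.pos ∘ x) k * dependency (P.pos ∘ x) l *
    if x k ≠ x l ∧ orb Γ (U.face D {x k, x l}) = a then 1 else 0

open Classical in
/-- The weights with which the triangular faces of the 5-simplex `D` enter in the variation of
the deficit angles. -/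
def faceWeight (U : SimplicialCells Γ V C) (P : Development Γ V) (D : C) (x : Fin 6 → V)
    (i : Orb Γ C) : ℝ :=
  ∑ s ∈ (Finset.univ.powersetCard 3 : Finset (Finset (Fin 6))),
    if orb Γ (subface U D x s) = i then
      P.area U (subface U D x s) / ∏ k ∈ sᶜ, dependency (P.pos ∘ x) k else 0

lemma exists_perm_mem_iff {s : Finset (Fin 6)} (hs : s.card = 3) :
    ∃ π : Equiv.Perm (Fin 6), ∀ k, π k ∈ s ↔ k < 3 := by
  have hc : Fintype.card {k : Fin 6 // k < 3} = Fintype.card {k : Fin 6 // k ∈ s} := by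
    rw [Fintype.card_coe, hs]
    decide
  have e : {k : Fin 6 // k < 3} ≃ {k : Fin 6 // k ∈ s} := Fintype.equivOfCardEq hc
  refine ⟨e.extendSubtype, fun k => ⟨fun h => ?_, fun h => e.extendSubtype_mem k h⟩⟩
  by_contra hk
  exact e.extendSubtype_not_mem k hk h

lemma filter_perm {s : Finset (Fin 6)} {π : Equiv.Perm (Fin 6)} (hπ : ∀ k, π k ∈ s ↔ k < 3) :
    sᶜ = ({3, 4, 5} : Finset (Fin 6)).map π.toEmbedding ∧
      s = ({0, 1, 2} : Finset (Fin 6)).map π.toEmbedding := by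
  have h1 : ∀ k : Fin 6, ¬ k < 3 ↔ k ∈ ({3, 4, 5} : Finset (Fin 6)) := by decide
  have h2 : ∀ k : Fin 6, k < 3 ↔ k ∈ ({0, 1, 2} : Finset (Fin 6)) := by decide
  constructor
  · ext k
    rw [Finset.mem_map_equiv, Finset.mem_compl, ← h1, ← hπ, Equiv.apply_symm_apply]
  · ext k
    rw [Finset.mem_map_equiv, ← h2, ← hπ, Equiv.apply_symm_apply]

lemma angleAt_subface (hx : U.Enumerates D x) (L : Orb Γ C → ℝ) {s : Finset (Fin 6)}
    {π : Equiv.Perm (Fin 6)} (hπ : ∀ k, π k ∈ s ↔ k < 3) {m : Fin 6} (hm : 3 ≤ m) :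
    angleAt U L (subface U D x {π m}ᶜ) (subface U D x s) =
      dihedralAngle fun a b => edgeVar U L D (x (π (m.succAbove a))) (x (π (m.succAbove b))) := by
  have hs : s = {π 0, π 1, π 2} := by rw [(filter_perm hπ).2]; simp
  have hne : s.Nonempty := by rw [hs]; simp
  have hcard : s.card = 3 := by rw [(filter_perm hπ).2, Finset.card_map]; rfl
  have hF := hx.subface_spec (compl_singleton_nonempty (π m))
  have hy : U.Enumerates (subface U D x {π m}ᶜ) (x ∘ fun a => π (m.succAbove a)) := by
    refine hx.enumerates_subface (π.injective.comp Fin.succAbove_right_injective)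
      (compl_singleton_nonempty _) ?_
    have : (fun a => π (m.succAbove a)) = π ∘ m.succAbove := rfl
    rw [this, Set.range_comp, Fin.range_succAbove, Set.image_compl_eq π.bijective]
    simp
  have v0 : ∀ k : Fin 6, 3 ≤ k → k.succAbove 0 = 0 ∧ k.succAbove 1 = 1 ∧ k.succAbove 2 = 2 := by
    decide
  have hle : subface U D x s ≤ subface U D x {π m}ᶜ := by
    refine hx.subface_mono hne fun k hk => ?_
    rw [Finset.mem_compl, Finset.mem_singleton]
    rintro rfl
    exact absurd ((hπ m).1 hk) (not_lt.2 hm)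
  rw [angleAt_eq U L (by rw [hx.card_subface (compl_singleton_nonempty _), Finset.card_compl]; simp)
    (by rw [hx.card_subface hne, hcard]) hle hy]
  · simp only [edgeVar_of_le U L hF.1 (hy.mem _) (hy.mem _)]
    rfl
  · rw [(hx.subface_spec hne).2, hs]
    simp only [Function.comp_apply, (v0 m hm).1, (v0 m hm).2.1, (v0 m hm).2.2]
    simp [Set.image_insert_eq]

open Classical in
-- A permutation carrying {0, 1, 2} to `s` reduces this to the model computation for six points. It
-- multiplies all coefficients δ_k by its sign σ: the signs of the angles and the product of three
-- coefficients each acquire a factor σ, while the quadratic edge weight is unaffected.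
lemma hasDerivAt_sum_angleAt (hx : U.Enumerates D x)
    (hd : ∀ k, dependency (P.pos ∘ x) k ≠ 0) (a : Orb Γ C) {s : Finset (Fin 6)}
    (hs : s.card = 3) :
    HasDerivAt (fun t => ∑ j ∈ sᶜ, Real.sign (dependency (P.pos ∘ x) j) *
        angleAt U (Function.update (sqLength U P) a t) (subface U D x {j}ᶜ) (subface U D x s))
      (P.area U (subface U D x s) / (∏ k ∈ sᶜ, dependency (P.pos ∘ x) k) * edgeWeight U P D x a)
      (sqLength U P a) := by
  obtain ⟨π, hπ⟩ := exists_perm_mem_iff hs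
  obtain ⟨σ, hσ1, hσ2⟩ : ∃ σ : ℝ, (σ = 1 ∨ σ = -1) ∧
      ∀ k, dependency ((P.pos ∘ x) ∘ π) k = σ * dependency (P.pos ∘ x) (π k) := by
    refine ⟨((Equiv.Perm.sign π : ℤ) : ℝ), ?_, fun k => dependency_comp_perm _ _ _⟩
    rcases Int.units_eq_one_or (Equiv.Perm.sign π) with h | h <;> simp [h]
  have hσ0 : σ ≠ 0 := by rcases hσ1 with h | h <;> rw [h] <;> norm_num
  have hsq : σ * σ = 1 := by rcases hσ1 with h | h <;> rw [h] <;> norm_num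
  have hsign : ∀ z : ℝ, Real.sign (σ * z) = σ * Real.sign z := fun z => by
    rcases hσ1 with h | h <;> rw [h]
    · rw [one_mul, one_mul]
    · rw [neg_one_mul, Real.sign_neg, neg_one_mul]
  have H := (hasDerivAt_sum_dihedralAngle
    (e := fun t k l => edgeVar U (Function.update (sqLength U P) a t) D (x (π k)) (x (π l)))
    (y := (P.pos ∘ x) ∘ π)
    (fun k l => hasDerivAt_edgeVar (sqLength U P) a D (x (π k)) (x (π l)) (sqLength U P a))
    (fun k l => by simp only [ne_comm (a := x (π k)), Set.pair_comm (x (π k))])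
    (fun k => by simp)
    (fun k l => by
      rw [Function.update_eq_self]
      exact P.sqLength_eq U (hx.mem _) (hx.mem _))
    (fun k => by rw [hσ2]; exact mul_ne_zero hσ0 (hd _))).const_mul σ
  have hcompl : ∀ f : Fin 6 → ℝ, ∑ j ∈ sᶜ, f j = f (π 3) + f (π 4) + f (π 5) := fun f => by
    rw [(filter_perm hπ).1, Finset.sum_map, Finset.sum_insert (by decide),
      Finset.sum_insert (by decide), Finset.sum_singleton, ← add_assoc]
    rfl
  have hcompl' : ∀ f : Fin 6 → ℝ, ∏ j ∈ sᶜ, f j = f (π 3) * f (π 4) * f (π 5) := fun f => by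
    rw [(filter_perm hπ).1, Finset.prod_map, Finset.prod_insert (by decide),
      Finset.prod_insert (by decide), Finset.prod_singleton, ← mul_assoc]
    rfl
  have harea : P.area U (subface U D x s) = triangleArea (((P.pos ∘ x) ∘ π) 0)
      (((P.pos ∘ x) ∘ π) 1) (((P.pos ∘ x) ∘ π) 2) := by
    have hs' : s = {π 0, π 1, π 2} := by rw [(filter_perm hπ).2]; simp
    have hy : U.Enumerates (subface U D x s) (x ∘ (π ∘ ![0, 1, 2])) := by
      refine hx.enumerates_subface (π.injective.comp (by decide)) (by rw [hs']; simp) ?_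
      rw [hs']
      ext k
      simp [Fin.exists_fin_succ, eq_comm]
    rw [P.area_eq U hy]
    rfl
  have hsum : ∑ k, ∑ l, dependency ((P.pos ∘ x) ∘ π) k * dependency ((P.pos ∘ x) ∘ π) l *
      (if x (π k) ≠ x (π l) ∧ orb Γ (U.face D {x (π k), x (π l)}) = a then (1 : ℝ) else 0) =
      ∑ k, ∑ l, dependency (P.pos ∘ x) k * dependency (P.pos ∘ x) l *
      (if x k ≠ x l ∧ orb Γ (U.face D {x k, x l}) = a then (1 : ℝ) else 0) := by
    rw [← Equiv.sum_comp π fun k => ∑ l, dependency (P.pos ∘ x) k * dependency (P.pos ∘ x) l *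
      (if x k ≠ x l ∧ orb Γ (U.face D {x k, x l}) = a then (1 : ℝ) else 0)]
    refine Finset.sum_congr rfl fun k _ => ?_
    rw [← Equiv.sum_comp π fun l => dependency (P.pos ∘ x) (π k) * dependency (P.pos ∘ x) l *
      (if x (π k) ≠ x l ∧ orb Γ (U.face D {x (π k), x l}) = a then (1 : ℝ) else 0)]
    refine Finset.sum_congr rfl fun l _ => ?_
    rw [hσ2, hσ2]
    linear_combination (dependency (P.pos ∘ x) (π k) * dependency (P.pos ∘ x) (π l) *
      (if x (π k) ≠ x (π l) ∧ orb Γ (U.face D {x (π k), x (π l)}) = a then (1 : ℝ) else 0)) * hsq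
  rw [hsum, hσ2, hσ2, hσ2, hsign, hsign, hsign] at H
  rw [harea, hcompl', edgeWeight]
  refine (H.congr_of_eventuallyEq (Filter.Eventually.of_forall fun t => ?_)).congr_deriv ?_
  · have key : ∀ a b c d e f : ℝ, a * b + c * d + e * f =
        σ * (σ * a * b + σ * c * d + σ * e * f) := fun a b c d e f => by
      linear_combination -(a * b + c * d + e * f) * hsq
    simp only
    rw [hcompl, angleAt_subface hx _ hπ (by decide), angleAt_subface hx _ hπ (by decide),
      angleAt_subface hx _ hπ (by decide)]
    exact key _ _ _ _ _ _
  · have h3 := hd (π 3)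
    have h4 := hd (π 4)
    have h5 := hd (π 5)
    have : σ * dependency (P.pos ∘ x) (π 3) * (σ * dependency (P.pos ∘ x) (π 4)) *
        (σ * dependency (P.pos ∘ x) (π 5)) = σ * (dependency (P.pos ∘ x) (π 3) *
        dependency (P.pos ∘ x) (π 4) * dependency (P.pos ∘ x) (π 5)) := by
      linear_combination (σ * (dependency (P.pos ∘ x) (π 3) *
        dependency (P.pos ∘ x) (π 4) * dependency (P.pos ∘ x) (π 5))) * hsq
    rw [this]
    field_simp

/-- Each coefficient is up to sign the determinant of a facet, and every facet belongs to one of the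
two nondegenerate triangulations. -/
lemma IsMove.dependency_ne_zero (h : IsMove K K' D x J) (hK : P.Nondegenerate K)
    (hK' : P.Nondegenerate K') (j : Fin 6) : dependency (P.pos ∘ x) j ≠ 0 := by
  have hne : P.edgeDet (x ∘ j.succAbove) ≠ 0 := by
    by_cases hj : j ∈ J
    · exact P.edgeDet_ne_zero hK ((h.facet_mem j).2 hj) (h.enumerates.enumerates_facet j)
    · exact P.edgeDet_ne_zero hK' ((h.facet_mem_new j).2 hj) (h.enumerates.enumerates_facet j)
  rw [dependency_eq]
  exact mul_ne_zero (pow_ne_zero _ (by norm_num)) hne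

open Classical in
/-- A move changes the matrix `(∂Ω_a / ∂S_i)` by a matrix of rank one. -/
theorem omegaMatrix_move (h : IsMove K K' D x J) (hK : P.Nondegenerate K)
    (hK' : P.Nondegenerate K') (hJ : ∃ k, k ∉ J) :
    ∃ c : ℝ, |c| = 1 ∧ ∀ a i : Orb Γ C, (U.verts i.out).card = 3 →
      omegaMatrix K' P a i = omegaMatrix K P a i + c * edgeWeight U P D x a *
        faceWeight U P D x i := by
  obtain ⟨o, ho⟩ := exists_orientation h hJ
  refine ⟨-((o : ℤ) : ℝ), ?_, fun a i hi => ?_⟩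
  · rcases Int.units_eq_one_or o with h | h <;> simp [h]
  have hx := h.enumerates
  have hd := h.dependency_ne_zero P hK hK'
  -- The angles at each triangle of `D` are collected first, so that the derivative can be taken
  -- triangle by triangle.
  have hswap : ∀ L : Orb Γ C → ℝ, ∑ j, Real.sign (dependency (P.pos ∘ x) j) *
      angleSum U L (subface U D x {j}ᶜ) i =
      ∑ s ∈ (Finset.univ.powersetCard 3 : Finset (Finset (Fin 6))),
        if orb Γ (subface U D x s) = i then
          ∑ j ∈ sᶜ, Real.sign (dependency (P.pos ∘ x) j) *
            angleAt U L (subface U D x {j}ᶜ) (subface U D x s) else 0 := by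
    intro L
    simp only [angleSum_facet hx, Finset.mul_sum]
    rw [Finset.sum_comm]
    refine Finset.sum_congr rfl fun s _ => ?_
    by_cases hs : orb Γ (subface U D x s) = i
    · simp only [hs, true_and, if_true, mul_ite, mul_zero, ← Finset.mem_compl]
      rw [Finset.sum_ite_mem, Finset.univ_inter]
    · simp [hs]
  have hfun : (fun t => deficit K' P (Function.update (sqLength U P) a t) i.out) = fun t =>
      deficit K P (Function.update (sqLength U P) a t) i.out - ((o : ℤ) : ℝ) *
        ∑ s ∈ (Finset.univ.powersetCard 3 : Finset (Finset (Fin 6))),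
        if orb Γ (subface U D x s) = i then
          ∑ j ∈ sᶜ, Real.sign (dependency (P.pos ∘ x) j) *
            angleAt U (Function.update (sqLength U P) a t) (subface U D x {j}ᶜ)
              (subface U D x s) else 0 := by
    funext t
    rw [deficit_sub_deficit P h ho _ hi, orb_out, hswap]
  have hderiv : HasDerivAt (fun t => ∑ s ∈ (Finset.univ.powersetCard 3 : Finset (Finset (Fin 6))),
      if orb Γ (subface U D x s) = i then
        ∑ j ∈ sᶜ, Real.sign (dependency (P.pos ∘ x) j) *
          angleAt U (Function.update (sqLength U P) a t) (subface U D x {j}ᶜ)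
            (subface U D x s) else 0) (edgeWeight U P D x a * faceWeight U P D x i)
      (sqLength U P a) := by
    rw [faceWeight, Finset.mul_sum]
    refine HasDerivAt.fun_sum fun s hs => ?_
    by_cases hsi : orb Γ (subface U D x s) = i
    · simp only [hsi, if_true]
      exact (hasDerivAt_sum_angleAt P hx hd a (Finset.mem_powersetCard.1 hs).2).congr_deriv
        (mul_comm _ _)
    · simp only [hsi, if_false, mul_zero]
      exact hasDerivAt_const _ _
  have hK0 := (differentiableAt_deficit P hK a hi).hasDerivAt
  have := (hK0.sub (hderiv.const_mul ((o : ℤ) : ℝ))).deriv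
  simp only [omegaMatrix, Matrix.of_apply, deficitDeriv]
  rw [hfun]
  refine this.trans ?_
  ring

open Classical in
/-- Edges outside the triangulation do not enter in the deficit angles. -/
lemma omegaMatrix_eq_zero_of_edge (K : Triangulation U) {a i : Orb Γ C} (ha : a ∉ K.orbits 1)
    (hi : (U.verts i.out).card = 3) : omegaMatrix K P a i = 0 := by
  have hconst : ∀ t, deficit K P (Function.update (sqLength U P) a t) i.out =
      deficit K P (sqLength U P) i.out := by
    intro t
    simp only [deficit_eq_sum K P _ hi, angleSum]
    congr 1
    refine Finset.sum_congr rfl fun q hq => ?_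
    congr 1
    refine Finset.sum_congr rfl fun s hs => ?_
    have hp := K.out_mem_simplices.2 (Set.mem_toFinset.1 hq)
    have hs := (Finset.mem_filter.1 hs).1
    have hf := face_spec_of_mem_powersetCard hs
    have hfl := (U.flag_spec hp.2 (i := U.face q.out (s : Set V))
      (by rw [hf.2.2.2]; exact (Finset.mem_powersetCard.1 hs).2) hf.2.2.1).1
    rw [angleAt, angleAt]
    congr 1
    funext m n
    rw [edgeVar, edgeVar]
    split_ifs with hmn
    · rfl
    · rw [Function.update_of_ne]
      rintro rfl
      apply ha
      have h2 := U.face_spec (c := q.out) ⟨_, Set.mem_insert _ _⟩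
        (Set.pair_subset (hfl.mem m) (hfl.mem n))
      rw [K.orb_mem_orbits]
      refine ⟨K.lower _ _ h2.1 hp.1, ?_⟩
      rw [← Set.ncard_coe_finset, h2.2, Set.ncard_pair hmn]
  simp only [omegaMatrix, Matrix.of_apply, deficitDeriv, hconst, deriv_const]

/-- At a triangle outside `K` the deficit angle is an empty sum. -/
lemma omegaMatrix_eq_zero_of_face (K : Triangulation U) {a i : Orb Γ C} (hK : i ∉ K.orbits 2)
    (hi : (U.verts i.out).card = 3) : omegaMatrix K P a i = 0 := by
  classical
  have hzero : ∀ L, deficit K P L i.out = 0 := by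
    intro L
    rw [deficit_eq_sum K P _ hi, neg_eq_zero]
    refine Finset.sum_eq_zero fun q hq => ?_
    rw [angleSum, Finset.sum_eq_zero, mul_zero]
    intro s hs
    exfalso
    rw [Finset.mem_filter, orb_out] at hs
    have hp := K.out_mem_simplices.2 (Set.mem_toFinset.1 hq)
    have hf := face_spec_of_mem_powersetCard hs.1
    apply hK
    rw [← hs.2, K.orb_mem_orbits]
    exact ⟨K.lower _ _ hf.2.2.1 hp.1,
      by rw [hf.2.2.2]; exact (Finset.mem_powersetCard.1 hs.1).2⟩
  simp only [omegaMatrix, Matrix.of_apply, deficitDeriv, hzero, deriv_const]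

end RankOne

section Minors

variable {Γ V C : Type*} [Group Γ] [MulAction Γ V] [MulAction Γ C] [PartialOrder C]
  {U : SimplicialCells Γ V C} {K K' : Triangulation U} {D : C} {x : Fin 6 → V}
  {J : Finset (Fin 6)} (P : Development Γ V)

/-! ### Weights of the interior edges and faces of the clusters -/

lemma subface_pair (k l : Fin 6) : subface U D x {k, l} = U.face D {x k, x l} := by
  simp [subface, Set.image_pair]

lemma subface_triple (k l m : Fin 6) : subface U D x {k, l, m} = U.face D {x k, x l, x m} := by
  simp [subface, Set.image_insert_eq]

lemma IsMove.faceWeight_eq (h : IsMove K K' D x J) {s : Finset (Fin 6)} (hs : s.card = 3)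
    (hJ : J ⊆ s ∨ Jᶜ ⊆ s) : faceWeight U P D x (orb Γ (subface U D x s)) =
      P.area U (subface U D x s) / ∏ k ∈ sᶜ, dependency (P.pos ∘ x) k := by
  have hs0 : s.Nonempty := by rw [← Finset.card_pos, hs]; norm_num
  rw [faceWeight, Finset.sum_eq_single s]
  · rw [if_pos rfl]
  · intro t ht hts
    rw [if_neg]
    intro ho
    have ht0 : t.Nonempty := by
      rw [← Finset.card_pos, (Finset.mem_powersetCard.1 ht).2]; norm_num
    exact hts (h.orb_subface_injective hs0 ht0 hJ ho)
  · intro hn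
    exact absurd (Finset.mem_powersetCard.2 ⟨Finset.subset_univ _, hs⟩) hn

/-- An interior edge is not identified with another edge of `D`, so only the two orderings of its
ends contribute, and they compensate the factor 1/2. -/
lemma IsMove.edgeWeight_eq (h : IsMove K K' D x J) {k l : Fin 6} (hkl : k ≠ l)
    (hJ : J ⊆ {k, l} ∨ Jᶜ ⊆ {k, l}) : edgeWeight U P D x (orb Γ (subface U D x {k, l})) =
      dependency (P.pos ∘ x) k * dependency (P.pos ∘ x) l := by
  have hcond : ∀ m n : Fin 6, (x m ≠ x n ∧ orb Γ (U.face D {x m, x n}) =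
      orb Γ (subface U D x {k, l})) ↔ (m = k ∧ n = l) ∨ (m = l ∧ n = k) := by
    intro m n
    rw [← subface_pair]
    constructor
    · rintro ⟨-, ho⟩
      have := h.orb_subface_injective ⟨k, by simp⟩ ⟨m, by simp⟩ hJ ho
      have hk : k ∈ ({m, n} : Finset (Fin 6)) := by rw [this]; simp
      have hl : l ∈ ({m, n} : Finset (Fin 6)) := by rw [this]; simp
      simp only [Finset.mem_insert, Finset.mem_singleton] at hk hl
      omega
    · rintro (⟨rfl, rfl⟩ | ⟨rfl, rfl⟩)
      · exact ⟨h.enumerates.1.ne hkl, rfl⟩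
      · exact ⟨h.enumerates.1.ne hkl.symm, by rw [Finset.pair_comm]⟩
  have hite : ∀ m n : Fin 6, (if (m = k ∧ n = l) ∨ (m = l ∧ n = k) then (1 : ℝ) else 0) =
      (if m = k then 1 else 0) * (if n = l then 1 else 0) +
        (if m = l then 1 else 0) * (if n = k then 1 else 0) := by
    intro m n
    by_cases h1 : m = k <;> by_cases h2 : n = l <;> by_cases h3 : m = l <;>
      by_cases h4 : n = k <;> first
      | omega
      | simp [h1, h2, h3, h4, hkl, hkl.symm]
  rw [edgeWeight]
  simp only [hcond, hite, mul_add, Finset.sum_add_distrib]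
  have hsum : ∀ a b : Fin 6, ∑ m, ∑ n, dependency (P.pos ∘ x) m * dependency (P.pos ∘ x) n *
      ((if m = a then 1 else 0) * (if n = b then (1 : ℝ) else 0)) =
      dependency (P.pos ∘ x) a * dependency (P.pos ∘ x) b := by
    intro a b
    rw [Finset.sum_eq_single a, Finset.sum_eq_single b]
    · simp
    · intro n _ hn
      simp [hn]
    · simp
    · intro m _ hm
      simp [hm]
    · simp
  rw [hsum, hsum]
  ring

/-! ### Determinants and changes of rank one -/

/-- Subtracting u_l / u₀ times the last column removes the rank-one term from column l and clears
the last row, leaving a block triangular matrix. -/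
lemma det_border_rank_one {ι : Type*} [Fintype ι] [DecidableEq ι] (A : Matrix ι ι ℝ)
    (w u : ι → ℝ) (c w₀ u₀ : ℝ) (hu₀ : u₀ ≠ 0) :
    (Matrix.fromBlocks (Matrix.of fun k l => A k l + c * w k * u l)
      (Matrix.of fun k (_ : Unit) => c * w k * u₀) (Matrix.of fun (_ : Unit) l => c * w₀ * u l)
      (Matrix.of fun (_ : Unit) (_ : Unit) => c * w₀ * u₀)).det = A.det * (c * w₀ * u₀) := by
  have h : Matrix.fromBlocks (Matrix.of fun k l => A k l + c * w k * u l)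
      (Matrix.of fun k (_ : Unit) => c * w k * u₀) (Matrix.of fun (_ : Unit) l => c * w₀ * u l)
      (Matrix.of fun (_ : Unit) (_ : Unit) => c * w₀ * u₀) =
      Matrix.fromBlocks A (Matrix.of fun k (_ : Unit) => c * w k * u₀) 0
        (Matrix.of fun (_ : Unit) (_ : Unit) => c * w₀ * u₀) *
      Matrix.fromBlocks 1 0 (Matrix.of fun (_ : Unit) l => u l / u₀) 1 := by
    rw [Matrix.fromBlocks_multiply]
    congr 1 <;> ext k l <;> simp [Matrix.mul_apply] <;> field_simp
  rw [h, Matrix.det_mul, Matrix.det_fromBlocks_zero₂₁, Matrix.det_fromBlocks_zero₁₂]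
  simp

/-- The two last columns are both proportional to `w`, one with −u₀ and the other with u₁. Multiples
of such a column clear the rank-one term elsewhere, and the ratio −u₁ / u₀ remains. -/
lemma det_replace_column {ι : Type*} [Fintype ι] [DecidableEq ι] (A : Matrix (ι ⊕ Unit) ι ℝ)
    (w : ι ⊕ Unit → ℝ) (u : ι → ℝ) (c u₀ u₁ : ℝ) (hu₀ : u₀ ≠ 0) :
    (Matrix.of fun k l => Sum.elim (fun l => A k l + c * w k * u l)
      (fun _ : Unit => c * w k * u₁) l : Matrix (ι ⊕ Unit) (ι ⊕ Unit) ℝ).det =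
    (Matrix.of fun k l => Sum.elim (fun l => A k l) (fun _ : Unit => -(c * w k * u₀)) l :
      Matrix (ι ⊕ Unit) (ι ⊕ Unit) ℝ).det * (-u₁ / u₀) := by
  have h : (Matrix.of fun k l => Sum.elim (fun l => A k l + c * w k * u l)
      (fun _ : Unit => c * w k * u₁) l : Matrix (ι ⊕ Unit) (ι ⊕ Unit) ℝ) =
      (Matrix.of fun k l => Sum.elim (fun l => A k l) (fun _ : Unit => -(c * w k * u₀)) l :
        Matrix (ι ⊕ Unit) (ι ⊕ Unit) ℝ) *
      Matrix.fromBlocks 1 0 (Matrix.of fun (_ : Unit) l => -u l / u₀)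
        (Matrix.of fun (_ : Unit) (_ : Unit) => -u₁ / u₀) := by
    ext k l
    rcases l with l | l
    · simp only [Matrix.of_apply, Sum.elim_inl, Matrix.mul_apply, Fintype.sum_sum_type,
        Sum.elim_inr, Matrix.fromBlocks_apply₁₁, Matrix.fromBlocks_apply₂₁, Matrix.one_apply,
        mul_ite, mul_one, mul_zero, Finset.sum_ite_eq', Finset.mem_univ, if_true,
        Finset.univ_unique, Finset.sum_singleton]
      field_simp
    · simp only [Matrix.of_apply, Matrix.mul_apply, Fintype.sum_sum_type,
        Sum.elim_inr, Matrix.fromBlocks_apply₁₂, Matrix.fromBlocks_apply₂₂, Matrix.zero_apply,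
        mul_zero, Finset.sum_const_zero, zero_add, Finset.univ_unique, Finset.sum_singleton]
      field_simp
  rw [h, Matrix.det_mul, Matrix.det_fromBlocks_zero₁₂]
  simp

/-! ### Products over the simplices of the quotient -/

lemma prodVolume_eq (K : Triangulation U) :
    prodVolume P K = ∏ q ∈ (K.orbits 4).toFinset, P.volume U q.out :=
  (Finset.prod_subtype _ (fun _ => Set.mem_toFinset) fun q : Orb Γ C => P.volume U q.out).symm

lemma prodArea_eq (K : Triangulation U) :
    prodArea P K = ∏ q ∈ (K.orbits 2).toFinset, P.area U q.out :=
  (Finset.prod_subtype _ (fun _ => Set.mem_toFinset) fun q : Orb Γ C => P.area U q.out).symm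

lemma prodEdge_eq (K : Triangulation U) :
    prodEdge P K = ∏ q ∈ (K.orbits 1).toFinset, 72 * P.length U q.out ^ 5 :=
  (Finset.prod_subtype _ (fun _ => Set.mem_toFinset)
    fun q : Orb Γ C => 72 * P.length U q.out ^ 5).symm

lemma volume_out {p : C} (hp : (U.verts p).card = 5) :
    P.volume U (orb Γ p).out = P.volume U p := by
  obtain ⟨γ, hγ⟩ := exists_smul_out (Γ := Γ) p
  rw [← hγ, P.volume_smul U γ hp]

lemma area_out {i : C} (hi : (U.verts i).card = 3) : P.area U (orb Γ i).out = P.area U i := by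
  obtain ⟨γ, hγ⟩ := exists_smul_out (Γ := Γ) i
  rw [← hγ, P.area_smul U γ hi]

lemma length_out {a : C} (ha : (U.verts a).card = 2) :
    P.length U (orb Γ a).out = P.length U a := by
  obtain ⟨γ, hγ⟩ := exists_smul_out (Γ := Γ) a
  rw [← hγ, P.length_smul U γ ha]

lemma volume_facet (hx : U.Enumerates D x) (j : Fin 6) :
    P.volume U (orb Γ (subface U D x {j}ᶜ)).out = |dependency (P.pos ∘ x) j| / 24 := by
  have hc : (U.verts (subface U D x {j}ᶜ)).card = 5 := by
    rw [hx.card_subface (compl_singleton_nonempty j), Finset.card_compl]; simp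
  rw [volume_out P hc, P.volume_eq U hc (hx.enumerates_facet j), P.edgeDet_eq,
    ← abs_simplexDet_succAbove]
  rfl

lemma IsMove.prodVolume_eq (h : IsMove K K' D x J) :
    ∃ c : ℝ, prodVolume P K = c * ∏ j ∈ J, (|dependency (P.pos ∘ x) j| / 24) ∧
      prodVolume P K' = c * ∏ j ∈ Jᶜ, (|dependency (P.pos ∘ x) j| / 24) := by
  classical
  refine ⟨∏ q ∈ (K.orbits 4).toFinset ∩ (K'.orbits 4).toFinset, P.volume U q.out, ?_, ?_⟩
  · rw [FourManifold.prodVolume_eq, h.prod_orbits (by norm_num), facets_filter, Finset.prod_image]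
    · simp only [volume_facet P h.enumerates]
    · intro j _ k _ hjk
      simpa using hjk
  · rw [FourManifold.prodVolume_eq, h.symm.prod_orbits (by norm_num), facets_filter,
      Finset.prod_image, Finset.inter_comm]
    · simp only [volume_facet P h.enumerates]
    · intro j _ k _ hjk
      simpa using hjk

lemma IsMove.prodArea_eq (h : IsMove K K' D x J) :
    ∃ c : ℝ, prodArea P K = c * ∏ s ∈ (Finset.univ.powersetCard 3).filter
        (fun s : Finset (Fin 6) => Jᶜ ⊆ s), P.area U (subface U D x s) ∧
      prodArea P K' = c * ∏ s ∈ (Finset.univ.powersetCard 3).filter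
        (fun s : Finset (Fin 6) => J ⊆ s), P.area U (subface U D x s) := by
  classical
  have harea : ∀ s ∈ (Finset.univ.powersetCard 3 : Finset (Finset (Fin 6))),
      P.area U (orb Γ (subface U D x s)).out = P.area U (subface U D x s) := fun s hs => by
    have hs := (Finset.mem_powersetCard.1 hs).2
    exact area_out P (by rw [h.enumerates.card_subface (by rw [← Finset.card_pos, hs]; norm_num),
      hs])
  refine ⟨∏ q ∈ (K.orbits 2).toFinset ∩ (K'.orbits 2).toFinset, P.area U q.out, ?_, ?_⟩
  · rw [FourManifold.prodArea_eq, h.prod_orbits (by norm_num)]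
    exact congrArg _ (Finset.prod_congr rfl fun s hs => harea s (Finset.mem_filter.1 hs).1)
  · rw [FourManifold.prodArea_eq, h.symm.prod_orbits (by norm_num), Finset.inter_comm, compl_compl]
    exact congrArg _ (Finset.prod_congr rfl fun s hs => harea s (Finset.mem_filter.1 hs).1)

lemma IsMove.prodEdge_eq (h : IsMove K K' D x J) :
    ∃ c : ℝ, prodEdge P K = c * ∏ s ∈ (Finset.univ.powersetCard 2).filter
        (fun s : Finset (Fin 6) => Jᶜ ⊆ s), (72 * P.length U (subface U D x s) ^ 5) ∧
      prodEdge P K' = c * ∏ s ∈ (Finset.univ.powersetCard 2).filter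
        (fun s : Finset (Fin 6) => J ⊆ s), (72 * P.length U (subface U D x s) ^ 5) := by
  classical
  have hlen : ∀ s ∈ (Finset.univ.powersetCard 2 : Finset (Finset (Fin 6))),
      72 * P.length U (orb Γ (subface U D x s)).out ^ 5 =
        72 * P.length U (subface U D x s) ^ 5 := fun s hs => by
    have hs := (Finset.mem_powersetCard.1 hs).2
    rw [length_out P (by rw [h.enumerates.card_subface (by rw [← Finset.card_pos, hs]; norm_num),
      hs])]
  refine ⟨∏ q ∈ (K.orbits 1).toFinset ∩ (K'.orbits 1).toFinset, 72 * P.length U q.out ^ 5,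
    ?_, ?_⟩
  · rw [FourManifold.prodEdge_eq, h.prod_orbits (by norm_num)]
    exact congrArg _ (Finset.prod_congr rfl fun s hs => hlen s (Finset.mem_filter.1 hs).1)
  · rw [FourManifold.prodEdge_eq, h.symm.prod_orbits (by norm_num), Finset.inter_comm, compl_compl]
    exact congrArg _ (Finset.prod_congr rfl fun s hs => hlen s (Finset.mem_filter.1 hs).1)

lemma card_verts_out_of_mem {K : Triangulation U} {n : ℕ} {q : Orb Γ C} (hq : q ∈ K.orbits n) :
    (U.verts q.out).card = n + 1 := (K.out_mem_simplices.2 hq).2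

lemma IsMove.area_pos (h : IsMove K K' D x J) (hK : P.Nondegenerate K)
    (hK' : P.Nondegenerate K') {s : Finset (Fin 6)} (hs : s.card = 3) :
    0 < P.area U (subface U D x s) := by
  obtain ⟨π, hπ⟩ := exists_perm_mem_iff hs
  have hs' : s = {π 0, π 1, π 2} := by rw [(filter_perm hπ).2]; simp
  have hy : U.Enumerates (subface U D x s) (x ∘ (π ∘ ![0, 1, 2])) := by
    refine h.enumerates.enumerates_subface (π.injective.comp (by decide)) (by rw [hs']; simp) ?_
    rw [hs']
    ext k
    simp [Fin.exists_fin_succ, eq_comm]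
  rw [P.area_eq U hy]
  have hd : simplexDet (((P.pos ∘ x) ∘ π) ∘ (5 : Fin 6).succAbove) ≠ 0 := by
    intro h0
    have h1 := abs_simplexDet_succAbove ((P.pos ∘ x) ∘ π) 5
    rw [h0, abs_zero, eq_comm, abs_eq_zero, dependency_comp_perm, mul_eq_zero] at h1
    rcases h1 with h1 | h1
    · rcases Int.units_eq_one_or (Equiv.Perm.sign π) with h2 | h2 <;> simp [h2] at h1
    · exact h.dependency_ne_zero P hK hK' _ h1
  have := triangleArea_pos hd
  simp only [Function.comp_apply] at this
  exact this

/-- The minor of `(∂Ω_a / ∂S_i)` when a new edge and a new face are added. -/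
lemma IsMove.minorOmega_border (h : IsMove K K' D x J) (hK : P.Nondegenerate K)
    (hK' : P.Nondegenerate K') (hJc : ∃ k, k ∉ J) {k l : Fin 6} {s : Finset (Fin 6)}
    (hkl : k ≠ l) (hJ : J ⊆ {k, l}) (hs : s.card = 3) (hJs : J ⊆ s)
    {ι : Type*} [Fintype ι] [DecidableEq ι] (a i : ι → Orb Γ C)
    (hi : ∀ m, i m ∈ K.orbits 2) :
    |minorOmega P K' (Sum.elim a fun _ : Unit => orb Γ (subface U D x {k, l}))
      (Sum.elim i fun _ : Unit => orb Γ (subface U D x s))| =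
    |minorOmega P K a i| * (|dependency (P.pos ∘ x) k| * |dependency (P.pos ∘ x) l| *
      (P.area U (subface U D x s) / ∏ k ∈ sᶜ, |dependency (P.pos ∘ x) k|)) := by
  obtain ⟨c, hc, hW⟩ := omegaMatrix_move P h hK hK' hJc
  have hd := h.dependency_ne_zero P hK hK'
  have hs0 : s.Nonempty := by rw [← Finset.card_pos, hs]; norm_num
  have hcs : (U.verts (orb Γ (subface U D x s)).out).card = 3 := by
    rw [U.card_verts_out, h.enumerates.card_subface hs0, hs]
  have hedge : orb Γ (subface U D x {k, l}) ∉ K.orbits 1 := by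
    rw [h.orb_subface_mem (Finset.card_pair hkl) (by norm_num)]
    exact fun hn => hn hJ
  have hface : orb Γ (subface U D x s) ∉ K.orbits 2 := by
    rw [h.orb_subface_mem hs (by norm_num)]
    exact fun hn => hn hJs
  have hA := h.area_pos P hK hK' hs
  have hu0 : faceWeight U P D x (orb Γ (subface U D x s)) ≠ 0 := by
    rw [h.faceWeight_eq P hs (Or.inl hJs)]
    exact div_ne_zero hA.ne' (Finset.prod_ne_zero_iff.2 fun k _ => hd k)
  -- In the matrix of `K` the new edge has a zero row and the new face a zero column, so the border
  -- consists of the rank-one term alone.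
  have hM : (omegaMatrix K' P).submatrix
      (Sum.elim a fun _ : Unit => orb Γ (subface U D x {k, l}))
      (Sum.elim i fun _ : Unit => orb Γ (subface U D x s)) =
      Matrix.fromBlocks (Matrix.of fun m n => (omegaMatrix K P).submatrix a i m n +
          c * edgeWeight U P D x (a m) * faceWeight U P D x (i n))
        (Matrix.of fun m (_ : Unit) => c * edgeWeight U P D x (a m) *
          faceWeight U P D x (orb Γ (subface U D x s)))
        (Matrix.of fun (_ : Unit) n => c * edgeWeight U P D x (orb Γ (subface U D x {k, l})) *
          faceWeight U P D x (i n))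
        (Matrix.of fun (_ : Unit) (_ : Unit) => c *
          edgeWeight U P D x (orb Γ (subface U D x {k, l})) *
          faceWeight U P D x (orb Γ (subface U D x s))) := by
    ext m n
    rcases m with m | m <;> rcases n with n | n
    · simp [hW _ _ (card_verts_out_of_mem (hi n))]
    · simp [hW _ _ hcs, omegaMatrix_eq_zero_of_face P K hface hcs]
    · simp [hW _ _ (card_verts_out_of_mem (hi n)),
        omegaMatrix_eq_zero_of_edge P K hedge (card_verts_out_of_mem (hi n))]
    · simp [hW _ _ hcs, omegaMatrix_eq_zero_of_edge P K hedge hcs]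
  rw [minorOmega, hM, det_border_rank_one _ (fun m => edgeWeight U P D x (a m))
    (fun n => faceWeight U P D x (i n)) _ _ _ hu0, h.faceWeight_eq P hs (Or.inl hJs),
    h.edgeWeight_eq P hkl (Or.inl hJ)]
  simp only [abs_mul, hc, abs_div, Finset.abs_prod, one_mul, abs_of_pos hA]
  rfl

/-- The minor of `(∂Ω_a / ∂S_i)` when a face is replaced. -/
lemma IsMove.minorOmega_replace (h : IsMove K K' D x J) (hK : P.Nondegenerate K)
    (hK' : P.Nondegenerate K') (hJ : J.card = 3)
    {ι : Type*} [Fintype ι] [DecidableEq ι] (a : ι ⊕ Unit → Orb Γ C) (i : ι → Orb Γ C)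
    (hi : ∀ m, i m ∈ K.orbits 2) :
    |minorOmega P K' a (Sum.elim i fun _ : Unit => orb Γ (subface U D x J))| =
    |minorOmega P K a (Sum.elim i fun _ : Unit => orb Γ (subface U D x Jᶜ))| *
      ((P.area U (subface U D x J) / ∏ k ∈ Jᶜ, |dependency (P.pos ∘ x) k|) /
      (P.area U (subface U D x Jᶜ) / ∏ k ∈ J, |dependency (P.pos ∘ x) k|)) := by
  have hJc : Jᶜ.card = 3 := by rw [Finset.card_compl, hJ]; rfl
  obtain ⟨c, hc, hW⟩ := omegaMatrix_move P h hK hK' (by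
    obtain ⟨k, hk⟩ := Finset.card_pos.1 (show 0 < Jᶜ.card by rw [hJc]; norm_num)
    exact ⟨k, Finset.mem_compl.1 hk⟩)
  have hd := h.dependency_ne_zero P hK hK'
  have hcs : ∀ {s : Finset (Fin 6)}, s.card = 3 →
      (U.verts (orb Γ (subface U D x s)).out).card = 3 := fun {s} hs => by
    rw [U.card_verts_out, h.enumerates.card_subface (by rw [← Finset.card_pos, hs]; norm_num), hs]
  have hold : orb Γ (subface U D x Jᶜ) ∉ K'.orbits 2 := by
    rw [h.orb_subface_mem_new hJc (by norm_num)]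
    exact fun hn => hn (Finset.Subset.refl _)
  have hnew : orb Γ (subface U D x J) ∉ K.orbits 2 := by
    rw [h.orb_subface_mem hJ (by norm_num)]
    exact fun hn => hn (Finset.Subset.refl _)
  have hA := h.area_pos P hK hK' hJ
  have hA' := h.area_pos P hK hK' hJc
  have hu0 : faceWeight U P D x (orb Γ (subface U D x Jᶜ)) ≠ 0 := by
    rw [h.faceWeight_eq P hJc (Or.inr (Finset.Subset.refl _))]
    exact div_ne_zero hA'.ne' (Finset.prod_ne_zero_iff.2 fun k _ => hd k)
  have h1 : (omegaMatrix K' P).submatrix a (Sum.elim i fun _ : Unit => orb Γ (subface U D x J)) =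
      (Matrix.of fun m n => Sum.elim (fun n => (omegaMatrix K P).submatrix a i m n +
          c * edgeWeight U P D x (a m) * faceWeight U P D x (i n))
        (fun _ : Unit => c * edgeWeight U P D x (a m) *
          faceWeight U P D x (orb Γ (subface U D x J))) n) := by
    ext m n
    rcases n with n | n
    · simp [hW _ _ (card_verts_out_of_mem (hi n))]
    · simp [hW _ _ (hcs hJ), omegaMatrix_eq_zero_of_face P K hnew (hcs hJ)]
  have h2 : (omegaMatrix K P).submatrix a (Sum.elim i fun _ : Unit => orb Γ (subface U D x Jᶜ)) =
      (Matrix.of fun m n => Sum.elim (fun n => (omegaMatrix K P).submatrix a i m n)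
        (fun _ : Unit => -(c * edgeWeight U P D x (a m) *
          faceWeight U P D x (orb Γ (subface U D x Jᶜ)))) n) := by
    ext m n
    rcases n with n | n
    · simp
    -- The old face has a zero column in the matrix of `K'`, so its column for `K` is minus the
    -- rank-one term.
    · have := hW (a m) _ (hcs hJc)
      rw [omegaMatrix_eq_zero_of_face P K' hold (hcs hJc)] at this
      simp only [Matrix.submatrix_apply, Sum.elim_inr, Matrix.of_apply]
      linarith
  rw [minorOmega, minorOmega, h1, h2, det_replace_column _ (fun m => edgeWeight U P D x (a m))
    (fun n => faceWeight U P D x (i n)) _ _ _ hu0,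
    h.faceWeight_eq P hJ (Or.inl (Finset.Subset.refl _)),
    h.faceWeight_eq P hJc (Or.inr (Finset.Subset.refl _)), compl_compl]
  simp only [abs_mul, abs_div, abs_neg, Finset.abs_prod, abs_of_pos hA, abs_of_pos hA']

end Minors

section AreaVariation

variable {Γ V C : Type*} [Group Γ] [MulAction Γ V] [MulAction Γ C] [PartialOrder C]

/-! ### The variation of the area of a triangle -/

lemma norm_altitude_sq (p q : E4) (hq : ‖q‖ ≠ 0) :
    (‖p - (inner ℝ p q / ‖q‖ ^ 2) • q‖ * ‖q‖) ^ 2 = ‖p‖ ^ 2 * ‖q‖ ^ 2 - inner ℝ p q ^ 2 := by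
  rw [mul_pow, ← real_inner_self_eq_norm_sq (p - _), inner_sub_left, inner_sub_right,
    inner_sub_right, inner_smul_left, inner_smul_right, inner_smul_right, inner_smul_left,
    real_inner_self_eq_norm_sq, real_inner_self_eq_norm_sq, real_inner_comm p q]
  simp only [conj_trivial]
  field_simp
  ring

/-- A deviation orthogonal to the edge pairs with the altitude as it does with B − A, and altitude
times base is twice the area. If the base or the altitude is zero, both sides are zero by the
convention for division, so no nondegeneracy is required. -/
lemma altitude_term (A B D v : E4) (hv : inner ℝ v (D - B) = 0) :
    ‖D - B‖ * inner ℝ (‖(B - A) - (inner ℝ (B - A) (D - B) / ‖D - B‖ ^ 2) • (D - B)‖⁻¹ •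
      ((B - A) - (inner ℝ (B - A) (D - B) / ‖D - B‖ ^ 2) • (D - B))) v =
    ‖D - B‖ ^ 2 * inner ℝ (B - A) v / (2 * triangleArea A B D) := by
  set p := B - A
  set q := D - B
  set h := p - (inner ℝ p q / ‖q‖ ^ 2) • q with hh
  have hqv : inner ℝ q v = 0 := by rw [real_inner_comm]; exact hv
  have hhv : inner ℝ h v = inner ℝ p v := by
    rw [hh, inner_sub_left, inner_smul_left, hqv, mul_zero, sub_zero]
  have harea : 2 * triangleArea A B D = ‖h‖ * ‖q‖ := by
    by_cases hq : q = 0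
    · have hBD : D = B := sub_eq_zero.1 hq
      have := triangleArea_sq A B B
      rw [real_inner_self_eq_norm_sq] at this
      have h0 : triangleArea A B B = 0 := by nlinarith
      rw [hq, norm_zero, mul_zero, hBD, h0, mul_zero]
    · have hq' : ‖q‖ ≠ 0 := norm_ne_zero_iff.2 hq
      have h1 := norm_altitude_sq p q hq'
      have h2 : (2 * triangleArea A B D) ^ 2 = (‖h‖ * ‖q‖) ^ 2 := by
        have e : D - A = p + q := by simp only [p, q]; abel
        rw [hh, h1, triangleArea_sq, e, inner_add_right, real_inner_self_eq_norm_sq,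
          ← real_inner_self_eq_norm_sq (p + q), inner_add_left, inner_add_right, inner_add_right,
          real_inner_self_eq_norm_sq, real_inner_self_eq_norm_sq, real_inner_comm p q]
        ring
      refine (sq_eq_sq₀ ?_ (by positivity)).1 h2
      have : 0 ≤ triangleArea A B D := by
        rw [triangleArea]
        positivity
      positivity
  rw [inner_smul_left, hhv, harea]
  simp only [conj_trivial]
  by_cases hq : ‖q‖ = 0
  · rw [hq]
    simp
  · by_cases hn : ‖h‖ = 0
    · rw [hn]
      simp
    · field_simp

variable {U : SimplicialCells Γ V C} {P : Development Γ V}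

/-- An equivariant family of vectors at the edges, each orthogonal to its edge. -/
structure IsEdgeField (U : SimplicialCells Γ V C) (P : Development Γ V) (v : C → E4) : Prop where
  inner_eq_zero : ∀ a A B, (U.verts a : Set V) = {A, B} → inner ℝ (v a) (P.pos B - P.pos A) = 0
  map_smul : ∀ (γ : Γ) a, v (γ • a) = (P.hol γ).linearIsometryEquiv (v a)

/-- The contribution of the edge `bd` to the variation of the area of the face `abd`, multiplied
by twice the area. -/
def edgeTerm (U : SimplicialCells Γ V C) (P : Development Γ V) (v : C → E4) (c : C)
    (a b d : V) : ℝ :=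
  ‖P.pos d - P.pos b‖ ^ 2 * inner ℝ (P.pos b - P.pos a) (v (U.face c {b, d}))

namespace IsEdgeField

variable {v w : C → E4}

lemma sub (hv : IsEdgeField U P v) (hw : IsEdgeField U P w) :
    IsEdgeField U P (fun a => v a - w a) where
  inner_eq_zero := fun a A B h => by
    rw [inner_sub_left, hv.inner_eq_zero a A B h, hw.inner_eq_zero a A B h, sub_zero]
  map_smul := fun γ a => by rw [hv.map_smul, hw.map_smul, map_sub]

lemma edgeTerm_swap (hv : IsEdgeField U P v) {c : C} {b d : V} (hb : b ∈ U.verts c)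
    (hd : d ∈ U.verts c) (a : V) : edgeTerm U P v c a d b = edgeTerm U P v c a b d := by
  have hs := U.face_spec (c := c) (s := {b, d}) ⟨b, by simp⟩ (Set.pair_subset hb hd)
  have h0 := hv.inner_eq_zero _ _ _ hs.2
  rw [real_inner_comm] at h0
  rw [edgeTerm, edgeTerm, Set.pair_comm, norm_sub_rev,
    show P.pos d - P.pos a = (P.pos d - P.pos b) + (P.pos b - P.pos a) by abel,
    inner_add_left, h0, zero_add]

/-- The three terms are symmetric in the ends of their edges, so any ordering of the vertices may
replace the chosen one. -/
lemma areaVariation_eq (hv : IsEdgeField U P v) {i : C} {y : Fin 3 → V}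
    (hy : U.Enumerates i y) : areaVariation U P v i =
      (edgeTerm U P v i (y 0) (y 1) (y 2) + edgeTerm U P v i (y 1) (y 2) (y 0) +
        edgeTerm U P v i (y 2) (y 0) (y 1)) / (2 * P.area U i) := by
  have hc : (U.verts i).card = 3 := by
    rw [← Set.ncard_coe_finset, ← hy.2, ← Set.image_univ, Set.ncard_image_of_injective _ hy.1]
    simp
  have ht := U.tuple_spec (n := 2) hc
  have hterm : ∀ k : Fin 3, inner ℝ (v (U.face i {U.tuple 2 i (k + 1), U.tuple 2 i (k + 2)}))
      (P.pos (U.tuple 2 i (k + 2)) - P.pos (U.tuple 2 i (k + 1))) = 0 := fun k =>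
    hv.inner_eq_zero _ _ _ (U.face_spec ⟨_, Set.mem_insert _ _⟩
      (Set.pair_subset (ht.mem _) (ht.mem _))).2
  have h1 : areaVariation U P v i = (edgeTerm U P v i (U.tuple 2 i 0) (U.tuple 2 i 1)
      (U.tuple 2 i 2) + edgeTerm U P v i (U.tuple 2 i 1) (U.tuple 2 i 2) (U.tuple 2 i 0) +
        edgeTerm U P v i (U.tuple 2 i 2) (U.tuple 2 i 0) (U.tuple 2 i 1)) / (2 * P.area U i) := by
    simp only [areaVariation]
    rw [Finset.sum_congr rfl fun k _ => altitude_term _ _ _ _ (hterm k), Fin.sum_univ_three,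
      P.area_eq_triangleArea]
    simp only [edgeTerm, zero_add, Fin.isValue, show (1 : Fin 3) + 1 = 2 from rfl,
      show (1 : Fin 3) + 2 = 0 from rfl, show (2 : Fin 3) + 1 = 0 from rfl,
      show (2 : Fin 3) + 2 = 1 from rfl]
    rw [triangleArea_rotate (P.pos (U.tuple 2 i 0)),
      ← triangleArea_rotate (P.pos (U.tuple 2 i 2)) (P.pos (U.tuple 2 i 0))]
    ring
  rw [h1]
  congr 1
  obtain ⟨π, hπ⟩ := hy.exists_perm ht
  have e01 : π 0 ≠ π 1 := π.injective.ne (by decide)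
  have e02 : π 0 ≠ π 2 := π.injective.ne (by decide)
  have e12 : π 1 ≠ π 2 := π.injective.ne (by decide)
  have hsw : ∀ a b d, edgeTerm U P v i (y a) (y b) (y d) = edgeTerm U P v i (y a) (y d) (y b) :=
    fun a b d => hv.edgeTerm_swap (hy.mem d) (hy.mem b) (y a)
  rw [hπ]
  simp only [Function.comp_apply]
  generalize π 0 = a at *
  generalize π 1 = b at *
  generalize π 2 = c at *
  have s0 := hsw 0 1 2
  have s1 := hsw 1 2 0
  have s2 := hsw 2 0 1
  fin_cases a <;> fin_cases b <;> fin_cases c <;> first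
    | exact absurd rfl e01
    | exact absurd rfl e02
    | exact absurd rfl e12
    | (simp only [Fin.zero_eta, Fin.mk_one, Fin.reduceFinMk] <;> linarith)

lemma edgeTerm_smul (hv : IsEdgeField U P v) (γ : Γ) {c : C} {b d : V} (hb : b ∈ U.verts c)
    (hd : d ∈ U.verts c) (a : V) :
    edgeTerm U P v (γ • c) (γ • a) (γ • b) (γ • d) = edgeTerm U P v c a b d := by
  have h : ({γ • b, γ • d} : Set V) = (fun v => γ • v) '' {b, d} := by rw [Set.image_pair]
  rw [edgeTerm, edgeTerm, pos_sub_smul, pos_sub_smul, h,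
    U.face_smul γ ⟨b, by simp⟩ (Set.pair_subset hb hd), hv.map_smul, LinearIsometryEquiv.norm_map,
    LinearIsometryEquiv.inner_map_map]

lemma areaVariation_smul (hv : IsEdgeField U P v) (γ : Γ) {i : C} (hi : (U.verts i).card = 3) :
    areaVariation U P v (γ • i) = areaVariation U P v i := by
  have h := U.tuple_spec (n := 2) hi
  rw [hv.areaVariation_eq h, hv.areaVariation_eq (h.smul γ), P.area_smul U γ hi,
    hv.edgeTerm_smul γ (h.mem _) (h.mem _), hv.edgeTerm_smul γ (h.mem _) (h.mem _),
    hv.edgeTerm_smul γ (h.mem _) (h.mem _)]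

lemma areaVariation_out (hv : IsEdgeField U P v) {i : C} (hi : (U.verts i).card = 3) :
    areaVariation U P v (orb Γ i).out = areaVariation U P v i := by
  obtain ⟨γ, hγ⟩ := exists_smul_out (Γ := Γ) i
  rw [← hγ, hv.areaVariation_smul γ hi]

end IsEdgeField

lemma areaVariation_congr {v w : C → E4} {i : C} (hi : (U.verts i).card = 3)
    (h : ∀ a ≤ i, (U.verts a).card = 2 → v a = w a) :
    areaVariation U P v i = areaVariation U P w i := by
  have ht := U.tuple_spec (n := 2) hi
  simp only [areaVariation]
  refine Finset.sum_congr rfl fun k _ => ?_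
  have hs := U.face_spec (c := i) (s := {U.tuple 2 i (k + 1), U.tuple 2 i (k + 2)})
    ⟨_, Set.mem_insert _ _⟩ (Set.pair_subset (ht.mem _) (ht.mem _))
  rw [h _ hs.1]
  rw [← Set.ncard_coe_finset, hs.2, Set.ncard_pair (ht.1.ne (by clear * -; revert k; decide))]

/-! ### The linear relation between the variations of the areas of the faces of a 5-simplex -/

section FiveSimplex

variable {D : C} {x : Fin 6 → V} {v : C → E4}

/-- The contribution of the edge `q` to the variation of the area of the face `q ∪ {k}`,
multiplied by twice the area. -/
def pairTerm (U : SimplicialCells Γ V C) (P : Development Γ V) (v : C → E4) (D : C)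
    (x : Fin 6 → V) (k : Fin 6) (q : Finset (Fin 6)) : ℝ :=
  P.length U (subface U D x q) ^ 2 *
    inner ℝ ((1 / 2 : ℝ) • ∑ b ∈ q, (P.pos (x b) - P.pos (x k))) (v (subface U D x q))

/-- In `pairTerm` the midpoint of the edge replaces one of its ends, which makes the expression
depend on the unordered pair only. By orthogonality of the deviation to the edge, every point of the
edge gives the same product. -/
lemma IsEdgeField.edgeTerm_eq_pairTerm (hv : IsEdgeField U P v) (hx : U.Enumerates D x)
    {c : C} (hc : c ≤ D) {k b d : Fin 6} (hbd : b ≠ d) (hb : x b ∈ U.verts c)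
    (hd : x d ∈ U.verts c) :
    edgeTerm U P v c (x k) (x b) (x d) = pairTerm U P v D x k {b, d} := by
  have hs := hx.subface_spec (s := {b, d}) ⟨b, by simp⟩
  rw [Finset.coe_pair, Set.image_pair] at hs
  have h0 := hv.inner_eq_zero _ _ _ hs.2
  rw [real_inner_comm, inner_sub_left] at h0
  rw [pairTerm, P.length_eq U (hx.1.ne hbd) hs.2, dist_eq_norm, Finset.sum_pair hbd,
    inner_smul_left, inner_add_left, edgeTerm, ← U.face_of_le hc ⟨_, Set.mem_insert _ _⟩
      (Set.pair_subset hb hd), ← subface_pair, norm_sub_rev]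
  simp only [inner_sub_left, conj_trivial]
  rw [sub_eq_zero] at h0
  rw [h0]
  ring

lemma IsEdgeField.area_mul_areaVariation (hv : IsEdgeField U P v) (hx : U.Enumerates D x)
    {s : Finset (Fin 6)} (hs : s.card = 3) (ha : P.area U (subface U D x s) ≠ 0) :
    P.area U (subface U D x s) * areaVariation U P v (subface U D x s) =
      (∑ k ∈ s, pairTerm U P v D x k (s.erase k)) / 2 := by
  obtain ⟨k, l, m, hkl, hkm, hlm, rfl⟩ := Finset.card_eq_three.1 hs
  have hne : ({k, l, m} : Finset (Fin 6)).Nonempty := ⟨k, by simp⟩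
  have hinj : Function.Injective ![k, l, m] := by
    intro a b hab
    fin_cases a <;> fin_cases b <;> first
      | rfl
      | exact absurd hab hkl
      | exact absurd hab hkm
      | exact absurd hab hlm
      | exact absurd hab.symm hkl
      | exact absurd hab.symm hkm
      | exact absurd hab.symm hlm
  have hy := hx.enumerates_subface hinj hne (by
    ext a
    simp only [Set.mem_range, Fin.exists_fin_succ, Finset.coe_insert, Finset.coe_singleton,
      Set.mem_insert_iff, Set.mem_singleton_iff]
    simp [eq_comm])
  have hD := (hx.subface_spec hne).1
  have hm : ∀ a : Fin 3, x (![k, l, m] a) ∈ U.verts (subface U D x {k, l, m}) := fun a => hy.mem a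
  have h1 := hv.areaVariation_eq hy
  simp only [Function.comp_apply] at h1
  rw [hv.edgeTerm_eq_pairTerm hx hD (hinj.ne (by decide)) (hm _) (hm _),
    hv.edgeTerm_eq_pairTerm hx hD (hinj.ne (by decide)) (hm _) (hm _),
    hv.edgeTerm_eq_pairTerm hx hD (hinj.ne (by decide)) (hm _) (hm _)] at h1
  simp only [Matrix.cons_val_zero, Matrix.cons_val_one, Matrix.cons_val] at h1
  have e1 : ({k, l, m} : Finset (Fin 6)).erase k = {l, m} := by
    ext a; simp only [Finset.mem_erase, Finset.mem_insert, Finset.mem_singleton]; omega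
  have e2 : ({k, l, m} : Finset (Fin 6)).erase l = {m, k} := by
    ext a; simp only [Finset.mem_erase, Finset.mem_insert, Finset.mem_singleton]; omega
  have e3 : ({k, l, m} : Finset (Fin 6)).erase m = {k, l} := by
    ext a; simp only [Finset.mem_erase, Finset.mem_insert, Finset.mem_singleton]; omega
  rw [h1, Finset.sum_insert (by simp [hkl, hkm]), Finset.sum_pair hlm, e1, e2, e3]
  field_simp
  ring

/-- The deviation is paired with ∑ δ_k (z − r_k) = 0 for z at either end of the edge. The two
indices belonging to the edge itself give zero by orthogonality. -/
lemma IsEdgeField.sum_pairTerm (hv : IsEdgeField U P v) (hx : U.Enumerates D x)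
    {q : Finset (Fin 6)} (hq : q.card = 2) :
    ∑ k ∈ qᶜ, dependency (P.pos ∘ x) k * pairTerm U P v D x k q = 0 := by
  obtain ⟨b, d, hbd, rfl⟩ := Finset.card_eq_two.1 hq
  have hs := hx.subface_spec (s := {b, d}) ⟨b, by simp⟩
  rw [Finset.coe_pair, Set.image_pair] at hs
  have h0 := hv.inner_eq_zero _ _ _ hs.2
  rw [real_inner_comm, inner_sub_left] at h0
  have hin : ∀ k ∈ ({b, d} : Finset (Fin 6)), pairTerm U P v D x k {b, d} = 0 := by
    intro k hk
    rw [pairTerm, Finset.sum_pair hbd, inner_smul_left, inner_add_left]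
    simp only [inner_sub_left]
    simp only [Finset.mem_insert, Finset.mem_singleton] at hk
    rcases hk with rfl | rfl
    · rw [h0]; simp
    · rw [← neg_sub, h0]; simp
  have hall : ∑ k, dependency (P.pos ∘ x) k * pairTerm U P v D x k {b, d} = 0 := by
    have h1 : ∀ z : E4, ∑ k, dependency (P.pos ∘ x) k * inner ℝ (z - P.pos (x k))
        (v (subface U D x {b, d})) = 0 := by
      intro z
      have := congrArg (fun t => inner ℝ t (v (subface U D x {b, d})))
        (sum_dependency_smul_sub (P.pos ∘ x) z)
      simp only [sum_inner, inner_smul_left, inner_zero_left, conj_trivial] at this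
      rw [← neg_eq_zero, ← Finset.sum_neg_distrib, ← this]
      refine Finset.sum_congr rfl fun k _ => ?_
      rw [← mul_neg, ← inner_neg_left, neg_sub]
      rfl
    simp only [pairTerm, Finset.sum_pair hbd, inner_smul_left, inner_add_left, conj_trivial]
    have hb := h1 (P.pos (x b))
    have hd := h1 (P.pos (x d))
    have : ∀ k, dependency (P.pos ∘ x) k * (P.length U (subface U D x {b, d}) ^ 2 *
        (1 / 2 * (inner ℝ (P.pos (x b) - P.pos (x k)) (v (subface U D x {b, d})) +
          inner ℝ (P.pos (x d) - P.pos (x k)) (v (subface U D x {b, d}))))) =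
        (P.length U (subface U D x {b, d}) ^ 2 / 2) * (dependency (P.pos ∘ x) k *
          inner ℝ (P.pos (x b) - P.pos (x k)) (v (subface U D x {b, d})) +
          dependency (P.pos ∘ x) k *
          inner ℝ (P.pos (x d) - P.pos (x k)) (v (subface U D x {b, d}))) := fun k => by ring
    rw [Finset.sum_congr rfl fun k _ => this k, ← Finset.mul_sum, Finset.sum_add_distrib, hb, hd]
    simp
  rw [← Finset.sum_add_sum_compl {b, d}, Finset.sum_eq_zero fun k hk => by rw [hin k hk, mul_zero],
    zero_add] at hall
  exact hall

/-- After multiplication by the product of all δ_k, the weight of a triangle becomes the product of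
δ over its own vertices. Summing over pairs of a triangle and an edge in it, with the edge fixed and
the third vertex varying, leaves for each edge the relation `sum_pairTerm`. -/
lemma IsEdgeField.sum_areaVariation (hv : IsEdgeField U P v) (hx : U.Enumerates D x)
    (hδ : ∀ k, dependency (P.pos ∘ x) k ≠ 0)
    (ha : ∀ s : Finset (Fin 6), s.card = 3 → P.area U (subface U D x s) ≠ 0) :
    ∑ s ∈ Finset.univ.powersetCard 3,
      P.area U (subface U D x s) / (∏ k ∈ sᶜ, dependency (P.pos ∘ x) k) *
        areaVariation U P v (subface U D x s) = 0 := by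
  set δ := dependency (P.pos ∘ x)
  have hterm : ∀ s ∈ (Finset.univ.powersetCard 3 : Finset (Finset (Fin 6))),
      P.area U (subface U D x s) / (∏ k ∈ sᶜ, δ k) * areaVariation U P v (subface U D x s) =
        (∑ k ∈ s, (∏ l ∈ s, δ l) * pairTerm U P v D x k (s.erase k)) / (2 * ∏ k, δ k) := by
    intro s hs
    have hs := (Finset.mem_powersetCard.1 hs).2
    have h1 := hv.area_mul_areaVariation hx hs (ha s hs)
    have hp : ∏ k ∈ s, δ k ≠ 0 := Finset.prod_ne_zero_iff.2 fun k _ => hδ k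
    have hp' : ∏ k ∈ sᶜ, δ k ≠ 0 := Finset.prod_ne_zero_iff.2 fun k _ => hδ k
    rw [div_mul_eq_mul_div, h1, ← Finset.mul_sum, ← Finset.prod_mul_prod_compl s]
    field_simp
  rw [Finset.sum_congr rfl hterm, ← Finset.sum_div, Finset.sum_sigma']
  -- A triangle with a marked vertex is the same as an edge with a vertex outside it.
  have hbij : ∑ z ∈ (Finset.univ.powersetCard 3 : Finset (Finset (Fin 6))).sigma fun s => s,
        (∏ l ∈ z.1, δ l) * pairTerm U P v D x z.2 (z.1.erase z.2) =
      ∑ z ∈ (Finset.univ.powersetCard 2 : Finset (Finset (Fin 6))).sigma fun q => qᶜ,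
        (∏ l ∈ z.1, δ l) * (δ z.2 * pairTerm U P v D x z.2 z.1) := by
    refine Finset.sum_bij' (fun z _ => ⟨z.1.erase z.2, z.2⟩) (fun z _ => ⟨insert z.2 z.1, z.2⟩)
      ?_ ?_ ?_ ?_ ?_
    · rintro ⟨s, k⟩ h
      simp only [Finset.mem_sigma, Finset.mem_powersetCard, Finset.subset_univ, true_and,
        Finset.mem_compl, Finset.mem_erase, ne_eq, not_true_eq_false, false_and,
        not_false_eq_true, and_true] at h ⊢
      rw [Finset.card_erase_of_mem h.2, h.1]
    · rintro ⟨q, k⟩ h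
      simp only [Finset.mem_sigma, Finset.mem_powersetCard, Finset.subset_univ, true_and,
        Finset.mem_compl, Finset.mem_insert, true_or, and_true] at h ⊢
      rw [Finset.card_insert_of_notMem h.2, h.1]
    · rintro ⟨s, k⟩ h
      simp only [Finset.mem_sigma] at h
      simp [Finset.insert_erase h.2]
    · rintro ⟨q, k⟩ h
      simp only [Finset.mem_sigma, Finset.mem_compl] at h
      simp [Finset.erase_insert h.2]
    · rintro ⟨s, k⟩ h
      simp only [Finset.mem_sigma] at h
      simp only
      rw [← Finset.mul_prod_erase _ _ h.2]
      ring
  rw [hbij, Finset.sum_sigma]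
  have : ∀ q ∈ (Finset.univ.powersetCard 2 : Finset (Finset (Fin 6))),
      ∑ k ∈ qᶜ, (∏ l ∈ q, δ l) * (δ k * pairTerm U P v D x k q) = 0 := by
    intro q hq
    rw [← Finset.mul_sum, hv.sum_pairTerm hx (Finset.mem_powersetCard.1 hq).2, mul_zero]
  rw [Finset.sum_eq_zero this, zero_div]

lemma IsEdgeField.sum_faceWeight (hv : IsEdgeField U P v) (hx : U.Enumerates D x)
    (hδ : ∀ k, dependency (P.pos ∘ x) k ≠ 0)
    (ha : ∀ s : Finset (Fin 6), s.card = 3 → P.area U (subface U D x s) ≠ 0)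
    {T : Finset (Orb Γ C)}
    (hT : ∀ s : Finset (Fin 6), s.card = 3 → orb Γ (subface U D x s) ∈ T) :
    ∑ i ∈ T, faceWeight U P D x i * areaVariation U P v i.out = 0 := by
  classical
  rw [← hv.sum_areaVariation hx hδ ha]
  simp only [faceWeight, Finset.sum_mul, ite_mul, zero_mul]
  rw [Finset.sum_comm]
  refine Finset.sum_congr rfl fun s hs => ?_
  have hs := (Finset.mem_powersetCard.1 hs).2
  have hc : (U.verts (subface U D x s)).card = 3 := by
    rw [hx.card_subface (by rw [← Finset.card_pos, hs]; norm_num), hs]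
  rw [Finset.sum_ite_eq, if_pos (hT s hs), hv.areaVariation_out hc]

end FiveSimplex

end AreaVariation

section Maps

variable {Γ V C : Type*} [Group Γ] [MulAction Γ V] [MulAction Γ C] [PartialOrder C]
  {U : SimplicialCells Γ V C} {K K' : Triangulation U} {P : Development Γ V}

/-! ### Edge fields -/

lemma IsEdgeField.of_mem {v : C → E4} (hv : v ∈ edgeDeviations K P) : IsEdgeField U P v where
  inner_eq_zero := fun a A B hAB => by
    by_cases ha : a ∈ K.simplices 1
    · have h := hv.2.1 a ha
      rcases U.tuple_one_pair ha.2 hAB with ⟨h0, h1⟩ | ⟨h0, h1⟩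
      · rwa [h0, h1] at h
      · rw [h0, h1] at h
        rw [← neg_sub, inner_neg_right, h, neg_zero]
    · rw [hv.1 a ha, inner_zero_left]
  map_smul := hv.2.2

open Classical in
lemma IsEdgeField.of_frame {u : C → Fin 3 → E4} (hu : IsFrame U P u) {e : C}
    (he : (U.verts e).card = 2) (k : Fin 3) :
    IsEdgeField U P fun a => if orb Γ a = orb Γ e then u a k else 0 where
  inner_eq_zero := fun a A B hAB => by
    split_ifs with ha
    · obtain ⟨γ, rfl⟩ := orb_eq_orb.1 ha
      have hc : (U.verts (γ • e)).card = 2 := by rw [U.card_verts_smul, he]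
      have h := (hu.1 _ hc).2 k
      rcases U.tuple_one_pair hc hAB with ⟨h0, h1⟩ | ⟨h0, h1⟩
      · rwa [h0, h1] at h
      · rw [h0, h1] at h
        rw [← neg_sub, inner_neg_right, h, neg_zero]
    · rw [inner_zero_left]
  map_smul := fun γ a => by
    rw [orb_smul]
    split_ifs
    · exact hu.2 γ a k
    · rw [map_zero]

lemma IsEdgeField.add {v w : C → E4} (hv : IsEdgeField U P v) (hw : IsEdgeField U P w) :
    IsEdgeField U P (fun a => v a + w a) where
  inner_eq_zero := fun a A B h => by
    rw [inner_add_left, hv.inner_eq_zero a A B h, hw.inner_eq_zero a A B h, add_zero]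
  map_smul := fun γ a => by rw [hv.map_smul, hw.map_smul, map_add]

lemma IsEdgeField.smul {v : C → E4} (hv : IsEdgeField U P v) (c : ℝ) :
    IsEdgeField U P (fun a => c • v a) where
  inner_eq_zero := fun a A B h => by rw [inner_smul_left, hv.inner_eq_zero a A B h, mul_zero]
  map_smul := fun γ a => by rw [hv.map_smul, _root_.map_smul]

open Classical in
lemma IsEdgeField.restrict_mem {v : C → E4} (hv : IsEdgeField U P v) (K : Triangulation U) :
    (fun a => if a ∈ K.simplices 1 then v a else 0) ∈ edgeDeviations K P := by
  refine ⟨fun a ha => if_neg ha, fun a ha => ?_, fun γ a => ?_⟩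
  · have h := U.tuple_spec (n := 1) ha.2
    simp only [if_pos ha]
    refine hv.inner_eq_zero _ _ _ ?_
    rw [← h.2]
    ext v
    simp [Fin.exists_fin_succ, eq_comm]
  · simp only [K.smul_mem_simplices]
    split_ifs
    · exact hv.map_smul γ a
    · rw [map_zero]

lemma edge_mem_simplices {i a : C} (hi : i ∈ K.simplices 2) (ha : a ≤ i)
    (hc : (U.verts a).card = 2) : a ∈ K.simplices 1 := ⟨K.lower _ _ ha hi.1, hc⟩

lemma areaVariation_congr_of_mem {v w : C → E4} (h : ∀ a ∈ K.simplices 1, v a = w a)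
    {i : Orb Γ C} (hi : i ∈ K.orbits 2) :
    areaVariation U P v i.out = areaVariation U P w i.out :=
  areaVariation_congr (K.out_mem_simplices.2 hi).2 fun _ ha hc =>
    h _ (edge_mem_simplices (K.out_mem_simplices.2 hi) ha hc)

lemma areaVariation_add (v w : C → E4) (i : C) : areaVariation U P (fun a => v a + w a) i =
    areaVariation U P v i + areaVariation U P w i := by
  simp only [areaVariation, inner_add_right, mul_add, Finset.sum_add_distrib]

lemma areaVariation_smul (c : ℝ) (v : C → E4) (i : C) :
    areaVariation U P (fun a => c • v a) i = c * areaVariation U P v i := by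
  simp only [areaVariation, inner_smul_right, Finset.mul_sum]
  exact Finset.sum_congr rfl fun _ _ => by ring

lemma areaVariation_sub (v w : C → E4) (i : C) : areaVariation U P (fun a => v a - w a) i =
    areaVariation U P v i - areaVariation U P w i := by
  simp only [areaVariation, inner_sub_right, mul_sub, Finset.sum_sub_distrib]

/-! ### From vertex deviations to variations of areas -/

open Classical in
/-- The edge deviations due to a family of tensors at the vertices. -/
def edgeField (U : SimplicialCells Γ V C) (P : Development Γ V)
    (σ : V → Matrix (Fin 4) (Fin 4) ℝ) (a : C) : E4 :=
  if (U.verts a).card = 2 then edgeDeviation P σ (U.tuple 1 a 0) (U.tuple 1 a 1) else 0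

lemma edgeField_eq (σ : V → Matrix (Fin 4) (Fin 4) ℝ) {a : C} {A B : V} (hAB : A ≠ B)
    (ha : (U.verts a : Set V) = {A, B}) : edgeField U P σ a = edgeDeviation P σ A B := by
  have hc : (U.verts a).card = 2 := by rw [← Set.ncard_coe_finset, ha, Set.ncard_pair hAB]
  rw [edgeField, if_pos hc]
  rcases U.tuple_one_pair hc ha with ⟨h0, h1⟩ | ⟨h0, h1⟩
  · rw [h0, h1]
  · rw [h0, h1, edgeDeviation_symm]

lemma coe_verts_tuple {a : C} (ha : (U.verts a).card = 2) :
    (U.verts a : Set V) = {U.tuple 1 a 0, U.tuple 1 a 1} := by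
  rw [← (U.tuple_spec (n := 1) ha).2]
  ext v
  simp [Fin.exists_fin_succ, eq_comm]

lemma IsEdgeField.of_vertexDeviation {σ : V → Matrix (Fin 4) (Fin 4) ℝ}
    (hσ : σ ∈ vertexDeviations K P) : IsEdgeField U P (edgeField U P σ) where
  inner_eq_zero := fun a A B hAB => by
    by_cases h : A = B
    · rw [h, sub_self, inner_zero_right]
    · rw [edgeField_eq σ h hAB]
      exact inner_edgeDeviation P σ A B (hσ.2.1 _) (hσ.2.1 _)
  map_smul := fun γ a => by
    by_cases hc : (U.verts a).card = 2
    · have hne : U.tuple 1 a 0 ≠ U.tuple 1 a 1 := (U.tuple_spec (n := 1) hc).1.ne (by decide)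
      rw [edgeField_eq σ hne (coe_verts_tuple hc), edgeField_eq σ ((MulAction.injective γ).ne hne)
        (by rw [U.verts_smul, coe_verts_tuple hc, Set.image_pair])]
      exact edgeDeviation_smul P σ γ _ _ (hσ.2.2 _ _) (hσ.2.2 _ _)
    · rw [edgeField, edgeField, if_neg hc, if_neg (by rwa [U.card_verts_smul]), map_zero]

lemma norm_sq_mul_inner_edgeDeviation (σ : V → Matrix (Fin 4) (Fin 4) ℝ) (A B : V) (p : E4) :
    ‖P.pos B - P.pos A‖ ^ 2 * inner ℝ p (edgeDeviation P σ A B) =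
      (WithLp.ofLp (P.pos B - P.pos A) ᵥ* (σ A - σ B)) ⬝ᵥ WithLp.ofLp p := by
  rw [edgeDeviation, inner_smul_right]
  by_cases h : ‖P.pos B - P.pos A‖ = 0
  · rw [norm_eq_zero.1 h]
    simp
  · rw [← mul_assoc, mul_inv_cancel₀ (pow_ne_zero 2 h), one_mul]
    rw [PiLp.inner_apply, dotProduct]
    rfl

lemma vecMul_dotProduct_antisymm {σ : Matrix (Fin 4) (Fin 4) ℝ} (hσ : σ ∈ bivectors)
    (p q : Fin 4 → ℝ) : (p ᵥ* σ) ⬝ᵥ q = -((q ᵥ* σ) ⬝ᵥ p) := by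
  have hσ : σᵀ = -σ := hσ
  rw [← Matrix.dotProduct_mulVec, ← Matrix.vecMul_transpose, hσ, Matrix.vecMul_neg,
    dotProduct_neg, dotProduct_comm]

/-- The factor l² of `edgeTerm` cancels the denominator of the edge deviation. The tensor at each
vertex then enters through the two edges meeting there, and antisymmetry cancels the two
contributions. -/
lemma areaVariation_edgeField {σ : V → Matrix (Fin 4) (Fin 4) ℝ}
    (hσ : σ ∈ vertexDeviations K P) {i : C} (hi : (U.verts i).card = 3) :
    areaVariation U P (edgeField U P σ) i = 0 := by
  have ht := U.tuple_spec (n := 2) hi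
  have hterm : ∀ {k l : Fin 3} (p : E4), k ≠ l → ‖P.pos (U.tuple 2 i l) - P.pos (U.tuple 2 i k)‖ ^ 2
      * inner ℝ p (edgeField U P σ (U.face i {U.tuple 2 i k, U.tuple 2 i l})) =
      (WithLp.ofLp (P.pos (U.tuple 2 i l) - P.pos (U.tuple 2 i k)) ᵥ*
        (σ (U.tuple 2 i k) - σ (U.tuple 2 i l))) ⬝ᵥ WithLp.ofLp p := by
    intro k l p hkl
    have hs := U.face_spec (c := i) (s := {U.tuple 2 i k, U.tuple 2 i l})
      ⟨_, Set.mem_insert _ _⟩ (Set.pair_subset (ht.mem _) (ht.mem _))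
    rw [edgeField_eq σ (ht.1.ne hkl) hs.2, norm_sq_mul_inner_edgeDeviation]
  rw [(IsEdgeField.of_vertexDeviation hσ).areaVariation_eq ht]
  simp only [edgeTerm]
  rw [hterm _ (by decide), hterm _ (by decide), hterm _ (by decide)]
  generalize hA : U.tuple 2 i 0 = A
  generalize hB : U.tuple 2 i 1 = B
  generalize hD : U.tuple 2 i 2 = D
  have key : ∀ X, ∀ p q : Fin 4 → ℝ, (p ᵥ* σ X) ⬝ᵥ q = -((q ᵥ* σ X) ⬝ᵥ p) := fun X =>
    vecMul_dotProduct_antisymm (hσ.2.1 X)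
  rw [div_eq_zero_iff]
  left
  simp only [WithLp.ofLp_sub, Matrix.vecMul_sub, Matrix.sub_vecMul, sub_dotProduct,
    dotProduct_sub]
  have hAA := key A (P.pos A).ofLp (P.pos A).ofLp
  have hAB := key A (P.pos A).ofLp (P.pos B).ofLp
  have hAD := key A (P.pos A).ofLp (P.pos D).ofLp
  have hBB := key A (P.pos B).ofLp (P.pos B).ofLp
  have hBD := key A (P.pos B).ofLp (P.pos D).ofLp
  have hDD := key A (P.pos D).ofLp (P.pos D).ofLp
  have hAA' := key B (P.pos A).ofLp (P.pos A).ofLp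
  have hAB' := key B (P.pos A).ofLp (P.pos B).ofLp
  have hAD' := key B (P.pos A).ofLp (P.pos D).ofLp
  have hBB' := key B (P.pos B).ofLp (P.pos B).ofLp
  have hBD' := key B (P.pos B).ofLp (P.pos D).ofLp
  have hDD' := key B (P.pos D).ofLp (P.pos D).ofLp
  have hAA'' := key D (P.pos A).ofLp (P.pos A).ofLp
  have hAB'' := key D (P.pos A).ofLp (P.pos B).ofLp
  have hAD'' := key D (P.pos A).ofLp (P.pos D).ofLp
  have hBB'' := key D (P.pos B).ofLp (P.pos B).ofLp
  have hBD'' := key D (P.pos B).ofLp (P.pos D).ofLp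
  have hDD'' := key D (P.pos D).ofLp (P.pos D).ofLp
  linarith

/-! ### The variation of squared lengths -/

/-- The variation of the squared length of the edge `a` due to displacements of the vertices. -/
def lengthVariation (U : SimplicialCells Γ V C) (P : Development Γ V)
    (y : (V → E4) × (Γ → MotionAlgebra)) (a : C) : ℝ :=
  2 * inner ℝ (P.pos (U.tuple 1 a 1) - P.pos (U.tuple 1 a 0))
    (y.1 (U.tuple 1 a 1) - y.1 (U.tuple 1 a 0))

lemma lengthVariation_eq (y : (V → E4) × (Γ → MotionAlgebra)) {a : C} {A B : V} (hAB : A ≠ B)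
    (ha : (U.verts a : Set V) = {A, B}) :
    lengthVariation U P y a = 2 * inner ℝ (P.pos B - P.pos A) (y.1 B - y.1 A) := by
  have hc : (U.verts a).card = 2 := by rw [← Set.ncard_coe_finset, ha, Set.ncard_pair hAB]
  rw [lengthVariation]
  rcases U.tuple_one_pair hc ha with ⟨h0, h1⟩ | ⟨h0, h1⟩
  · rw [h0, h1]
  · rw [h0, h1, ← neg_sub (P.pos B), ← neg_sub (y.1 B), inner_neg_neg]

/-- Infinitesimal motions preserve distances: ⟨r, τ r⟩ = 0 for antisymmetric τ. -/
lemma inner_velocity_sub (X : MotionAlgebra) (p q : E4) :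
    inner ℝ (p - q) (velocity X p - velocity X q) = 0 := by
  have h : velocity X p - velocity X q =
      WithLp.toLp 2 ((X.1 : Matrix (Fin 4) (Fin 4) ℝ) *ᵥ WithLp.ofLp (p - q)) := by
    rw [velocity, velocity, WithLp.ofLp_sub, Matrix.mulVec_sub, WithLp.toLp_sub]
    abel
  have e : ∀ r : E4, inner ℝ r (WithLp.toLp 2 ((X.1 : Matrix (Fin 4) (Fin 4) ℝ) *ᵥ
      WithLp.ofLp r) : E4) = (WithLp.ofLp r ᵥ* (X.1 : Matrix (Fin 4) (Fin 4) ℝ)) ⬝ᵥ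
      WithLp.ofLp r := by
    intro r
    rw [← Matrix.dotProduct_mulVec, dotProduct_comm, PiLp.inner_apply, dotProduct]
    rfl
  rw [h, e]
  have := vecMul_dotProduct_antisymm X.1.2 (WithLp.ofLp (p - q)) (WithLp.ofLp (p - q))
  linarith

/-- Displacements are equivariant only up to the infinitesimal motion `y.2 γ`, which does not change
lengths. -/
lemma lengthVariation_smul {dg : Submodule ℝ (Γ → MotionAlgebra)}
    {y : (V → E4) × (Γ → MotionAlgebra)} (hy : y ∈ displacements K P dg) (γ : Γ) {a : C}
    (hc : (U.verts a).card = 2) (ha : ∀ v ∈ U.verts a, v ∈ K.vertices) :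
    lengthVariation U P y (γ • a) = lengthVariation U P y a := by
  have ht := U.tuple_spec (n := 1) hc
  have hne : U.tuple 1 a 0 ≠ U.tuple 1 a 1 := ht.1.ne (by decide)
  rw [lengthVariation_eq y ((MulAction.injective γ).ne hne)
    (by rw [U.verts_smul, coe_verts_tuple hc, Set.image_pair]),
    hy.2.2 _ (ha _ (ht.mem _)), hy.2.2 _ (ha _ (ht.mem _)), add_sub_add_comm, inner_add_right,
    inner_velocity_sub, zero_add, pos_sub_smul, ← map_sub, LinearIsometryEquiv.inner_map_map]
  rfl

lemma lengthVariation_out {dg : Submodule ℝ (Γ → MotionAlgebra)}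
    {y : (V → E4) × (Γ → MotionAlgebra)} (hy : y ∈ displacements K P dg) {a : C}
    (hc : (U.verts a).card = 2) (ha : ∀ v ∈ U.verts a, v ∈ K.vertices) :
    lengthVariation U P y (orb Γ a).out = lengthVariation U P y a := by
  obtain ⟨γ, hγ⟩ := exists_smul_out (Γ := Γ) a
  rw [← hγ, lengthVariation_smul hy γ hc ha]

/-- After expanding y_l − y_k, in each part one of the two summations is ∑ δ_l (r_l − z) = 0. This
is the first variation of the vanishing Cayley–Menger determinant of the six points. -/
lemma sum_dependency_mul_inner (r y : Fin 6 → E4) : ∑ k, ∑ l, dependency r k * dependency r l *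
    inner ℝ (r l - r k) (y l - y k) = 0 := by
  have h0 : ∀ z t : E4, ∑ l, dependency r l * inner ℝ (r l - z) t = 0 := by
    intro z t
    have := congrArg (fun s => inner ℝ s t) (sum_dependency_smul_sub r z)
    simpa only [sum_inner, inner_smul_left, inner_zero_left, conj_trivial] using this
  have h1 : ∀ k, ∑ l, dependency r k * dependency r l * inner ℝ (r l - r k) (y l - y k) =
      ∑ l, dependency r k * dependency r l * inner ℝ (r l - r k) (y l) := by
    intro k
    have e : ∀ l, dependency r k * dependency r l * inner ℝ (r l - r k) (y l - y k) =
        dependency r k * dependency r l * inner ℝ (r l - r k) (y l) -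
          dependency r k * (dependency r l * inner ℝ (r l - r k) (y k)) := fun l => by
      rw [inner_sub_right]; ring
    rw [Finset.sum_congr rfl fun l _ => e l, Finset.sum_sub_distrib, ← Finset.mul_sum, h0,
      mul_zero, sub_zero]
  rw [Finset.sum_congr rfl fun k _ => h1 k, Finset.sum_comm]
  refine Finset.sum_eq_zero fun l _ => ?_
  have e : ∀ k, dependency r k * dependency r l * inner ℝ (r l - r k) (y l) =
      -dependency r l * (dependency r k * inner ℝ (r k - r l) (y l)) := fun k => by
    rw [← neg_sub (r k), inner_neg_left]; ring
  rw [Finset.sum_congr rfl fun k _ => e k, ← Finset.mul_sum, h0, mul_zero]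

lemma sum_edgeWeight {dg : Submodule ℝ (Γ → MotionAlgebra)}
    {y : (V → E4) × (Γ → MotionAlgebra)} (hy : y ∈ displacements K P dg) {D : C} {x : Fin 6 → V}
    (hx : U.Enumerates D x) (hxK : ∀ k, x k ∈ K.vertices) {T : Finset (Orb Γ C)}
    (hT : ∀ k l : Fin 6, k ≠ l → orb Γ (U.face D {x k, x l}) ∈ T) :
    ∑ a ∈ T, edgeWeight U P D x a * lengthVariation U P y a.out = 0 := by
  classical
  have hkl : ∀ k l : Fin 6, ∑ a ∈ T, (if x k ≠ x l ∧ orb Γ (U.face D {x k, x l}) = a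
      then (1 : ℝ) else 0) * lengthVariation U P y a.out =
      2 * inner ℝ (P.pos (x l) - P.pos (x k)) (y.1 (x l) - y.1 (x k)) := by
    intro k l
    by_cases h : k = l
    · simp [h]
    · have hne := hx.1.ne h
      have hs := U.face_spec (c := D) (s := {x k, x l}) ⟨_, Set.mem_insert _ _⟩
        (Set.pair_subset (hx.mem _) (hx.mem _))
      have hc : (U.verts (U.face D {x k, x l})).card = 2 := by
        rw [← Set.ncard_coe_finset, hs.2, Set.ncard_pair hne]
      have hv : ∀ v ∈ U.verts (U.face D {x k, x l}), v ∈ K.vertices := by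
        intro v hv
        have hv : v ∈ (U.verts (U.face D {x k, x l}) : Set V) := hv
        rw [hs.2] at hv
        rcases hv with rfl | rfl
        · exact hxK k
        · exact hxK l
      rw [Finset.sum_eq_single (orb Γ (U.face D {x k, x l}))]
      · rw [if_pos ⟨hne, rfl⟩, one_mul, lengthVariation_out hy hc hv,
          lengthVariation_eq y hne hs.2]
      · intro b _ hb
        rw [if_neg fun h => hb h.2.symm, zero_mul]
      · exact fun hn => absurd (hT k l h) hn
  have h1 : ∀ a, edgeWeight U P D x a * lengthVariation U P y a.out =
      1 / 2 * ∑ k, ∑ l, dependency (P.pos ∘ x) k * dependency (P.pos ∘ x) l *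
        ((if x k ≠ x l ∧ orb Γ (U.face D {x k, x l}) = a then (1 : ℝ) else 0) *
          lengthVariation U P y a.out) := by
    intro a
    simp only [edgeWeight, ← mul_assoc, ← Finset.sum_mul]
  simp only [h1]
  rw [← Finset.mul_sum, Finset.sum_comm]
  have h2 : ∀ k : Fin 6, ∑ a ∈ T, ∑ l, dependency (P.pos ∘ x) k * dependency (P.pos ∘ x) l *
        ((if x k ≠ x l ∧ orb Γ (U.face D {x k, x l}) = a then (1 : ℝ) else 0) *
          lengthVariation U P y a.out) = ∑ l, dependency (P.pos ∘ x) k *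
        dependency (P.pos ∘ x) l * (2 * inner ℝ (P.pos (x l) - P.pos (x k))
          (y.1 (x l) - y.1 (x k))) := by
    intro k
    rw [Finset.sum_comm]
    exact Finset.sum_congr rfl fun l _ => by rw [← Finset.mul_sum, hkl]
  rw [Finset.sum_congr rfl fun k _ => h2 k]
  have h3 := sum_dependency_mul_inner (P.pos ∘ x) (y.1 ∘ x)
  simp only [Function.comp_apply] at h3
  simp only [mul_left_comm _ (2 : ℝ), ← Finset.mul_sum, h3, mul_zero]

end Maps

section Exactness

variable {Γ V C : Type*} [Group Γ] [MulAction Γ V] [MulAction Γ C] [PartialOrder C]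
  {U : SimplicialCells Γ V C} (K : Triangulation U) (P : Development Γ V)
  (dg : Submodule ℝ (Γ → MotionAlgebra))

/-! ### Exactness in terms of elements -/

open Classical in
/-- The displacements of the vertices due to an infinitesimal motion. -/
def motionField (X : MotionAlgebra) : (V → E4) × (Γ → MotionAlgebra) :=
  (fun v => if v ∈ K.vertices then velocity X (P.pos v) else 0, 0)

/-- The variations of the deficit angles, with weights `S`. -/
def omegaSum (S : Orb Γ C → ℝ) (a : Orb Γ C) : ℝ :=
  ∑ i ∈ (K.orbits 2).toFinset, omegaMatrix K P a i * S i

/-- The value at `y` of the functional on displacements given by the weights `Ω` of the edges. -/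
def lengthSum (y : (V → E4) × (Γ → MotionAlgebra)) (Ω : Orb Γ C → ℝ) : ℝ :=
  ∑ a ∈ (K.orbits 1).toFinset, Ω a * lengthVariation U P y a.out

/-- Acyclicity, with functions on the simplices of `K` replaced by functions on all simplices. -/
structure ElementwiseAcyclic : Prop where
  injective : ∀ X ∈ trivialDeviations K P, trivialFamily K P X = 0 → X = 0
  exact_vertex : ∀ σ ∈ vertexDeviations K P, (∀ a ∈ K.simplices 1, edgeField U P σ a = 0) ↔
    ∃ X ∈ trivialDeviations K P, trivialFamily K P X = σ
  exact_edge : ∀ v ∈ edgeDeviations K P, (∀ i ∈ K.orbits 2, areaVariation U P v i.out = 0) ↔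
    ∃ σ ∈ vertexDeviations K P, ∀ a ∈ K.simplices 1, edgeField U P σ a = v a
  exact_area : ∀ S : Orb Γ C → ℝ, (∀ a ∈ K.orbits 1, omegaSum K P S a = 0) ↔
    ∃ v ∈ edgeDeviations K P, ∀ i ∈ K.orbits 2, areaVariation U P v i.out = S i
  exact_omega : ∀ Ω : Orb Γ C → ℝ, (∀ y ∈ displacements K P dg, lengthSum K P y Ω = 0) ↔
    ∃ S : Orb Γ C → ℝ, ∀ a ∈ K.orbits 1, omegaSum K P S a = Ω a
  exact_displacement : ∀ φ : ((V → E4) × (Γ → MotionAlgebra)) →ₗ[ℝ] ℝ,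
    (∀ X ∈ commutingMotions P, φ (motionField K P X) = 0) ↔
    ∃ Ω : Orb Γ C → ℝ, ∀ y ∈ displacements K P dg, φ y = lengthSum K P y Ω
  surjective : ∀ X ∈ commutingMotions P, motionField K P X = 0 → X = 0

variable {K P dg}

omit [PartialOrder C] in
lemma exists_extend {s : Set (Orb Γ C)} (S : s → ℝ) :
    ∃ S' : Orb Γ C → ℝ, ∀ i : s, S' i = S i := by
  classical
  exact ⟨fun i => if h : i ∈ s then S ⟨i, h⟩ else 0, fun i => by simp⟩

lemma mapVertexEdge_eq_iff (σ : vertexDeviations K P) (v : edgeDeviations K P) :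
    mapVertexEdge K P σ = v ↔ ∀ a ∈ K.simplices 1, edgeField U P σ.1 a = v.1 a := by
  have h : ∀ a ∈ K.simplices 1, (mapVertexEdge K P σ).1 a = edgeField U P σ.1 a := by
    intro a ha
    simp [mapVertexEdge, edgeField, ha, ha.2]
  constructor
  · rintro rfl a ha
    exact (h a ha).symm
  · intro hv
    ext1
    funext a
    by_cases ha : a ∈ K.simplices 1
    · rw [h a ha, hv a ha]
    · rw [(mapVertexEdge K P σ).2.1 a ha, v.2.1 a ha]

lemma mapAreaOmega_apply (S : Orb Γ C → ℝ) (a : K.orbits 1) :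
    mapAreaOmega K P (fun i => S i) a = omegaSum K P S a := by
  rw [omegaSum, Finset.sum_subtype (p := fun i => i ∈ K.orbits 2) _ fun _ => Set.mem_toFinset]
  rfl

lemma mapOmegaDual_apply (Ω : Orb Γ C → ℝ) (y : displacements K P dg) :
    mapOmegaDual K P dg (fun a => Ω a) y = lengthSum K P y.1 Ω := by
  rw [lengthSum, Finset.sum_subtype (p := fun i => i ∈ K.orbits 1) _ fun _ => Set.mem_toFinset]
  simp [mapOmegaDual, LinearMap.sum_apply]
  rfl

lemma exact_vertex_iff : Function.Exact (mapTrivial K P) (mapVertexEdge K P) ↔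
    ∀ σ ∈ vertexDeviations K P, (∀ a ∈ K.simplices 1, edgeField U P σ a = 0) ↔
      ∃ X ∈ trivialDeviations K P, trivialFamily K P X = σ := by
  constructor
  · intro h σ hσ
    have := h ⟨σ, hσ⟩
    rw [mapVertexEdge_eq_iff] at this
    refine this.trans ⟨?_, ?_⟩
    · rintro ⟨X, hX⟩
      exact ⟨X.1, X.2, congrArg Subtype.val hX⟩
    · rintro ⟨X, hX, h⟩
      exact ⟨⟨X, hX⟩, Subtype.ext h⟩
  · intro h σ
    rw [mapVertexEdge_eq_iff]
    refine (h σ.1 σ.2).trans ⟨?_, ?_⟩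
    · rintro ⟨X, hX, h⟩
      exact ⟨⟨X, hX⟩, Subtype.ext h⟩
    · rintro ⟨X, hX⟩
      exact ⟨X.1, X.2, congrArg Subtype.val hX⟩

lemma exact_edge_iff : Function.Exact (mapVertexEdge K P) (mapEdgeArea K P) ↔
    ∀ v ∈ edgeDeviations K P, (∀ i ∈ K.orbits 2, areaVariation U P v i.out = 0) ↔
      ∃ σ ∈ vertexDeviations K P, ∀ a ∈ K.simplices 1, edgeField U P σ a = v a := by
  have h1 : ∀ v : edgeDeviations K P, mapEdgeArea K P v = 0 ↔
      ∀ i ∈ K.orbits 2, areaVariation U P v.1 i.out = 0 := fun v =>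
    ⟨fun h i hi => congrFun h ⟨i, hi⟩, fun h => funext fun i => h i.1 i.2⟩
  have h2 : ∀ v : edgeDeviations K P, v ∈ Set.range (mapVertexEdge K P) ↔
      ∃ σ ∈ vertexDeviations K P, ∀ a ∈ K.simplices 1, edgeField U P σ a = v.1 a := fun v => by
    constructor
    · rintro ⟨σ, hσ⟩
      exact ⟨σ.1, σ.2, (mapVertexEdge_eq_iff σ v).1 hσ⟩
    · rintro ⟨σ, hσ, h⟩
      exact ⟨⟨σ, hσ⟩, (mapVertexEdge_eq_iff _ v).2 h⟩
  simp only [Function.Exact, h1, h2, Subtype.forall]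

lemma exact_area_iff : Function.Exact (mapEdgeArea K P) (mapAreaOmega K P) ↔
    ∀ S : Orb Γ C → ℝ, (∀ a ∈ K.orbits 1, omegaSum K P S a = 0) ↔
      ∃ v ∈ edgeDeviations K P, ∀ i ∈ K.orbits 2, areaVariation U P v i.out = S i := by
  have h1 : ∀ S : Orb Γ C → ℝ, mapAreaOmega K P (fun i => S i) = 0 ↔
      ∀ a ∈ K.orbits 1, omegaSum K P S a = 0 := fun S =>
    ⟨fun h a ha => (mapAreaOmega_apply S ⟨a, ha⟩).symm.trans (congrFun h ⟨a, ha⟩),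
      fun h => funext fun a => (mapAreaOmega_apply S a).trans (h a.1 a.2)⟩
  have h2 : ∀ S : Orb Γ C → ℝ, (fun i : K.orbits 2 => S i) ∈ Set.range (mapEdgeArea K P) ↔
      ∃ v ∈ edgeDeviations K P, ∀ i ∈ K.orbits 2, areaVariation U P v i.out = S i := fun S => by
    constructor
    · rintro ⟨v, hv⟩
      exact ⟨v.1, v.2, fun i hi => congrFun hv ⟨i, hi⟩⟩
    · rintro ⟨v, hv, h⟩
      exact ⟨⟨v, hv⟩, funext fun i => h i.1 i.2⟩
  constructor
  · intro h S
    rw [← h1, ← h2]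
    exact h _
  · intro h S
    obtain ⟨S', hS⟩ := exists_extend S
    rw [show S = fun i : K.orbits 2 => S' i from funext fun i => (hS i).symm, h1, h2]
    exact h S'

lemma exact_omega_iff : Function.Exact (mapAreaOmega K P) (mapOmegaDual K P dg) ↔
    ∀ Ω : Orb Γ C → ℝ, (∀ y ∈ displacements K P dg, lengthSum K P y Ω = 0) ↔
      ∃ S : Orb Γ C → ℝ, ∀ a ∈ K.orbits 1, omegaSum K P S a = Ω a := by
  have h1 : ∀ Ω : Orb Γ C → ℝ, mapOmegaDual K P dg (fun i => Ω i) = 0 ↔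
      ∀ y ∈ displacements K P dg, lengthSum K P y Ω = 0 := fun Ω =>
    ⟨fun h y hy => (mapOmegaDual_apply Ω ⟨y, hy⟩).symm.trans (LinearMap.congr_fun h ⟨y, hy⟩),
      fun h => LinearMap.ext fun y => (mapOmegaDual_apply Ω y).trans (h y.1 y.2)⟩
  have h2 : ∀ Ω : Orb Γ C → ℝ, (fun i : K.orbits 1 => Ω i) ∈ Set.range (mapAreaOmega K P) ↔
      ∃ S : Orb Γ C → ℝ, ∀ a ∈ K.orbits 1, omegaSum K P S a = Ω a := fun Ω => by
    constructor
    · rintro ⟨S, hS⟩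
      obtain ⟨S', hS'⟩ := exists_extend S
      refine ⟨S', fun a ha => ?_⟩
      rw [← mapAreaOmega_apply S' ⟨a, ha⟩, show (fun i : K.orbits 2 => S' i) = S from funext hS',
        hS]
    · rintro ⟨S, h⟩
      exact ⟨fun i => S i, funext fun a => (mapAreaOmega_apply S a).trans (h a.1 a.2)⟩
  constructor
  · intro h Ω
    rw [← h1, ← h2]
    exact h _
  · intro h Ω
    obtain ⟨Ω', hΩ⟩ := exists_extend Ω
    rw [show Ω = fun i : K.orbits 1 => Ω' i from funext fun i => (hΩ i).symm, h1, h2]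
    exact h Ω'

lemma exact_displacement_iff :
    Function.Exact (mapOmegaDual K P dg) (mapMotion K P dg).dualMap ↔
    ∀ φ : ((V → E4) × (Γ → MotionAlgebra)) →ₗ[ℝ] ℝ,
      (∀ X ∈ commutingMotions P, φ (motionField K P X) = 0) ↔
      ∃ Ω : Orb Γ C → ℝ, ∀ y ∈ displacements K P dg, φ y = lengthSum K P y Ω := by
  have h1 : ∀ φ : ((V → E4) × (Γ → MotionAlgebra)) →ₗ[ℝ] ℝ,
      (mapMotion K P dg).dualMap (φ ∘ₗ (displacements K P dg).subtype) = 0 ↔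
      ∀ X ∈ commutingMotions P, φ (motionField K P X) = 0 := fun φ =>
    ⟨fun h X hX => LinearMap.congr_fun h ⟨X, hX⟩, fun h => LinearMap.ext fun X => h X.1 X.2⟩
  have h2 : ∀ φ : ((V → E4) × (Γ → MotionAlgebra)) →ₗ[ℝ] ℝ,
      φ ∘ₗ (displacements K P dg).subtype ∈ Set.range (mapOmegaDual K P dg) ↔
      ∃ Ω : Orb Γ C → ℝ, ∀ y ∈ displacements K P dg, φ y = lengthSum K P y Ω := fun φ => by
    constructor
    · rintro ⟨Ω, hΩ⟩
      obtain ⟨Ω', hΩ'⟩ := exists_extend Ω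
      refine ⟨Ω', fun y hy => ?_⟩
      rw [← mapOmegaDual_apply Ω' ⟨y, hy⟩, show (fun i : K.orbits 1 => Ω' i) = Ω from funext hΩ',
        hΩ]
      rfl
    · rintro ⟨Ω, h⟩
      exact ⟨fun i => Ω i, LinearMap.ext fun y => (mapOmegaDual_apply Ω y).trans (h y.1 y.2).symm⟩
  constructor
  · intro h φ
    rw [← h1, ← h2]
    exact h _
  · intro h φ
    -- Every functional on the subspace of displacements is a restriction from the ambient space, so
    -- quantifying over ambient functionals loses nothing.
    obtain ⟨φ', rfl⟩ := LinearMap.exists_extend φ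
    rw [h1, h2]
    exact h φ'

lemma dualMap_surjective_iff_of_submodule {E F : Type*} [AddCommGroup E] [Module ℝ E]
    [AddCommGroup F] [Module ℝ F] {p : Submodule ℝ E} {q : Submodule ℝ F} (f : p →ₗ[ℝ] q) :
    Function.Surjective f.dualMap ↔ Function.Injective f :=
  LinearMap.dualMap_surjective_iff

lemma dualMap_mapMotion_surjective_iff : Function.Surjective (mapMotion K P dg).dualMap ↔
    ∀ X ∈ commutingMotions P, motionField K P X = 0 → X = 0 := by
  rw [dualMap_surjective_iff_of_submodule, injective_iff_map_eq_zero]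
  constructor
  · intro h X hX h0
    exact congrArg Subtype.val (h ⟨X, hX⟩ (Subtype.ext h0))
  · intro h X hX
    exact Subtype.ext (h X.1 X.2 (congrArg Subtype.val hX))

lemma mapTrivial_injective_iff : Function.Injective (mapTrivial K P) ↔
    ∀ X ∈ trivialDeviations K P, trivialFamily K P X = 0 → X = 0 := by
  rw [injective_iff_map_eq_zero]
  constructor
  · intro h X hX h0
    exact congrArg Subtype.val (h ⟨X, hX⟩ (Subtype.ext h0))
  · intro h X hX
    exact Subtype.ext (h X.1 X.2 (congrArg Subtype.val hX))

/-- In the elementwise form the conditions for `K` and `K'` concern the same ambient functions, so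
they can be compared without transport between different index types. -/
theorem acyclic_iff : Acyclic K P dg ↔ ElementwiseAcyclic K P dg := by
  constructor
  · rintro ⟨h1, h2, h3, h4, h5, h6, h7⟩
    exact ⟨mapTrivial_injective_iff.1 h1, exact_vertex_iff.1 h2, exact_edge_iff.1 h3,
      exact_area_iff.1 h4, exact_omega_iff.1 h5, exact_displacement_iff.1 h6,
      dualMap_mapMotion_surjective_iff.1 h7⟩
  · rintro ⟨h1, h2, h3, h4, h5, h6, h7⟩
    exact ⟨mapTrivial_injective_iff.2 h1, exact_vertex_iff.2 h2, exact_edge_iff.2 h3,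
      exact_area_iff.2 h4, exact_omega_iff.2 h5, exact_displacement_iff.2 h6,
      dualMap_mapMotion_surjective_iff.2 h7⟩

end Exactness

/-! ### Coordinates of a simplex in a frame orthogonal to an edge -/

/-- The unit vector along the edge together with `u` is an orthonormal basis. In it the first edge
vector has only its first coordinate, the length, so the 4×4 determinant reduces to the 3×3 one. -/
lemma abs_det_inner_frame {y : Fin 5 → E4} (hy : simplexDet y ≠ 0) {u : Fin 3 → E4}
    (hu : Orthonormal ℝ u) (hp : ∀ k, inner ℝ (u k) (y 1 - y 0) = 0) :
    |(Matrix.of fun j k : Fin 3 => inner ℝ (y 0 - y j.succ.succ) (u k)).det| * ‖y 1 - y 0‖ =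
      |simplexDet y| := by
  have hl : ‖y 1 - y 0‖ ≠ 0 := by
    intro h0
    rw [norm_eq_zero] at h0
    refine hy (Matrix.det_eq_zero_of_row_eq_zero 0 fun j => ?_)
    exact congrArg (fun t : E4 => t j) h0
  set p := y 1 - y 0
  set o : Fin 4 → E4 := Fin.cons (‖p‖⁻¹ • p) u with ho
  have horth : ∀ k l, inner ℝ (o k) (o l) = if k = l then (1 : ℝ) else 0 := by
    have hu' := orthonormal_iff_ite.1 hu
    intro k l
    refine Fin.cases ?_ (fun k => ?_) k <;> refine Fin.cases ?_ (fun l => ?_) l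
    · simp only [ho, Fin.cons_zero, inner_smul_left, inner_smul_right, conj_trivial,
        real_inner_self_eq_norm_sq, if_true]
      field_simp
    · simp only [ho, Fin.cons_zero, Fin.cons_succ, inner_smul_left]
      rw [real_inner_comm, hp, mul_zero, if_neg (Fin.succ_ne_zero l).symm]
    · simp only [ho, Fin.cons_zero, Fin.cons_succ, inner_smul_right]
      rw [hp, mul_zero, if_neg (Fin.succ_ne_zero k)]
    · simp only [ho, Fin.cons_succ, hu' k l, Fin.succ_inj]
  set B : Matrix (Fin 4) (Fin 4) ℝ := Matrix.of fun i k => o k i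
  have hinner : ∀ a b : E4, inner ℝ a b = ∑ i, a i * b i := fun a b => by
    rw [PiLp.inner_apply]
    exact Finset.sum_congr rfl fun i _ => mul_comm _ _
  have hB : |B.det| = 1 := by
    have h1 : Bᵀ * B = 1 := by
      ext k l
      rw [Matrix.mul_apply, Matrix.one_apply, ← horth, hinner]
      rfl
    have h2 := congrArg Matrix.det h1
    rw [Matrix.det_mul, Matrix.det_transpose, Matrix.det_one] at h2
    rcases mul_self_eq_one_iff.1 h2 with h | h <;> simp [h]
  have hM : (Matrix.of fun i j : Fin 4 => (y i.succ - y 0) j) * B =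
      Matrix.of fun i k => inner ℝ (y i.succ - y 0) (o k) := by
    ext i k
    rw [Matrix.mul_apply, Matrix.of_apply, hinner]
    rfl
  have hdet : (Matrix.of fun i k : Fin 4 => (inner ℝ (y i.succ - y 0) (o k) : ℝ)).det =
      ‖p‖ * (Matrix.of fun j k : Fin 3 => (inner ℝ (y j.succ.succ - y 0) (u k) : ℝ)).det := by
    rw [Matrix.det_succ_row_zero, Fin.sum_univ_succ]
    have h0 : (inner ℝ (y (Fin.succ 0) - y 0) (o 0) : ℝ) = ‖p‖ := by
      change inner ℝ p (o 0) = ‖p‖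
      simp only [ho, Fin.cons_zero, inner_smul_right, real_inner_self_eq_norm_sq]
      field_simp
    have h1 : ∀ k : Fin 3, (inner ℝ (y (Fin.succ 0) - y 0) (o k.succ) : ℝ) = 0 := fun k => by
      change inner ℝ p (o k.succ) = 0
      simp only [ho, Fin.cons_succ]
      rw [real_inner_comm, hp]
    simp only [Matrix.of_apply, h0, h1, mul_zero, zero_mul, Finset.sum_const_zero, add_zero,
      Fin.val_zero, pow_zero, one_mul]
    rfl
  have hneg : (Matrix.of fun j k : Fin 3 => (inner ℝ (y 0 - y j.succ.succ) (u k) : ℝ)) =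
      -Matrix.of fun j k : Fin 3 => (inner ℝ (y j.succ.succ - y 0) (u k) : ℝ) := by
    ext j k
    simp only [Matrix.of_apply, Matrix.neg_apply, ← inner_neg_left, neg_sub]
  have := congrArg (fun t => |t.det|) hM
  simp only [Matrix.det_mul, abs_mul, hB, mul_one, hdet] at this
  rw [hneg, Matrix.det_neg, abs_mul, simplexDet, this, abs_norm]
  simp [mul_comm]

/-! ### The 3×3 block of area derivatives at the new edge -/

section NewEdge

variable {Γ V C : Type*} [Group Γ] [MulAction Γ V] [MulAction Γ C] [PartialOrder C]
  {U : SimplicialCells Γ V C} {K K' : Triangulation U} {P : Development Γ V} {D : C}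
  {x : Fin 6 → V}

lemma IsEdgeField.area_mul_areaVariation_of_support {v : C → E4} (hv : IsEdgeField U P v)
    (hx : U.Enumerates D x) {k l m : Fin 6} (hkl : k ≠ l) (hkm : k ≠ m) (hlm : l ≠ m)
    (ha : P.area U (subface U D x {k, l, m}) ≠ 0)
    (h0 : ∀ q : Finset (Fin 6), q.card = 2 → q ≠ {k, l} → v (subface U D x q) = 0) :
    P.area U (subface U D x {k, l, m}) * areaVariation U P v (subface U D x {k, l, m}) =
      P.length U (subface U D x {k, l}) ^ 2 / 2 *
        inner ℝ (P.pos (x k) - P.pos (x m)) (v (subface U D x {k, l})) := by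
  have hs : ({k, l, m} : Finset (Fin 6)).card = 3 :=
    Finset.card_eq_three.2 ⟨k, l, m, hkl, hkm, hlm, rfl⟩
  have e1 : ({k, l, m} : Finset (Fin 6)).erase k = {l, m} := by
    ext a; simp only [Finset.mem_erase, Finset.mem_insert, Finset.mem_singleton]; omega
  have e2 : ({k, l, m} : Finset (Fin 6)).erase l = {k, m} := by
    ext a; simp only [Finset.mem_erase, Finset.mem_insert, Finset.mem_singleton]; omega
  have e3 : ({k, l, m} : Finset (Fin 6)).erase m = {k, l} := by
    ext a; simp only [Finset.mem_erase, Finset.mem_insert, Finset.mem_singleton]; omega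
  have n1 : ({l, m} : Finset (Fin 6)) ≠ {k, l} := fun h => by
    have : m ∈ ({k, l} : Finset (Fin 6)) := h ▸ by simp
    simp only [Finset.mem_insert, Finset.mem_singleton] at this
    omega
  have n2 : ({k, m} : Finset (Fin 6)) ≠ {k, l} := fun h => by
    have : m ∈ ({k, l} : Finset (Fin 6)) := h ▸ by simp
    simp only [Finset.mem_insert, Finset.mem_singleton] at this
    omega
  rw [hv.area_mul_areaVariation hx hs ha, Finset.sum_insert (by simp [hkl, hkm]),
    Finset.sum_pair hlm, e1, e2, e3]
  have z1 : pairTerm U P v D x k {l, m} = 0 := by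
    rw [pairTerm, h0 _ (Finset.card_pair hlm) n1, inner_zero_right, mul_zero]
  have z2 : pairTerm U P v D x l {k, m} = 0 := by
    rw [pairTerm, h0 _ (Finset.card_pair hkm) n2, inner_zero_right, mul_zero]
  have hsp := hx.subface_spec (s := {k, l}) ⟨k, by simp⟩
  rw [Finset.coe_pair, Set.image_pair] at hsp
  have h1 := hv.inner_eq_zero _ _ _ hsp.2
  rw [real_inner_comm, inner_sub_left, sub_eq_zero] at h1
  rw [z1, z2, pairTerm, Finset.sum_pair hkl, inner_smul_left, inner_add_left]
  simp only [inner_sub_left, conj_trivial, h1]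
  ring

/-- The derivatives of the areas of three faces at a new edge with respect to the deviation of
the edge. -/
def newEdgeMatrix (U : SimplicialCells Γ V C) (P : Development Γ V) (D : C) (x : Fin 6 → V)
    (u : C → Fin 3 → E4) : Matrix (Fin 3) (Fin 3) ℝ :=
  (areaMatrix U P u).submatrix (fun k => orb Γ (subface U D x {0, 1, ![2, 3, 4] k}))
    fun k => (orb Γ (subface U D x {0, 1}), k)

/-- No other edge of `D` lies in the orbit of the new one, so a single term of the area formula
survives. -/
lemma IsMove.newEdgeMatrix_apply (h : IsMove K K' D x {0, 1}) (hK : P.Nondegenerate K)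
    (hK' : P.Nondegenerate K') {u : C → Fin 3 → E4} (hu : IsFrame U P u) (j k : Fin 3) :
    newEdgeMatrix U P D x u j k =
      P.length U (subface U D x {0, 1}) ^ 2 /
        (2 * P.area U (subface U D x {0, 1, j.succ.succ.castSucc})) *
      inner ℝ (P.pos (x 0) - P.pos (x j.succ.succ.castSucc)) (u (subface U D x {0, 1}) k) := by
  classical
  have hj : (![2, 3, 4] j : Fin 6) = j.succ.succ.castSucc := by revert j; decide
  have h0 : (0 : Fin 6) ≠ j.succ.succ.castSucc := by revert j; decide
  have h1 : (1 : Fin 6) ≠ j.succ.succ.castSucc := by revert j; decide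
  have hs : ({0, 1, j.succ.succ.castSucc} : Finset (Fin 6)).card = 3 :=
    Finset.card_eq_three.2 ⟨_, _, _, by decide, h0, h1, rfl⟩
  have ha := (h.area_pos P hK hK' hs).ne'
  have hx := h.enumerates
  have hc : (U.verts (subface U D x {0, 1})).card = 2 := by
    rw [hx.card_subface ⟨0, by simp⟩]; rfl
  have hv := IsEdgeField.of_frame hu hc k
  have key := hv.area_mul_areaVariation_of_support hx (by decide) h0 h1 ha (fun q hq hne => by
    rw [if_neg]
    intro ho
    exact hne (h.orb_subface_injective ⟨0, by simp⟩ (by rw [← Finset.card_pos, hq]; norm_num)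
      (Or.inl (Finset.Subset.refl _)) ho))
  rw [if_pos rfl] at key
  have hout := hv.areaVariation_out (i := subface U D x {0, 1, j.succ.succ.castSucc}) (by
    rw [hx.card_subface ⟨0, by simp⟩, hs])
  have e : newEdgeMatrix U P D x u j k = areaVariation U P
      (fun a => if orb Γ a = orb Γ (subface U D x {0, 1}) then u a k else 0)
      (orb Γ (subface U D x {0, 1, j.succ.succ.castSucc})).out := by
    rw [newEdgeMatrix, Matrix.submatrix_apply, hj]
    rfl
  rw [e, hout]
  field_simp
  linarith

/-- The three rows contribute factors l² / (2S). The remaining determinant is computed in the facet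
opposite to `x 5` and equals |δ_5| / l in absolute value, which turns l⁶ into l⁵. -/
lemma IsMove.abs_det_newEdgeMatrix (h : IsMove K K' D x {0, 1}) (hK : P.Nondegenerate K)
    (hK' : P.Nondegenerate K') {u : C → Fin 3 → E4} (hu : IsFrame U P u) :
    |(newEdgeMatrix U P D x u).det| =
      P.length U (subface U D x {0, 1}) ^ 5 * |dependency (P.pos ∘ x) 5| /
        (8 * (P.area U (subface U D x {0, 1, 2}) * P.area U (subface U D x {0, 1, 3}) *
          P.area U (subface U D x {0, 1, 4}))) := by
  set l := P.length U (subface U D x {0, 1})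
  have hx := h.enumerates
  have hs := hx.subface_spec (s := {0, 1}) ⟨0, by simp⟩
  rw [Finset.coe_pair, Set.image_pair] at hs
  have hne : x 0 ≠ x 1 := hx.1.ne (by decide)
  have hl : l = ‖P.pos (x 1) - P.pos (x 0)‖ := by
    rw [← dist_eq_norm, dist_comm]
    exact P.length_eq U hne hs.2
  have hc : (U.verts (subface U D x {0, 1})).card = 2 := by
    rw [hx.card_subface ⟨0, by simp⟩]; rfl
  have hd : simplexDet ((P.pos ∘ x) ∘ Fin.succAbove 5) ≠ 0 := by
    rw [← abs_ne_zero, abs_simplexDet_succAbove, abs_ne_zero]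
    exact h.dependency_ne_zero P hK hK' 5
  have hperp : ∀ k, inner ℝ (u (subface U D x {0, 1}) k)
      (((P.pos ∘ x) ∘ Fin.succAbove 5) 1 - ((P.pos ∘ x) ∘ Fin.succAbove 5) 0) = 0 := by
    classical
    intro k
    have := (IsEdgeField.of_frame hu hc k).inner_eq_zero _ _ _ hs.2
    rwa [if_pos rfl] at this
  have key := abs_det_inner_frame hd (hu.1 _ hc).1 hperp
  rw [abs_simplexDet_succAbove] at key
  have e : newEdgeMatrix U P D x u = Matrix.diagonal (fun j : Fin 3 => l ^ 2 /
      (2 * P.area U (subface U D x {0, 1, j.succ.succ.castSucc}))) *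
      Matrix.of fun j k : Fin 3 => (inner ℝ (((P.pos ∘ x) ∘ Fin.succAbove 5) 0 -
        ((P.pos ∘ x) ∘ Fin.succAbove 5) j.succ.succ) (u (subface U D x {0, 1}) k) : ℝ) := by
    ext j k
    rw [h.newEdgeMatrix_apply hK hK' hu, Matrix.diagonal_mul]
    fin_cases j <;> rfl
  have hkey : |(Matrix.of fun j k : Fin 3 => (inner ℝ (((P.pos ∘ x) ∘ Fin.succAbove 5) 0 -
        ((P.pos ∘ x) ∘ Fin.succAbove 5) j.succ.succ) (u (subface U D x {0, 1}) k) : ℝ)).det| * l =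
      |dependency (P.pos ∘ x) 5| := by
    rw [hl]
    exact key
  have ha : ∀ j : Fin 6, ({0, 1, j} : Finset (Fin 6)).card = 3 →
      0 < P.area U (subface U D x {0, 1, j}) := fun j hj => h.area_pos P hK hK' hj
  have h2 := ha 2 (by decide)
  have h3 := ha 3 (by decide)
  have h4 := ha 4 (by decide)
  have hlen : 0 ≤ l := by rw [hl]; positivity
  rw [e, Matrix.det_mul, Matrix.det_diagonal, Fin.prod_univ_three, abs_mul, ← hkey]
  change |l ^ 2 / (2 * P.area U (subface U D x {0, 1, 2})) *
    (l ^ 2 / (2 * P.area U (subface U D x {0, 1, 3}))) *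
    (l ^ 2 / (2 * P.area U (subface U D x {0, 1, 4})))| * _ = _
  rw [abs_of_nonneg (by positivity)]
  field_simp
  ring

lemma IsMove.length_pos (h : IsMove K K' D x {0, 1}) (hK : P.Nondegenerate K)
    (hK' : P.Nondegenerate K') : 0 < P.length U (subface U D x {0, 1}) := by
  have hx := h.enumerates
  have hs := hx.subface_spec (s := {0, 1}) ⟨0, by simp⟩
  rw [Finset.coe_pair, Set.image_pair] at hs
  rw [P.length_eq U (hx.1.ne (by decide)) hs.2, dist_eq_norm]
  refine lt_of_le_of_ne (norm_nonneg _) fun h0 => ?_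
  have hd : simplexDet ((P.pos ∘ x) ∘ Fin.succAbove 5) ≠ 0 := by
    rw [← abs_ne_zero, abs_simplexDet_succAbove, abs_ne_zero]
    exact h.dependency_ne_zero P hK hK' 5
  refine hd (Matrix.det_eq_zero_of_row_eq_zero 0 fun j => ?_)
  rw [eq_comm, norm_sub_rev, norm_eq_zero] at h0
  exact congrArg (fun t : E4 => t j) h0

lemma IsMove.det_newEdgeMatrix_ne_zero (h : IsMove K K' D x {0, 1}) (hK : P.Nondegenerate K)
    (hK' : P.Nondegenerate K') {u : C → Fin 3 → E4} (hu : IsFrame U P u) :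
    (newEdgeMatrix U P D x u).det ≠ 0 := by
  rw [← abs_ne_zero, h.abs_det_newEdgeMatrix hK hK' hu]
  have ha : ∀ j : Fin 6, ({0, 1, j} : Finset (Fin 6)).card = 3 →
      0 < P.area U (subface U D x {0, 1, j}) := fun j hj => h.area_pos P hK hK' hj
  have h2 := ha 2 (by decide)
  have h3 := ha 3 (by decide)
  have h4 := ha 4 (by decide)
  have h5 := abs_pos.2 (h.dependency_ne_zero P hK hK' 5)
  have hl := h.length_pos hK hK'
  positivity

/-- The minor of `(∂S_i / ∂v_a)` when three new faces and a new edge are added. -/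
lemma IsMove.minorArea_border (h : IsMove K K' D x {0, 1}) (u : C → Fin 3 → E4)
    {κ : Type*} [Fintype κ] [DecidableEq κ] (j : κ → Orb Γ C) (b : κ → Orb Γ C × Fin 3)
    (hj : ∀ k, j k ∈ K.orbits 2) :
    minorArea U P u (Sum.elim j fun k : Fin 3 => orb Γ (subface U D x {0, 1, ![2, 3, 4] k}))
      (Sum.elim b fun k : Fin 3 => (orb Γ (subface U D x {0, 1}), k)) =
    minorArea U P u j b * (newEdgeMatrix U P D x u).det := by
  classical
  have hedge : orb Γ (subface U D x {0, 1}) ∉ K.orbits 1 := by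
    rw [h.orb_subface_mem rfl (by norm_num)]
    exact fun hn => hn (Finset.Subset.refl _)
  have hM : (areaMatrix U P u).submatrix
      (Sum.elim j fun k : Fin 3 => orb Γ (subface U D x {0, 1, ![2, 3, 4] k}))
      (Sum.elim b fun k : Fin 3 => (orb Γ (subface U D x {0, 1}), k)) =
      Matrix.fromBlocks ((areaMatrix U P u).submatrix j b) 0
        ((areaMatrix U P u).submatrix
          (fun k : Fin 3 => orb Γ (subface U D x {0, 1, ![2, 3, 4] k})) b)
        (newEdgeMatrix U P D x u) := by
    ext m n
    rcases m with m | m <;> rcases n with n | n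
    · rfl
    -- The new edge is not an edge of any face of `K`, so its deviation does not affect the old
    -- rows.
    · rw [Matrix.fromBlocks_apply₁₂, Matrix.zero_apply]
      have e : areaVariation U P (fun _ => (0 : E4)) (j m).out = 0 := by
        simp [areaVariation]
      have e' : areaVariation U P
          (fun a => if orb Γ a = orb Γ (subface U D x {0, 1}) then u a n else 0) (j m).out =
          areaVariation U P (fun _ => (0 : E4)) (j m).out :=
        areaVariation_congr_of_mem (K := K) (fun a ha => if_neg
          fun ho : orb Γ a = orb Γ (subface U D x {0, 1}) =>
            hedge (ho ▸ K.orb_mem_orbits.2 ha)) (hj m)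
      exact e'.trans e
    · rfl
    · rfl
  rw [minorArea, hM, Matrix.det_fromBlocks_zero₁₂]
  rfl

end NewEdge

section Transfer

variable {Γ V C : Type*} [Group Γ] [MulAction Γ V] [MulAction Γ C] [PartialOrder C]
  {U : SimplicialCells Γ V C} {K K' : Triangulation U} {P : Development Γ V} {D : C}
  {x : Fin 6 → V} {J : Finset (Fin 6)} {dg : Submodule ℝ (Γ → MotionAlgebra)}

/-! ### Spaces that depend only on the vertices or on the edges -/

lemma vertexDeviations_congr (h : K.vertices = K'.vertices) :
    vertexDeviations K P = vertexDeviations K' P := by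
  refine Submodule.ext fun σ => ?_
  change (_ ∧ _) ↔ (_ ∧ _)
  rw [h]

lemma trivialFamily_congr (h : K.vertices = K'.vertices) :
    trivialFamily K P = trivialFamily K' P := by
  refine LinearMap.ext fun X => ?_
  funext v
  have hv : v ∈ K.vertices ↔ v ∈ K'.vertices := by rw [h]
  by_cases h' : v ∈ K'.vertices <;> simp [trivialFamily, hv, h']

lemma trivialDeviations_congr (h : K.vertices = K'.vertices) :
    trivialDeviations K P = trivialDeviations K' P := by
  rw [trivialDeviations, trivialDeviations, vertexDeviations_congr h, trivialFamily_congr h]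

lemma displacements_congr (h : K.vertices = K'.vertices) :
    displacements K P dg = displacements K' P dg := by
  refine Submodule.ext fun σ => ?_
  change (_ ∧ _) ↔ (_ ∧ _)
  rw [h]

lemma motionField_congr (h : K.vertices = K'.vertices) : motionField K P = motionField K' P := by
  funext X
  rw [motionField, motionField, h]

/-- A lost vertex would be an interior face of the old cluster, and such a face has at least |Jᶜ| ≥
2 vertices. -/
lemma IsMove.vertices_subset (h : IsMove K K' D x J) (hJ : 2 ≤ Jᶜ.card) :
    K.vertices ⊆ K'.vertices := by
  rintro v ⟨c, hc, hv⟩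
  have hs := U.face_spec (c := c) (s := {v}) ⟨v, rfl⟩ (Set.singleton_subset_iff.2 hv)
  have hm : U.face c {v} ∈ K.simplices 0 := by
    refine ⟨K.lower _ _ hs.1 hc, ?_⟩
    rw [← Set.ncard_coe_finset, hs.2, Set.ncard_singleton]
  rcases h.mem_orbits_or (K.orb_mem_orbits.2 hm) with hq | ⟨s, hs1, hs2, -⟩
  · refine ⟨_, (K'.orb_mem_orbits.1 hq).1, ?_⟩
    have : v ∈ (U.verts (U.face c {v}) : Set V) := by rw [hs.2]; rfl
    exact this
  · have := Finset.card_le_card hs2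
    omega

lemma IsMove.vertices_eq (h : IsMove K K' D x J) (hJ : 2 ≤ J.card) (hJ' : 2 ≤ Jᶜ.card) :
    K.vertices = K'.vertices :=
  (h.vertices_subset hJ').antisymm (h.symm.vertices_subset (by rwa [compl_compl]))

lemma IsMove.mem_vertices (h : IsMove K K' D x J) (hJ : 2 ≤ J.card) (k : Fin 6) :
    x k ∈ K.vertices := by
  refine ⟨subface U D x {k}, (h.subface_mem ⟨k, by simp⟩ (by revert k; decide)).2 fun hk => ?_,
    (h.enumerates.mem_verts_subface ⟨k, by simp⟩).2 (by simp)⟩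
  have := Finset.card_le_card hk
  rw [Finset.card_singleton] at this
  omega

lemma IsMove.edges_subset (h : IsMove K K' D x J) (hJ : 3 ≤ Jᶜ.card) :
    K.orbits 1 ⊆ K'.orbits 1 := by
  intro q hq
  rcases h.mem_orbits_or hq with hq | ⟨s, hs1, hs2, -⟩
  · exact hq
  · have := Finset.card_le_card hs2
    omega

lemma simplices_subset_of_orbits_subset {n : ℕ} (h : K.orbits n ⊆ K'.orbits n) :
    K.simplices n ⊆ K'.simplices n := fun _ hc =>
  K'.orb_mem_orbits.1 (h (K.orb_mem_orbits.2 hc))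

lemma mem_edgeDeviations_of_subset (h : K.orbits 1 ⊆ K'.orbits 1) {v : C → E4}
    (hv : v ∈ edgeDeviations K P) : v ∈ edgeDeviations K' P := by
  have hf := IsEdgeField.of_mem hv
  refine ⟨fun a ha => hv.1 a fun ha' => ha (simplices_subset_of_orbits_subset h ha'),
    fun a ha => hf.inner_eq_zero _ _ _ (coe_verts_tuple ha.2), hv.2.2⟩

lemma edgeDeviations_congr (h : K.orbits 1 = K'.orbits 1) :
    edgeDeviations K P = edgeDeviations K' P :=
  le_antisymm (fun _ hv => mem_edgeDeviations_of_subset h.le hv)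
    fun _ hv => mem_edgeDeviations_of_subset h.ge hv

lemma omegaSum_congr {S S' : Orb Γ C → ℝ} (h : ∀ i ∈ K.orbits 2, S i = S' i) :
    omegaSum K P S = omegaSum K P S' := by
  funext a
  exact Finset.sum_congr rfl fun i hi => by rw [h i (Set.mem_toFinset.1 hi)]

/-! ### The weights of the faces and of the edges -/

open Classical in
/-- The sum of `S` over the faces of two triangulations, with the weights given by a
5-simplex. -/
def faceSum (K K' : Triangulation U) (P : Development Γ V) (D : C) (x : Fin 6 → V)
    (S : Orb Γ C → ℝ) : ℝ :=
  ∑ i ∈ (K.orbits 2).toFinset ∪ (K'.orbits 2).toFinset, faceWeight U P D x i * S i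

open Classical in
lemma faceSum_comm (S : Orb Γ C → ℝ) : faceSum K K' P D x S = faceSum K' K P D x S := by
  rw [faceSum, faceSum, Finset.union_comm]

lemma faceSum_sub (S T : Orb Γ C → ℝ) : faceSum K K' P D x (fun i => S i - T i) =
    faceSum K K' P D x S - faceSum K K' P D x T := by
  simp only [faceSum, mul_sub, Finset.sum_sub_distrib]

open Classical in
-- The value of S at one face of nonzero weight is a free parameter for the weighted sum. It will be
-- used at a face that one of the triangulations does not contain.
lemma exists_faceSum_eq (S : Orb Γ C → ℝ) {g : Orb Γ C} (hg : g ∈ K.orbits 2 ∨ g ∈ K'.orbits 2)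
    (hu : faceWeight U P D x g ≠ 0) (t : ℝ) :
    ∃ S' : Orb Γ C → ℝ, (∀ i, i ≠ g → S' i = S i) ∧ faceSum K K' P D x S' = t := by
  refine ⟨fun i => S i + if i = g then (t - faceSum K K' P D x S) / faceWeight U P D x g else 0,
    fun i hi => by simp [hi], ?_⟩
  have hg' : g ∈ (K.orbits 2).toFinset ∪ (K'.orbits 2).toFinset := by
    simpa only [Finset.mem_union, Set.mem_toFinset] using hg
  rw [faceSum]
  simp only [mul_add, Finset.sum_add_distrib, mul_ite, mul_zero]
  rw [Finset.sum_ite_eq', if_pos hg', mul_div_cancel₀ _ hu, faceSum]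
  ring

open Classical in
lemma eq_zero_of_faceSum {T : Orb Γ C → ℝ} {g : Orb Γ C} (hu : faceWeight U P D x g ≠ 0)
    (hT : faceSum K K' P D x T = 0) (h0 : ∀ i ∈ K.orbits 2, T i = 0)
    (hg : ∀ i ∈ K'.orbits 2, i ≠ g → T i = 0) : ∀ i ∈ K'.orbits 2, T i = 0 := by
  intro i hi
  by_cases hig : i = g
  · subst hig
    by_contra hne
    rw [faceSum, Finset.sum_eq_single i] at hT
    · exact (mul_ne_zero hu hne) hT
    · intro j hj hji
      rw [Finset.mem_union, Set.mem_toFinset, Set.mem_toFinset] at hj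
      rcases hj with hj | hj
      · rw [h0 j hj, mul_zero]
      · rw [hg j hj hji, mul_zero]
    · intro hn
      exact absurd (Finset.mem_union_right _ (Set.mem_toFinset.2 hi)) hn
  · exact hg i hi hig

lemma IsMove.orb_subface_mem_or (h : IsMove K K' D x J) {n : ℕ} {s : Finset (Fin 6)}
    (hn : s.card = n + 1) (hn5 : n < 5) :
    orb Γ (subface U D x s) ∈ K.orbits n ∨ orb Γ (subface U D x s) ∈ K'.orbits n := by
  rw [h.orb_subface_mem hn hn5, h.orb_subface_mem_new hn hn5, ← not_and_or]
  rintro ⟨h1, h2⟩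
  have : s = Finset.univ := by
    rw [← Finset.univ_subset_iff, ← Finset.union_compl J]
    exact Finset.union_subset h1 h2
  rw [this] at hn
  simp at hn
  omega

open Classical in
lemma IsMove.faceSum_areaVariation (h : IsMove K K' D x J) (hK : P.Nondegenerate K)
    (hK' : P.Nondegenerate K') {v : C → E4} (hv : IsEdgeField U P v) :
    faceSum K K' P D x (fun i => areaVariation U P v i.out) = 0 :=
  hv.sum_faceWeight h.enumerates (h.dependency_ne_zero P hK hK')
    (fun _ hs => (h.area_pos P hK hK' hs).ne') fun s hs => by
      rw [Finset.mem_union, Set.mem_toFinset, Set.mem_toFinset]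
      exact h.orb_subface_mem_or hs (by norm_num)

lemma IsMove.faceWeight_ne_zero (h : IsMove K K' D x J) (hK : P.Nondegenerate K)
    (hK' : P.Nondegenerate K') {s : Finset (Fin 6)} (hs : s.card = 3) (hJ : J ⊆ s ∨ Jᶜ ⊆ s) :
    faceWeight U P D x (orb Γ (subface U D x s)) ≠ 0 := by
  rw [h.faceWeight_eq P hs hJ]
  exact div_ne_zero (h.area_pos P hK hK' hs).ne'
    (Finset.prod_ne_zero_iff.2 fun k _ => h.dependency_ne_zero P hK hK' k)

open Classical in
lemma omegaSum_eq_sum_union (K K' : Triangulation U) (S : Orb Γ C → ℝ) (a : Orb Γ C) :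
    omegaSum K P S a = ∑ i ∈ (K.orbits 2).toFinset ∪ (K'.orbits 2).toFinset,
      omegaMatrix K P a i * S i := by
  rw [omegaSum]
  refine Finset.sum_subset_zero_on_sdiff Finset.subset_union_left (fun i hi => ?_) fun _ _ => rfl
  rw [Finset.mem_sdiff, Finset.mem_union, Set.mem_toFinset, Set.mem_toFinset] at hi
  rcases hi.1 with h | h
  · exact absurd h hi.2
  · rw [omegaMatrix_eq_zero_of_face P K hi.2 (card_verts_out_of_mem h), zero_mul]

open Classical in
-- On functions with zero `faceSum` the operators of the two triangulations agree; at the new edge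
-- of a move 2 → 4 only the rank-one term is present.
lemma IsMove.omegaSum_eq (h : IsMove K K' D x J) (hK : P.Nondegenerate K)
    (hK' : P.Nondegenerate K') (hJ : ∃ k, k ∉ J) : ∃ c : ℝ, c ≠ 0 ∧ ∀ S a,
      omegaSum K' P S a = omegaSum K P S a + c * edgeWeight U P D x a * faceSum K K' P D x S := by
  obtain ⟨c, hc, hW⟩ := omegaMatrix_move P h hK hK' hJ
  refine ⟨c, by rintro rfl; simp at hc, fun S a => ?_⟩
  rw [omegaSum_eq_sum_union K K', omegaSum_eq_sum_union K' K, Finset.union_comm, faceSum,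
    Finset.mul_sum, ← Finset.sum_add_distrib]
  refine Finset.sum_congr rfl fun i hi => ?_
  rw [Finset.mem_union, Set.mem_toFinset, Set.mem_toFinset] at hi
  have hi3 : (U.verts i.out).card = 3 := by
    rcases hi with hi | hi <;> exact card_verts_out_of_mem hi
  rw [hW a i hi3]
  ring

lemma omegaSum_eq_zero_of_edge {S : Orb Γ C → ℝ} {a : Orb Γ C} (ha : a ∉ K.orbits 1) :
    omegaSum K P S a = 0 :=
  Finset.sum_eq_zero fun i hi => by
    rw [omegaMatrix_eq_zero_of_edge P K ha (card_verts_out_of_mem (Set.mem_toFinset.1 hi)),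
      zero_mul]

/-! ### Moves that replace a face -/

lemma IsMove.mem_faces_of_ne (h : IsMove K K' D x J) (hJ : Jᶜ.card = 3) {i : Orb Γ C}
    (hi : i ∈ K.orbits 2) (hne : i ≠ orb Γ (subface U D x Jᶜ)) : i ∈ K'.orbits 2 := by
  rcases h.mem_orbits_or hi with h1 | ⟨s, hs1, hs2, hs3⟩
  · exact h1
  · rw [Finset.eq_of_subset_of_card_le hs2 (by rw [hs1, hJ])] at hne
    exact absurd hs3.symm hne

lemma lengthSum_congr (h : K.orbits 1 = K'.orbits 1) (y : (V → E4) × (Γ → MotionAlgebra))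
    (Ω : Orb Γ C → ℝ) : lengthSum K P y Ω = lengthSum K' P y Ω := by
  have : (K.orbits 1).toFinset = (K'.orbits 1).toFinset := by
    ext
    simp [h]
  rw [lengthSum, lengthSum, this]

/-- Vertices and edges do not change, so only the conditions involving faces need an argument. A
function on the faces of one triangulation is adjusted at the exchanged face absent from it until
`faceSum` vanishes; after that it has the same image under both operators. One implication suffices,
since the inverse move has the same form. -/
lemma IsMove.elementwiseAcyclic_of_replace (h : IsMove K K' D x J) (hK : P.Nondegenerate K)
    (hK' : P.Nondegenerate K') (hJ : J.card = 3) (hA : ElementwiseAcyclic K P dg) :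
    ElementwiseAcyclic K' P dg := by
  have hJc : Jᶜ.card = 3 := by rw [Finset.card_compl, hJ]; rfl
  have hV := h.vertices_eq (by omega) (by omega)
  have hE : K.orbits 1 = K'.orbits 1 := (h.edges_subset (by omega)).antisymm
    (h.symm.edges_subset (by rw [compl_compl]; omega))
  have hs1 : K.simplices 1 = K'.simplices 1 := (simplices_subset_of_orbits_subset hE.le).antisymm
    (simplices_subset_of_orbits_subset hE.ge)
  have hu : faceWeight U P D x (orb Γ (subface U D x Jᶜ)) ≠ 0 :=
    h.faceWeight_ne_zero hK hK' hJc (Or.inr (Finset.Subset.refl _))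
  have hu' : faceWeight U P D x (orb Γ (subface U D x J)) ≠ 0 :=
    h.faceWeight_ne_zero hK hK' hJ (Or.inl (Finset.Subset.refl _))
  have hold : ∀ i ∈ K.orbits 2, i ≠ orb Γ (subface U D x Jᶜ) → i ∈ K'.orbits 2 := fun i =>
    h.mem_faces_of_ne hJc
  have hnew : ∀ i ∈ K'.orbits 2, i ≠ orb Γ (subface U D x J) → i ∈ K.orbits 2 := fun i hi hne => by
    refine h.symm.mem_faces_of_ne (by rw [compl_compl, hJ]) hi (by rwa [compl_compl])
  have hfK : orb Γ (subface U D x Jᶜ) ∈ K.orbits 2 := by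
    rw [h.orb_subface_mem hJc (by norm_num)]
    intro hs
    obtain ⟨k, hk⟩ := Finset.card_pos.1 (show 0 < J.card by omega)
    exact (Finset.mem_compl.1 (hs hk)) hk
  have hfK' : orb Γ (subface U D x Jᶜ) ∉ K'.orbits 2 := by
    rw [h.orb_subface_mem_new hJc (by norm_num)]
    exact fun hn => hn (Finset.Subset.refl _)
  have hgK' : orb Γ (subface U D x J) ∈ K'.orbits 2 := by
    rw [h.orb_subface_mem_new hJ (by norm_num)]
    intro hs
    obtain ⟨k, hk⟩ := Finset.card_pos.1 (show 0 < Jᶜ.card by omega)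
    exact (Finset.mem_compl.1 hk) (hs hk)
  have hgK : orb Γ (subface U D x J) ∉ K.orbits 2 := by
    rw [h.orb_subface_mem hJ (by norm_num)]
    exact fun hn => hn (Finset.Subset.refl _)
  -- When `faceSum` vanishes, the value at the exchanged face is forced by the values at the common
  -- faces.
  have hzero : ∀ T : Orb Γ C → ℝ, faceSum K K' P D x T = 0 →
      ((∀ i ∈ K'.orbits 2, T i = 0) ↔ ∀ i ∈ K.orbits 2, T i = 0) := fun T hT =>
    ⟨fun h0 => eq_zero_of_faceSum hu (faceSum_comm (K := K) T ▸ hT) h0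
        fun i hi hne => h0 i (hold i hi hne),
      fun h0 => eq_zero_of_faceSum hu' hT h0 fun i hi hne => h0 i (hnew i hi hne)⟩
  obtain ⟨c, -, hc⟩ := h.omegaSum_eq hK hK' (by
    obtain ⟨k, hk⟩ := Finset.card_pos.1 (show 0 < Jᶜ.card by omega)
    exact ⟨k, Finset.mem_compl.1 hk⟩)
  refine ⟨?_, ?_, ?_, ?_, ?_, ?_, ?_⟩
  · rw [← trivialDeviations_congr hV, ← trivialFamily_congr hV]
    exact hA.injective
  · rw [← trivialDeviations_congr hV, ← trivialFamily_congr hV, ← vertexDeviations_congr hV, ← hs1]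
    exact hA.exact_vertex
  · rw [← vertexDeviations_congr hV, ← hs1, ← edgeDeviations_congr hE]
    intro v hv
    rw [← hA.exact_edge v hv]
    exact hzero _ (h.faceSum_areaVariation hK hK' (IsEdgeField.of_mem hv))
  · rw [← edgeDeviations_congr hE, ← hE]
    intro S
    -- Only the value at the old face is changed, which `K'` does not see.
    obtain ⟨S₁, hS₁, hf⟩ := exists_faceSum_eq (K := K) (K' := K') S (Or.inl hfK) hu 0
    have hS' : ∀ i ∈ K'.orbits 2, S i = S₁ i := fun i hi =>
      (hS₁ i fun hi' => hfK' (hi' ▸ hi)).symm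
    have h1 : ∀ a, omegaSum K' P S a = omegaSum K P S₁ a := fun a => by
      rw [omegaSum_congr hS', hc, hf, mul_zero, add_zero]
    simp only [h1]
    rw [hA.exact_area]
    refine exists_congr fun v => and_congr_right fun hv => ?_
    have h2 := hzero (fun i => areaVariation U P v i.out - S₁ i) (by
      rw [faceSum_sub, hf, h.faceSum_areaVariation hK hK' (IsEdgeField.of_mem hv), sub_zero])
    simp only [sub_eq_zero] at h2
    rw [← h2]
    exact forall₂_congr fun i hi => by rw [hS' i hi]
  · rw [← displacements_congr hV]
    simp only [← lengthSum_congr hE, ← hE]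
    intro Ω
    rw [hA.exact_omega]
    constructor
    · rintro ⟨S, hS⟩
      obtain ⟨S₁, hS₁, hf⟩ := exists_faceSum_eq (K := K) (K' := K') S (Or.inr hgK') hu' 0
      refine ⟨S₁, fun a ha => ?_⟩
      rw [hc, hf, mul_zero, add_zero, ← hS a ha]
      exact congrFun (omegaSum_congr fun i hi => hS₁ i fun hi' => hgK (hi' ▸ hi)) a
    · rintro ⟨S, hS⟩
      obtain ⟨S₁, hS₁, hf⟩ := exists_faceSum_eq (K := K) (K' := K') S (Or.inl hfK) hu 0
      refine ⟨S₁, fun a ha => ?_⟩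
      have h1 := hc S₁ a
      rw [hf, mul_zero, add_zero] at h1
      rw [← h1, ← hS a ha]
      exact congrFun (omegaSum_congr fun i hi => hS₁ i fun hi' => hfK' (hi' ▸ hi)) a
  · rw [← displacements_congr hV, ← motionField_congr hV]
    simp only [← lengthSum_congr hE]
    exact hA.exact_displacement
  · rw [← motionField_congr hV]
    exact hA.surjective

end Transfer

section AddEdge

variable {Γ V C : Type*} [Group Γ] [MulAction Γ V] [MulAction Γ C] [PartialOrder C]
  {U : SimplicialCells Γ V C} {K K' : Triangulation U} {P : Development Γ V} {D : C}
  {x : Fin 6 → V} {dg : Submodule ℝ (Γ → MotionAlgebra)}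

/-! ### Moves that add an edge -/

namespace IsMove

lemma newEdge_notMem (h : IsMove K K' D x {0, 1}) :
    orb Γ (subface U D x {0, 1}) ∉ K.orbits 1 := by
  rw [h.orb_subface_mem rfl (by norm_num)]
  exact fun hn => hn (Finset.Subset.refl _)

lemma newEdge_mem (h : IsMove K K' D x {0, 1}) :
    orb Γ (subface U D x {0, 1}) ∈ K'.orbits 1 := by
  rw [h.orb_subface_mem_new rfl (by norm_num)]
  decide

lemma mem_edges_iff (h : IsMove K K' D x {0, 1}) {a : Orb Γ C} :
    a ∈ K'.orbits 1 ↔ a ∈ K.orbits 1 ∨ a = orb Γ (subface U D x {0, 1}) := by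
  constructor
  · intro ha
    rcases h.symm.mem_orbits_or ha with h1 | ⟨s, hs1, hs2, hs3⟩
    · exact Or.inl h1
    · rw [compl_compl] at hs2
      rw [← Finset.eq_of_subset_of_card_le hs2 (by rw [hs1]; rfl)] at hs3
      exact Or.inr hs3.symm
  · rintro (ha | rfl)
    · exact h.edges_subset (by decide) ha
    · exact h.newEdge_mem

lemma newFace_notMem (h : IsMove K K' D x {0, 1}) {k : Fin 6} (hk : k ≠ 0 ∧ k ≠ 1) :
    orb Γ (subface U D x {0, 1, k}) ∉ K.orbits 2 := by
  rw [h.orb_subface_mem (n := 2) (by revert k; decide) (by norm_num)]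
  exact fun hn => hn (by revert k; decide)

lemma newFace_mem (h : IsMove K K' D x {0, 1}) {k : Fin 6} (hk : k ≠ 0 ∧ k ≠ 1) :
    orb Γ (subface U D x {0, 1, k}) ∈ K'.orbits 2 := by
  rw [h.orb_subface_mem_new (n := 2) (by revert k; decide) (by norm_num)]
  revert k
  decide

lemma mem_faces_iff (h : IsMove K K' D x {0, 1}) {i : Orb Γ C} :
    i ∈ K'.orbits 2 ↔ i ∈ K.orbits 2 ∨
      ∃ k : Fin 6, (k ≠ 0 ∧ k ≠ 1) ∧ i = orb Γ (subface U D x {0, 1, k}) := by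
  constructor
  · intro hi
    rcases h.symm.mem_orbits_or hi with h1 | ⟨s, hs1, hs2, hs3⟩
    · exact Or.inl h1
    · rw [compl_compl] at hs2
      have hs : ∃ k : Fin 6, (k ≠ 0 ∧ k ≠ 1) ∧ s = {0, 1, k} := by
        obtain ⟨k, hk⟩ := Finset.card_eq_one.1
          (show (s \ {0, 1}).card = 1 by rw [Finset.card_sdiff_of_subset hs2, hs1]; rfl)
        have hk' : k ∈ s \ {0, 1} := by rw [hk]; simp
        rw [Finset.mem_sdiff] at hk'
        refine ⟨k, by simpa using hk'.2, ?_⟩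
        rw [← Finset.union_sdiff_of_subset hs2, hk]
        rfl
      obtain ⟨k, hk, rfl⟩ := hs
      exact Or.inr ⟨k, hk, hs3.symm⟩
  · rintro (hi | ⟨k, hk, rfl⟩)
    · rcases h.mem_orbits_or hi with h1 | ⟨s, hs1, hs2, -⟩
      · exact h1
      · have := Finset.card_le_card hs2
        rw [hs1] at this
        exact absurd this (by decide)
    · exact h.newFace_mem hk

/-- An edge field that vanishes at the old edges and does not change the areas of the new faces
vanishes. -/
lemma edgeField_eq_zero (h : IsMove K K' D x {0, 1}) (hK : P.Nondegenerate K)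
    (hK' : P.Nondegenerate K') {z : C → E4} (hz : IsEdgeField U P z)
    (h0 : ∀ a ∈ K.simplices 1, z a = 0)
    (hA : ∀ i ∈ K'.orbits 2, areaVariation U P z i.out = 0) : ∀ a ∈ K'.simplices 1, z a = 0 := by
  have hx := h.enumerates
  have hs := hx.subface_spec (s := {0, 1}) ⟨0, by simp⟩
  rw [Finset.coe_pair, Set.image_pair] at hs
  have hold : ∀ q : Finset (Fin 6), q.card = 2 → q ≠ {0, 1} → z (subface U D x q) = 0 := by
    intro q hq hne
    refine h0 _ (K.orb_mem_orbits.1 ?_)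
    rw [h.orb_subface_mem hq (by norm_num)]
    exact fun hsub => hne (Finset.eq_of_subset_of_card_le hsub (by rw [hq]; rfl)).symm
  -- Since only the new edge deviates, each area condition says that its deviation is orthogonal to
  -- one more edge vector at `x 0`. Together with the edge itself these vectors span the space.
  have hperp : ∀ k : Fin 6, k ≠ 0 ∧ k ≠ 1 →
      inner ℝ (P.pos (x k) - P.pos (x 0)) (z (subface U D x {0, 1})) = 0 := by
    intro k hk
    have hc : ({0, 1, k} : Finset (Fin 6)).card = 3 := by revert k; decide
    have ha := (h.area_pos P hK hK' hc).ne'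
    have key := hz.area_mul_areaVariation_of_support hx (by decide) hk.1.symm hk.2.symm ha hold
    rw [← hz.areaVariation_out (by rw [hx.card_subface ⟨0, by simp⟩, hc]),
      hA _ (h.newFace_mem hk), mul_zero, eq_comm, mul_eq_zero] at key
    rw [← neg_sub, inner_neg_left, neg_eq_zero]
    refine key.resolve_left ?_
    have := h.length_pos hK hK'
    positivity
  have hd : simplexDet ((P.pos ∘ x) ∘ Fin.succAbove 5) ≠ 0 := by
    rw [← abs_ne_zero, abs_simplexDet_succAbove, abs_ne_zero]
    exact h.dependency_ne_zero P hK hK' 5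
  have hnew : z (subface U D x {0, 1}) = 0 := by
    refine linearIndependent_of_simplexDet_ne_zero hd _ fun i => ?_
    fin_cases i
    · have := hz.inner_eq_zero _ _ _ hs.2
      rw [real_inner_comm] at this
      exact this
    · exact hperp 2 (by decide)
    · exact hperp 3 (by decide)
    · exact hperp 4 (by decide)
  intro a ha
  rcases h.mem_edges_iff.1 (K'.orb_mem_orbits.2 ha) with h1 | h1
  · exact h0 a (K.orb_mem_orbits.1 h1)
  · obtain ⟨γ, rfl⟩ := orb_eq_orb.1 h1
    rw [hz.map_smul, hnew, map_zero]

/-- An edge deviation extends to the new edge with given variations of the areas of the new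
faces. -/
lemma exists_edgeDeviation (h : IsMove K K' D x {0, 1}) (hK : P.Nondegenerate K)
    (hK' : P.Nondegenerate K') {u : C → Fin 3 → E4} (hu : IsFrame U P u) {v : C → E4}
    (hv : v ∈ edgeDeviations K P) {S : Orb Γ C → ℝ}
    (hS : ∀ i ∈ K.orbits 2, areaVariation U P v i.out = S i) (hf : faceSum K K' P D x S = 0) :
    ∃ v' ∈ edgeDeviations K' P, (∀ a ∈ K.simplices 1, v' a = v a) ∧
      ∀ i ∈ K'.orbits 2, areaVariation U P v' i.out = S i := by
  classical
  have hx := h.enumerates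
  have hc : (U.verts (subface U D x {0, 1})).card = 2 := by
    rw [hx.card_subface ⟨0, by simp⟩]; rfl
  -- The components of the deviation of the new edge are solved for from three of the four new
  -- faces.
  obtain ⟨t, ht⟩ : ∃ t : Fin 3 → ℝ, newEdgeMatrix U P D x u *ᵥ t = fun j =>
      S (orb Γ (subface U D x {0, 1, ![2, 3, 4] j})) -
        areaVariation U P v (orb Γ (subface U D x {0, 1, ![2, 3, 4] j})).out :=
    Matrix.mulVec_surjective_iff_isUnit.2 ((Matrix.isUnit_iff_isUnit_det _).2
      (h.det_newEdgeMatrix_ne_zero hK hK' hu).isUnit) _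
  set w : Fin 3 → C → E4 := fun k a =>
    if orb Γ a = orb Γ (subface U D x {0, 1}) then u a k else 0
  have hw : ∀ k, IsEdgeField U P (w k) := IsEdgeField.of_frame hu hc
  set v' : C → E4 := fun a => v a + (t 0 • w 0 a + t 1 • w 1 a + t 2 • w 2 a) with hv'
  have hfield : IsEdgeField U P v' := (IsEdgeField.of_mem hv).add
    ((((hw 0).smul (t 0)).add ((hw 1).smul (t 1))).add ((hw 2).smul (t 2)))
  have hw0 : ∀ a, orb Γ a ≠ orb Γ (subface U D x {0, 1}) → ∀ k, w k a = 0 := fun a ha k =>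
    if_neg ha
  have hold : ∀ a ∈ K.simplices 1, v' a = v a := by
    intro a ha
    have hne : orb Γ a ≠ orb Γ (subface U D x {0, 1}) := fun ho =>
      h.newEdge_notMem (ho ▸ K.orb_mem_orbits.2 ha)
    simp [hv', hw0 a hne]
  refine ⟨v', ⟨fun a ha => ?_, fun a ha => hfield.inner_eq_zero _ _ _ (coe_verts_tuple ha.2),
    hfield.map_smul⟩, hold, ?_⟩
  · have hne : orb Γ a ≠ orb Γ (subface U D x {0, 1}) := fun ho =>
      ha (K'.orb_mem_orbits.1 (ho ▸ h.newEdge_mem))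
    have hva : v a = 0 := hv.1 a fun ha' =>
      ha (K'.orb_mem_orbits.1 (h.mem_edges_iff.2 (Or.inl (K.orb_mem_orbits.2 ha'))))
    simp [hv', hw0 a hne, hva]
  have hnew : ∀ j : Fin 3, areaVariation U P v'
      (orb Γ (subface U D x {0, 1, ![2, 3, 4] j})).out =
      S (orb Γ (subface U D x {0, 1, ![2, 3, 4] j})) := by
    intro j
    have h1 := congrFun ht j
    rw [Matrix.mulVec, dotProduct, Fin.sum_univ_three] at h1
    have h2 : ∀ k, newEdgeMatrix U P D x u j k = areaVariation U P (w k)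
        (orb Γ (subface U D x {0, 1, ![2, 3, 4] j})).out := fun k => rfl
    rw [hv', areaVariation_add, areaVariation_add (fun a => t 0 • w 0 a + t 1 • w 1 a),
      areaVariation_add (fun a => t 0 • w 0 a), areaVariation_smul, areaVariation_smul,
      areaVariation_smul, ← h2, ← h2, ← h2]
    linarith
  -- The area variation of the fourth new face, ABF, is forced by the relation among the faces of
  -- `D`.
  have hzero := eq_zero_of_faceSum (K := K) (K' := K') (P := P) (D := D) (x := x)
    (T := fun i => areaVariation U P v' i.out - S i) (g := orb Γ (subface U D x {0, 1, 5}))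
    (h.faceWeight_ne_zero hK hK' rfl (Or.inl (by decide)))
    (by rw [faceSum_sub, hf, h.faceSum_areaVariation hK hK' hfield, sub_zero])
    (fun i hi => by rw [areaVariation_congr_of_mem hold hi, hS i hi, sub_self])
    (fun i hi hne => by
      rcases h.mem_faces_iff.1 hi with h1 | ⟨k, hk, rfl⟩
      · rw [areaVariation_congr_of_mem hold h1, hS i h1, sub_self]
      · have hk' : ∃ j : Fin 3, k = ![2, 3, 4] j := by
          have : k ≠ 5 := by
            rintro rfl
            exact hne rfl
          clear * - hk this
          revert k
          decide
        obtain ⟨j, rfl⟩ := hk'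
        rw [hnew j, sub_self])
  exact fun i hi => sub_eq_zero.1 (hzero i hi)

lemma lengthSum_eq (h : IsMove K K' D x {0, 1}) (y : (V → E4) × (Γ → MotionAlgebra))
    (Ω : Orb Γ C → ℝ) : lengthSum K' P y Ω = lengthSum K P y Ω +
      Ω (orb Γ (subface U D x {0, 1})) *
        lengthVariation U P y (orb Γ (subface U D x {0, 1})).out := by
  classical
  have : (K'.orbits 1).toFinset = insert (orb Γ (subface U D x {0, 1})) (K.orbits 1).toFinset := by
    ext a
    rw [Finset.mem_insert, Set.mem_toFinset, Set.mem_toFinset, h.mem_edges_iff, or_comm]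
  rw [lengthSum, lengthSum, this, Finset.sum_insert (by simpa using h.newEdge_notMem), add_comm]

/-- Every edge of `D` lies in `K'`, so the relation between the length variations of `D` is one
between those of `K'`. -/
lemma lengthSum_edgeWeight (h : IsMove K K' D x {0, 1})
    {y : (V → E4) × (Γ → MotionAlgebra)} (hy : y ∈ displacements K P dg) :
    lengthSum K' P y (edgeWeight U P D x) = 0 :=
  sum_edgeWeight hy h.enumerates (h.mem_vertices (by decide)) fun k l hkl => by
    rw [Set.mem_toFinset, ← subface_pair, h.orb_subface_mem_new (Finset.card_pair hkl)
      (by norm_num)]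
    intro hn
    have := Finset.card_le_card hn
    rw [Finset.card_pair hkl] at this
    exact absurd this (by decide)

lemma edgeWeight_newEdge_ne_zero (h : IsMove K K' D x {0, 1}) (hK : P.Nondegenerate K)
    (hK' : P.Nondegenerate K') : edgeWeight U P D x (orb Γ (subface U D x {0, 1})) ≠ 0 := by
  rw [h.edgeWeight_eq P (by decide) (Or.inl (Finset.Subset.refl _))]
  exact mul_ne_zero (h.dependency_ne_zero P hK hK' _) (h.dependency_ne_zero P hK hK' _)

lemma lengthSum_sub_smul (K : Triangulation U) (y : (V → E4) × (Γ → MotionAlgebra))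
    (Ω w : Orb Γ C → ℝ) (c : ℝ) : lengthSum K P y (fun a => Ω a - c * w a) =
      lengthSum K P y Ω - c * lengthSum K P y w := by
  simp only [lengthSum, sub_mul, Finset.sum_sub_distrib, Finset.mul_sum, mul_assoc]

/-- The weights of the edges modulo the relation given by the 5-simplex. -/
lemma lengthSum_normalize (h : IsMove K K' D x {0, 1}) (hK : P.Nondegenerate K)
    (hK' : P.Nondegenerate K') (Ω : Orb Γ C → ℝ) {y : (V → E4) × (Γ → MotionAlgebra)}
    (hy : y ∈ displacements K P dg) :
    lengthSum K' P y Ω = lengthSum K P y fun a => Ω a - Ω (orb Γ (subface U D x {0, 1})) /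
      edgeWeight U P D x (orb Γ (subface U D x {0, 1})) * edgeWeight U P D x a := by
  have hw := h.edgeWeight_newEdge_ne_zero hK hK'
  have h1 := h.lengthSum_eq (P := P) y fun a => Ω a - Ω (orb Γ (subface U D x {0, 1})) /
      edgeWeight U P D x (orb Γ (subface U D x {0, 1})) * edgeWeight U P D x a
  rw [lengthSum_sub_smul, h.lengthSum_edgeWeight hy, mul_zero, sub_zero, div_mul_cancel₀ _ hw,
    sub_self, zero_mul, add_zero] at h1
  exact h1

end IsMove

end AddEdge

/-! ### Acyclicity under the moves 2 ↔ 4 -/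

section AddEdge

variable {Γ V C : Type*} [Group Γ] [MulAction Γ V] [MulAction Γ C] [PartialOrder C]
  {U : SimplicialCells Γ V C} {K K' : Triangulation U} {P : Development Γ V} {D : C}
  {x : Fin 6 → V} {dg : Submodule ℝ (Γ → MotionAlgebra)}

namespace IsMove

lemma edgeField_eq_of_vertexDeviation (h : IsMove K K' D x {0, 1}) (hK : P.Nondegenerate K)
    (hK' : P.Nondegenerate K') {σ : V → Matrix (Fin 4) (Fin 4) ℝ}
    (hσ : σ ∈ vertexDeviations K P) {v : C → E4} (hv : IsEdgeField U P v)
    (h0 : ∀ a ∈ K.simplices 1, edgeField U P σ a = v a)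
    (hA : ∀ i ∈ K'.orbits 2, areaVariation U P v i.out = 0) :
    ∀ a ∈ K'.simplices 1, edgeField U P σ a = v a := by
  intro a ha
  refine sub_eq_zero.1 (h.edgeField_eq_zero hK hK'
    ((IsEdgeField.of_vertexDeviation hσ).sub hv) (fun a ha => sub_eq_zero.2 (h0 a ha))
    (fun i hi => ?_) a ha)
  rw [areaVariation_sub, areaVariation_edgeField hσ (card_verts_out_of_mem hi), hA i hi, sub_zero]

/-- The edge deviations due to a vertex deviation do not change the areas. -/
lemma areaVariation_eq_zero {K : Triangulation U} {σ : V → Matrix (Fin 4) (Fin 4) ℝ}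
    (hσ : σ ∈ vertexDeviations K P) {K' : Triangulation U} {v : C → E4}
    (h0 : ∀ a ∈ K'.simplices 1, edgeField U P σ a = v a) :
    ∀ i ∈ K'.orbits 2, areaVariation U P v i.out = 0 := fun i hi => by
  rw [← areaVariation_congr_of_mem h0 hi, areaVariation_edgeField hσ (card_verts_out_of_mem hi)]

/-- The new row of the matrix is a nonzero multiple of `faceWeight`, so the condition it adds is
that `faceSum` vanish. For `K` the value of S at ABF is free and can be used to reach any `faceSum`.
Edge deviations restrict to `K`; those of `K` with prescribed areas extend by
`exists_edgeDeviation`, and `edgeField_eq_zero` supplies uniqueness. Weights of edges are extended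
by zero to the new edge, or normalised to zero there modulo `edgeWeight`. -/
lemma elementwiseAcyclic_iff (h : IsMove K K' D x {0, 1}) (hK : P.Nondegenerate K)
    (hK' : P.Nondegenerate K') {u : C → Fin 3 → E4} (hu : IsFrame U P u) :
    ElementwiseAcyclic K P dg ↔ ElementwiseAcyclic K' P dg := by
  have hV := h.vertices_eq (by decide) (by decide)
  have hE : K.orbits 1 ⊆ K'.orbits 1 := h.edges_subset (by decide)
  have hE1 := simplices_subset_of_orbits_subset hE
  have hF : K.orbits 2 ⊆ K'.orbits 2 := fun i hi => h.mem_faces_iff.2 (Or.inl hi)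
  have hg : orb Γ (subface U D x {0, 1, 5}) ∈ K'.orbits 2 := h.newFace_mem (by decide)
  have hgK : orb Γ (subface U D x {0, 1, 5}) ∉ K.orbits 2 := h.newFace_notMem (by decide)
  have hug : faceWeight U P D x (orb Γ (subface U D x {0, 1, 5})) ≠ 0 :=
    h.faceWeight_ne_zero hK hK' rfl (Or.inl (by decide))
  have hw := h.edgeWeight_newEdge_ne_zero hK hK'
  obtain ⟨c, hc0, hc⟩ := h.omegaSum_eq hK hK' ⟨2, by decide⟩
  have hnew : ∀ S, omegaSum K' P S (orb Γ (subface U D x {0, 1})) =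
      c * edgeWeight U P D x (orb Γ (subface U D x {0, 1})) * faceSum K K' P D x S := fun S => by
    rw [hc, omegaSum_eq_zero_of_edge h.newEdge_notMem, zero_add]
  have hadjust : ∀ (S : Orb Γ C → ℝ) (t : ℝ), ∃ S₁ : Orb Γ C → ℝ, (∀ i ∈ K.orbits 2, S₁ i = S i) ∧
      faceSum K K' P D x S₁ = t := fun S t => by
    obtain ⟨S₁, h1, h2⟩ := exists_faceSum_eq (K := K) (K' := K') S (Or.inr hg) hug t
    exact ⟨S₁, fun i hi => h1 i fun hi' => hgK (hi' ▸ hi), h2⟩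
  have hrestrict : ∀ v ∈ edgeDeviations K' P, ∃ v₁ ∈ edgeDeviations K P,
      (∀ a ∈ K.simplices 1, v₁ a = v a) := fun v hv => by
    classical
    exact ⟨_, (IsEdgeField.of_mem hv).restrict_mem K, fun a ha => if_pos ha⟩
  have hextend : ∀ Ω : Orb Γ C → ℝ, ∃ Ω₁ : Orb Γ C → ℝ, Ω₁ (orb Γ (subface U D x {0, 1})) = 0 ∧
      (∀ a ∈ K.orbits 1, Ω₁ a = Ω a) ∧
      ∀ y, lengthSum K P y Ω = lengthSum K' P y Ω₁ := fun Ω => by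
    classical
    have hold : ∀ a ∈ K.orbits 1, (if a = orb Γ (subface U D x {0, 1}) then 0 else Ω a) = Ω a :=
      fun a ha => if_neg fun ha' : a = orb Γ (subface U D x {0, 1}) =>
        h.newEdge_notMem (ha' ▸ ha)
    refine ⟨_, if_pos rfl, hold, fun y => ?_⟩
    rw [h.lengthSum_eq, if_pos rfl, zero_mul, add_zero]
    exact Finset.sum_congr rfl fun a ha =>
      congrArg (· * _) (hold a (Set.mem_toFinset.1 ha)).symm
  constructor
  · intro hA
    refine ⟨?_, ?_, ?_, ?_, ?_, ?_, ?_⟩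
    · rw [← trivialDeviations_congr hV, ← trivialFamily_congr hV]
      exact hA.injective
    · rw [← trivialDeviations_congr hV, ← trivialFamily_congr hV, ← vertexDeviations_congr hV]
      intro σ hσ
      rw [← hA.exact_vertex σ hσ]
      refine ⟨fun h0 a ha => h0 a (hE1 ha), fun h0 => ?_⟩
      exact h.edgeField_eq_zero hK hK' (IsEdgeField.of_vertexDeviation hσ) h0 fun i hi =>
        areaVariation_edgeField hσ (card_verts_out_of_mem hi)
    · rw [← vertexDeviations_congr hV]
      intro v hv
      constructor
      · intro h0
        obtain ⟨v₁, hv₁, hvv⟩ := hrestrict v hv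
        obtain ⟨σ, hσ, hσv⟩ := (hA.exact_edge v₁ hv₁).1 fun i hi => by
          rw [areaVariation_congr_of_mem hvv hi, h0 i (hF hi)]
        exact ⟨σ, hσ, h.edgeField_eq_of_vertexDeviation hK hK' hσ (IsEdgeField.of_mem hv)
          (fun a ha => (hσv a ha).trans (hvv a ha)) h0⟩
      · rintro ⟨σ, hσ, hσv⟩
        exact areaVariation_eq_zero hσ hσv
    · intro S
      constructor
      · intro h0
        have hf : faceSum K K' P D x S = 0 := by
          have := hnew S
          rw [h0 _ h.newEdge_mem, eq_comm, mul_eq_zero] at this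
          exact this.resolve_left (mul_ne_zero hc0 hw)
        obtain ⟨v, hv, hvS⟩ := (hA.exact_area S).1 fun a ha => by
          have := hc S a
          rwa [h0 a (hE ha), hf, mul_zero, add_zero, eq_comm] at this
        obtain ⟨v', hv', -, hS⟩ := h.exists_edgeDeviation hK hK' hu hv hvS hf
        exact ⟨v', hv', hS⟩
      · rintro ⟨v, hv, hvS⟩ a ha
        have hS : omegaSum K' P S = omegaSum K' P fun i => areaVariation U P v i.out :=
          omegaSum_congr fun i hi => (hvS i hi).symm
        have hf := h.faceSum_areaVariation hK hK' (IsEdgeField.of_mem hv)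
        rw [hS, hc, hf, mul_zero, add_zero]
        rcases h.mem_edges_iff.1 ha with h1 | rfl
        · obtain ⟨v₁, hv₁, hvv⟩ := hrestrict v hv
          exact (hA.exact_area _).2 ⟨v₁, hv₁, fun i hi => areaVariation_congr_of_mem hvv hi⟩ a h1
        · exact omegaSum_eq_zero_of_edge h.newEdge_notMem
    · rw [← displacements_congr hV]
      intro Ω
      set r := Ω (orb Γ (subface U D x {0, 1})) /
        edgeWeight U P D x (orb Γ (subface U D x {0, 1})) with hr
      have h1 : (∀ y ∈ displacements K P dg, lengthSum K' P y Ω = 0) ↔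
          ∀ y ∈ displacements K P dg,
            lengthSum K P y (fun a => Ω a - r * edgeWeight U P D x a) = 0 :=
        forall₂_congr fun y hy => by rw [h.lengthSum_normalize hK hK' Ω hy]
      rw [h1, hA.exact_omega]
      constructor
      · rintro ⟨S, hS⟩
        -- With this value the rank-one term equals r times `edgeWeight`, which restores the part of
        -- `Ω` removed by the normalisation.
        obtain ⟨S₁, hS₁, hf⟩ := hadjust S (r / c)
        refine ⟨S₁, fun a ha => ?_⟩
        rw [hc, hf]
        rcases h.mem_edges_iff.1 ha with h1 | rfl
        · rw [omegaSum_congr hS₁, hS a h1]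
          field_simp
          ring
        · rw [omegaSum_eq_zero_of_edge h.newEdge_notMem, hr]
          field_simp
          ring
      · rintro ⟨S, hS⟩
        refine ⟨S, fun a ha => ?_⟩
        have h2 := hc S a
        have h3 := hnew S
        rw [hS _ h.newEdge_mem] at h3
        rw [hS a (hE ha)] at h2
        rw [hr, h3, h2]
        field_simp
        ring
    · rw [← displacements_congr hV, ← motionField_congr hV]
      intro φ
      rw [hA.exact_displacement]
      constructor
      · rintro ⟨Ω, hΩ⟩
        obtain ⟨Ω₁, -, -, h1⟩ := hextend Ω
        exact ⟨Ω₁, fun y hy => (hΩ y hy).trans (h1 y)⟩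
      · rintro ⟨Ω, hΩ⟩
        exact ⟨_, fun y hy => (hΩ y hy).trans (h.lengthSum_normalize hK hK' Ω hy)⟩
    · rw [← motionField_congr hV]
      exact hA.surjective
  · intro hA
    refine ⟨?_, ?_, ?_, ?_, ?_, ?_, ?_⟩
    · rw [trivialDeviations_congr hV, trivialFamily_congr hV]
      exact hA.injective
    · rw [trivialDeviations_congr hV, trivialFamily_congr hV]
      intro σ hσ
      have := hA.exact_vertex σ (vertexDeviations_congr (P := P) hV ▸ hσ)
      rw [← this]
      refine ⟨fun h0 => ?_, fun h0 a ha => h0 a (hE1 ha)⟩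
      exact h.edgeField_eq_zero hK hK' (IsEdgeField.of_vertexDeviation hσ) h0 fun i hi =>
        areaVariation_edgeField hσ (card_verts_out_of_mem hi)
    · rw [vertexDeviations_congr hV]
      intro v hv
      constructor
      · intro h0
        obtain ⟨v', hv', hvv, hvS⟩ := h.exists_edgeDeviation hK hK' hu hv (S := 0)
          (fun i hi => h0 i hi) (by simp [faceSum])
        obtain ⟨σ, hσ, hσv⟩ := (hA.exact_edge v' hv').1 hvS
        exact ⟨σ, hσ, fun a ha => (hσv a (hE1 ha)).trans (hvv a ha)⟩
      · rintro ⟨σ, hσ, hσv⟩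
        exact areaVariation_eq_zero hσ hσv
    · intro S
      -- The value at ABF, which `K` does not see, is chosen so that the new row gives zero and the
      -- old rows are unchanged.
      obtain ⟨S₁, hS₁, hf⟩ := hadjust S 0
      constructor
      · intro h0
        obtain ⟨v, hv, hvS⟩ := (hA.exact_area S₁).1 fun a ha => by
          rw [hc, hf, mul_zero, add_zero, omegaSum_congr hS₁]
          rcases h.mem_edges_iff.1 ha with h1 | rfl
          · exact h0 a h1
          · exact omegaSum_eq_zero_of_edge h.newEdge_notMem
        obtain ⟨v₁, hv₁, hvv⟩ := hrestrict v hv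
        exact ⟨v₁, hv₁, fun i hi => by
          rw [areaVariation_congr_of_mem hvv hi, hvS i (hF hi), hS₁ i hi]⟩
      · rintro ⟨v, hv, hvS⟩ a ha
        have hS : omegaSum K P S = omegaSum K P fun i => areaVariation U P v i.out :=
          omegaSum_congr fun i hi => (hvS i hi).symm
        have h1 := hc (fun i => areaVariation U P v i.out) a
        rw [h.faceSum_areaVariation hK hK' (IsEdgeField.of_mem hv), mul_zero, add_zero] at h1
        rw [hS, ← h1]
        exact (hA.exact_area _).2
          ⟨v, mem_edgeDeviations_of_subset hE hv, fun _ _ => rfl⟩ a (hE ha)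
    · rw [displacements_congr hV]
      intro Ω
      obtain ⟨Ω₁, hΩ₁, hold, h1⟩ := hextend Ω
      simp only [h1]
      rw [hA.exact_omega]
      constructor
      · rintro ⟨S, hS⟩
        have hf : faceSum K K' P D x S = 0 := by
          have := hnew S
          rw [hS _ h.newEdge_mem, hΩ₁, eq_comm, mul_eq_zero] at this
          exact this.resolve_left (mul_ne_zero hc0 hw)
        refine ⟨S, fun a ha => ?_⟩
        have h2 := hc S a
        rw [hf, mul_zero, add_zero] at h2
        rw [← h2, hS a (hE ha), hold a ha]
      · rintro ⟨S, hS⟩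
        obtain ⟨S₁, hS₁, hf⟩ := hadjust S 0
        refine ⟨S₁, fun a ha => ?_⟩
        rw [hc, hf, mul_zero, add_zero, omegaSum_congr hS₁]
        rcases h.mem_edges_iff.1 ha with h2 | rfl
        · rw [hS a h2, hold a h2]
        · rw [omegaSum_eq_zero_of_edge h.newEdge_notMem, hΩ₁]
    · rw [motionField_congr hV]
      intro φ
      rw [hA.exact_displacement, ← displacements_congr hV]
      constructor
      · rintro ⟨Ω, hΩ⟩
        exact ⟨_, fun y hy => (hΩ y hy).trans (h.lengthSum_normalize hK hK' Ω hy)⟩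
      · rintro ⟨Ω, hΩ⟩
        obtain ⟨Ω₁, -, -, h1⟩ := hextend Ω
        exact ⟨Ω₁, fun y hy => (hΩ y hy).trans (h1 y)⟩
    · rw [motionField_congr hV]
      exact hA.surjective

end IsMove

end AddEdge

section Quantity

variable {Γ V C : Type*} [Group Γ] [MulAction Γ V] [MulAction Γ C] [PartialOrder C]
  {U : SimplicialCells Γ V C} {K K' : Triangulation U} {P : Development Γ V} {D : C}
  {x : Fin 6 → V}

/-! ### Invariance of the quantity -/

/-- Write S_k for the area of the face on `x 0`, `x 1`, `x k`, and δ_k for absolute values. The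
minors acquire the factors δ_0 δ_1 S_5 / (δ_2 δ_3 δ_4) and l⁵ δ_5 / (8 S_2 S_3 S_4). The volumes
contribute δ_2 δ_3 δ_4 δ_5 / (24² δ_0 δ_1), the edges 72 l⁵ and the areas 1 / (S_2 S_3 S_4 S_5).
Everything cancels, since 8 · 72 = 24². -/
lemma IsMove.abs_quantity_add_edge (h : IsMove K K' D x {0, 1}) (hK : P.Nondegenerate K)
    (hK' : P.Nondegenerate K') {u : C → Fin 3 → E4} (hu : IsFrame U P u) {m m' n n' : ℝ}
    (hm : |m'| = |m| * (|dependency (P.pos ∘ x) 0| * |dependency (P.pos ∘ x) 1| *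
      (P.area U (subface U D x {0, 1, 5}) / ∏ k ∈ ({0, 1, 5} : Finset (Fin 6))ᶜ,
        |dependency (P.pos ∘ x) k|)))
    (hn : n' = n * (newEdgeMatrix U P D x u).det) :
    |quantity P K m n| = |quantity P K' m' n'| := by
  obtain ⟨cV, hV, hV'⟩ := h.prodVolume_eq P
  obtain ⟨cA, hA, hA'⟩ := h.prodArea_eq P
  obtain ⟨cE, hE, hE'⟩ := h.prodEdge_eq P
  have hδ := h.dependency_ne_zero P hK hK'
  have hδ' : ∀ k, 0 < |dependency (P.pos ∘ x) k| := fun k => abs_pos.2 (hδ k)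
  have ha : ∀ j : Fin 6, ({0, 1, j} : Finset (Fin 6)).card = 3 →
      0 < P.area U (subface U D x {0, 1, j}) := fun j hj => h.area_pos P hK hK' hj
  have a2 := ha 2 (by decide)
  have a3 := ha 3 (by decide)
  have a4 := ha 4 (by decide)
  have a5 := ha 5 (by decide)
  have hl := h.length_pos hK hK'
  rw [show ({0, 1}ᶜ : Finset (Fin 6)) = {2, 3, 4, 5} from by decide] at hV' hA hE
  rw [show (Finset.univ.powersetCard 3).filter (fun s : Finset (Fin 6) => {2, 3, 4, 5} ⊆ s) = ∅
    from by decide, Finset.prod_empty, mul_one] at hA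
  rw [show (Finset.univ.powersetCard 2).filter (fun s : Finset (Fin 6) => {2, 3, 4, 5} ⊆ s) = ∅
    from by decide, Finset.prod_empty, mul_one] at hE
  rw [show (Finset.univ.powersetCard 3).filter (fun s : Finset (Fin 6) => {0, 1} ⊆ s) =
    {{0, 1, 2}, {0, 1, 3}, {0, 1, 4}, {0, 1, 5}} from by decide,
    Finset.prod_insert (by decide), Finset.prod_insert (by decide), Finset.prod_pair (by decide)]
    at hA'
  rw [show (Finset.univ.powersetCard 2).filter (fun s : Finset (Fin 6) => {0, 1} ⊆ s) =
    {{0, 1}} from by decide, Finset.prod_singleton] at hE'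
  rw [Finset.prod_pair (by decide)] at hV
  rw [Finset.prod_insert (by decide), Finset.prod_insert (by decide),
    Finset.prod_pair (by decide)] at hV'
  rw [show ({0, 1, 5}ᶜ : Finset (Fin 6)) = {2, 3, 4} from by decide,
    Finset.prod_insert (by decide), Finset.prod_pair (by decide)] at hm
  have hdet := h.abs_det_newEdgeMatrix hK hK' hu
  rw [quantity, quantity, hn, hV, hV', hA, hA', hE, hE']
  simp only [abs_mul, abs_div, hm, hdet, abs_abs, abs_of_pos a2, abs_of_pos a3, abs_of_pos a4,
    abs_of_pos a5, abs_pow, abs_of_pos hl, Nat.abs_ofNat]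
  have d0 := (hδ' 0).ne'
  have d1 := (hδ' 1).ne'
  have d2 := (hδ' 2).ne'
  have d3 := (hδ' 3).ne'
  have d4 := (hδ' 4).ne'
  have d5 := (hδ' 5).ne'
  generalize |dependency (P.pos ∘ x) 0| = δ0 at *
  generalize |dependency (P.pos ∘ x) 1| = δ1 at *
  generalize |dependency (P.pos ∘ x) 2| = δ2 at *
  generalize |dependency (P.pos ∘ x) 3| = δ3 at *
  generalize |dependency (P.pos ∘ x) 4| = δ4 at *
  generalize |dependency (P.pos ∘ x) 5| = δ5 at *
  generalize P.area U (subface U D x {0, 1, 2}) = A2 at *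
  generalize P.area U (subface U D x {0, 1, 3}) = A3 at *
  generalize P.area U (subface U D x {0, 1, 4}) = A4 at *
  generalize P.area U (subface U D x {0, 1, 5}) = A5 at *
  generalize P.length U (subface U D x {0, 1}) = l at *
  generalize |m| = m₁
  generalize |n| = n₁
  generalize |cV| = v₁
  generalize |cA| = a₁
  generalize |cE| = e₁
  -- A zero denominator, in the minor or in the product of the common areas, makes both sides zero
  -- by convention.
  by_cases hn₁ : n₁ = 0
  · simp [hn₁]
  by_cases ha₁ : a₁ = 0
  · simp [ha₁]
  field_simp
  ring

/-- The facets opposite to `x j` are old for j ∈ J and new for j ∉ J. So the factor acquired by the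
minor is exactly inverse to the change of ∏ V / ∏ S, with the same powers of 24 on both sides. -/
lemma IsMove.abs_mul_prodVolume_div_prodArea (h : IsMove K K' D x {3, 4, 5})
    (hK : P.Nondegenerate K) (hK' : P.Nondegenerate K') {m m' : ℝ}
    (hm : |m'| = |m| * ((P.area U (subface U D x {3, 4, 5}) /
      ∏ k ∈ ({3, 4, 5} : Finset (Fin 6))ᶜ, |dependency (P.pos ∘ x) k|) /
      (P.area U (subface U D x {3, 4, 5}ᶜ) /
        ∏ k ∈ ({3, 4, 5} : Finset (Fin 6)), |dependency (P.pos ∘ x) k|))) :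
    |m * prodVolume P K / prodArea P K| = |m' * prodVolume P K' / prodArea P K'| := by
  obtain ⟨cV, hV, hV'⟩ := h.prodVolume_eq P
  obtain ⟨cA, hA, hA'⟩ := h.prodArea_eq P
  have hδ := h.dependency_ne_zero P hK hK'
  have a0 := h.area_pos P hK hK' (s := {3, 4, 5}) rfl
  have a1 := h.area_pos P hK hK' (s := {3, 4, 5}ᶜ) rfl
  rw [show (Finset.univ.powersetCard 3).filter (fun s : Finset (Fin 6) => {3, 4, 5}ᶜ ⊆ s) =
    {{3, 4, 5}ᶜ} from by decide, Finset.prod_singleton] at hA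
  rw [show (Finset.univ.powersetCard 3).filter (fun s : Finset (Fin 6) => {3, 4, 5} ⊆ s) =
    {{3, 4, 5}} from by decide, Finset.prod_singleton] at hA'
  rw [Finset.prod_div_distrib, Finset.prod_const] at hV hV'
  rw [show ({3, 4, 5} : Finset (Fin 6)).card = 3 from rfl] at hV
  rw [show ({3, 4, 5}ᶜ : Finset (Fin 6)).card = 3 from rfl] at hV'
  have p0 : 0 < ∏ k ∈ ({3, 4, 5} : Finset (Fin 6)), |dependency (P.pos ∘ x) k| :=
    Finset.prod_pos fun k _ => abs_pos.2 (hδ k)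
  have p1 : 0 < ∏ k ∈ ({3, 4, 5} : Finset (Fin 6))ᶜ, |dependency (P.pos ∘ x) k| :=
    Finset.prod_pos fun k _ => abs_pos.2 (hδ k)
  rw [hV, hV', hA, hA']
  simp only [abs_mul, abs_div, hm, abs_of_pos a0, abs_of_pos a1, abs_of_pos p0, abs_of_pos p1,
    abs_pow, Nat.abs_ofNat]
  field_simp

lemma IsMove.prodEdge_congr (h : IsMove K K' D x {3, 4, 5}) : prodEdge P K = prodEdge P K' := by
  obtain ⟨c, hE, hE'⟩ := h.prodEdge_eq P
  rw [show (Finset.univ.powersetCard 2).filter (fun s : Finset (Fin 6) => {3, 4, 5}ᶜ ⊆ s) = ∅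
    from by decide, Finset.prod_empty] at hE
  rw [show (Finset.univ.powersetCard 2).filter (fun s : Finset (Fin 6) => {3, 4, 5} ⊆ s) = ∅
    from by decide, Finset.prod_empty] at hE'
  rw [hE, hE']

end Quantity

end FourManifold

/-! ### Assembly of the theorem -/

open FourManifold in
theorem mainTheorem4 {Γ V C : Type*} [Group Γ] [MulAction Γ V] [MulAction Γ C] [PartialOrder C]
    (U : SimplicialCells Γ V C) (P : Development Γ V)
    (dg : Submodule ℝ (Γ → MotionAlgebra)) (hdg : dg ≤ cocycles P)
    (u : C → Fin 3 → E4) (hu : IsFrame U P u)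
    (K K' : Triangulation U) (hK : P.Nondegenerate K) (hK' : P.Nondegenerate K')
    (D : C) (x : Fin 6 → V) :
    -- move 2 → 4 (read from `K'` to `K`: move 4 → 2); the vertices are `A = x 0, …, F = x 5`
    (IsMove K K' D x {0, 1} →
      (Acyclic K P dg ↔ Acyclic K' P dg) ∧
      ∀ {ι κ : Type} [Fintype ι] [DecidableEq ι] [Fintype κ] [DecidableEq κ]
        (a i : ι → Orb Γ C) (j : κ → Orb Γ C) (b : κ → Orb Γ C × Fin 3),
        (∀ k, a k ∈ K.orbits 1) → (∀ k, i k ∈ K.orbits 2) →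
        (∀ k, j k ∈ K.orbits 2) → (∀ k, (b k).1 ∈ K.orbits 1) →
        let m := minorOmega P K a i
        let n := minorArea U P u j b
        let m' := minorOmega P K'
          (Sum.elim a fun _ : Unit => orb Γ (U.face D {x 0, x 1}))
          (Sum.elim i fun _ : Unit => orb Γ (U.face D {x 0, x 1, x 5}))
        let n' := minorArea U P u
          (Sum.elim j fun k : Fin 3 => orb Γ (U.face D {x 0, x 1, ![x 2, x 3, x 4] k}))
          (Sum.elim b fun k : Fin 3 => (orb Γ (U.face D {x 0, x 1}), k))
        (m ≠ 0 ↔ m' ≠ 0) ∧ (n ≠ 0 ↔ n' ≠ 0) ∧ |quantity P K m n| = |quantity P K' m' n'|) ∧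
    -- move 3 → 3: the face `ABC` is replaced by the face `DEF`
    (IsMove K K' D x {3, 4, 5} →
      (Acyclic K P dg ↔ Acyclic K' P dg) ∧
      ∀ {ι κ : Type} [Fintype ι] [DecidableEq ι] [Fintype κ] [DecidableEq κ]
        (a : ι ⊕ Unit → Orb Γ C) (i : ι → Orb Γ C) (j : κ → Orb Γ C) (b : κ → Orb Γ C × Fin 3),
        (∀ k, a k ∈ K.orbits 1) →
        (∀ k, i k ∈ K.orbits 2 ∧ i k ≠ orb Γ (U.face D {x 0, x 1, x 2})) →
        (∀ k, j k ∈ K.orbits 2 ∧ j k ≠ orb Γ (U.face D {x 0, x 1, x 2})) →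
        (∀ k, (b k).1 ∈ K.orbits 1) →
        let m := minorOmega P K a
          (Sum.elim i fun _ : Unit => orb Γ (U.face D {x 0, x 1, x 2}))
        let m' := minorOmega P K' a
          (Sum.elim i fun _ : Unit => orb Γ (U.face D {x 3, x 4, x 5}))
        let n := minorArea U P u j b
        (m ≠ 0 ↔ m' ≠ 0) ∧
        |m * prodVolume P K / prodArea P K| = |m' * prodVolume P K' / prodArea P K'| ∧
        |quantity P K m n| = |quantity P K' m' n|) := by
  refine ⟨fun h => ⟨?_, ?_⟩, fun h => ⟨?_, ?_⟩⟩
  · rw [acyclic_iff, acyclic_iff]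
    exact h.elementwiseAcyclic_iff hK hK' hu
  · intro ι κ _ _ _ _ a i j b _ hi hj _
    dsimp only
    have hvec : ∀ k : Fin 3, U.face D {x 0, x 1, ![x 2, x 3, x 4] k} =
        subface U D x {0, 1, ![2, 3, 4] k} := fun k => by
      rw [subface_triple]
      fin_cases k <;> rfl
    simp only [hvec, ← subface_triple, ← subface_pair]
    have hm := h.minorOmega_border P hK hK' ⟨2, by decide⟩ (k := 0) (l := 1) (s := {0, 1, 5})
      (by decide) (Finset.Subset.refl _) rfl (by decide) a i hi
    have hn := h.minorArea_border (P := P) u j b hj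
    refine ⟨?_, ?_, h.abs_quantity_add_edge hK hK' hu hm hn⟩
    · rw [← abs_pos, ← abs_pos, hm]
      refine (mul_pos_iff_of_pos_right ?_).symm
      have hδ : ∀ k, 0 < |dependency (P.pos ∘ x) k| := fun k =>
        abs_pos.2 (h.dependency_ne_zero P hK hK' k)
      exact mul_pos (mul_pos (hδ 0) (hδ 1))
        (div_pos (h.area_pos P hK hK' rfl) (Finset.prod_pos fun k _ => hδ k))
    · rw [hn]
      exact (mul_ne_zero_iff_right (h.det_newEdgeMatrix_ne_zero hK hK' hu)).symm
  · rw [acyclic_iff, acyclic_iff]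
    -- The inverse move is of the same type, because the complement of {3, 4, 5} again has three
    -- elements.
    exact ⟨h.elementwiseAcyclic_of_replace hK hK' rfl,
      h.symm.elementwiseAcyclic_of_replace hK' hK rfl⟩
  · intro ι κ _ _ _ _ a i j b _ hi _ _
    dsimp only
    have hm := h.minorOmega_replace P hK hK' rfl a i fun k => (hi k).1
    have hq := h.abs_mul_prodVolume_div_prodArea hK hK' hm
    have hJ : ({3, 4, 5}ᶜ : Finset (Fin 6)) = {0, 1, 2} := by decide
    rw [hJ] at hm hq
    rw [← subface_triple, ← subface_triple]
    refine ⟨?_, hq, ?_⟩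
    · rw [← abs_pos, ← abs_pos, hm]
      refine (mul_pos_iff_of_pos_right ?_).symm
      have hδ : ∀ k, 0 < |dependency (P.pos ∘ x) k| := fun k =>
        abs_pos.2 (h.dependency_ne_zero P hK hK' k)
      exact div_pos (div_pos (h.area_pos P hK hK' rfl) (Finset.prod_pos fun k _ => hδ k))
        (div_pos (h.area_pos P hK hK' rfl) (Finset.prod_pos fun k _ => hδ k))
    -- The edges and the minor of (∂S/∂v) are common to both triangulations, so the quantity is the
    -- invariant expression just treated times a common factor.
    · have e : ∀ (L : Triangulation U) (m n : ℝ), quantity P L m n =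
          m * prodVolume P L / prodArea P L * (prodEdge P L / n) := fun L m n => by
        rw [quantity]
        ring
      rw [e, e, abs_mul, abs_mul, hq, h.prodEdge_congr]
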